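/- **Setting.** Let $t$ be a parameter ranging over the integers. *Terms* have the form $f_0(t)+\sum_i f_i(t)\,x_i+\sum_i f'_i(t)\lfloor \tau_i/t^{d_i}\rfloor+\sum_i f''_i(t)\,(\tau_i \bmod g_i(t))$ with $f_i,f'_i,f''_i,g_i\in\mathbb Z[t]$, $d_i\in\mathbb N$, integer variables $x_i$ and terms $\tau_i$; here $(x \bmod 0)=x$, and $(x\bmod g)\in[0,|g|-1]$ for $g\neq0$. A term is *linear* if neither $\lfloor\cdot/t^d\rfloor$ nor $(\cdot \bmod g)$ occurs in it, and *non-shifted* if $f_0=0$. *Constraints* are $\tau=0$, $\tau\le 0$ and $f(t)\mid\tau$ (where $0\mid\tau$ means $\tau=0$). A formula is a *positive Boolean combination* of constraints (only $\wedge,\vee$). For $\vec w=(w_1,\dots,w_n)$ and $B(w_i)\in\mathbb Z[t]$, the formula $\exists\vec w\le B:\phi$ means $\exists \vec w:\bigwedge_i(0\le w_i\le B(w_i))\wedge\phi$. Throughout, two formulae are *equivalent* if they have the same truth value for every integer $t\ge 2$ and all integer values of their free variables. The bit size of $f\in\mathbb Z[t]$ is $(\deg f+1)(\lceil\log_2(h(f)+1)\rceil+1)$,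 with $h(f)$ the largest absolute value of a coefficient. The $1$-norm $\|\rho\|_1$ of a term with integer coefficients is the sum of the absolute values of its constant and its coefficients. **Procedure BoundedQE** (non-deterministic). Input: $\exists\vec x:\phi$, with $\phi$ a positive Boolean combination of linear constraints. 1. Guess a set $Z$ of divisors of $\phi$; replace $f\mid\tau$ by $\tau=0$ for each $f\in Z$ and conjoin $f(t)=0$ for each $f\in Z$. Guess a sign $\pm$, let $m:=\pm\prod f$ over the remaining divisors, and let $\chi:=(m>0)$. Set the current sign to $+$, $\ell:=1$, $B:=\varnothing$. Replace each inequality $\tau\le0$ by $\tau+y=0$ with a fresh slack variable $y$. 2. For each $x$ in $\vec x$, in order, either set $B(x):=m-1$ and go on with the next variable; or guess an equality $f x+\tau=0$ of $\phi$ with $f\ne0$ and a sign $\pm$ (the new current sign), and: conjoin $\pm f>0$ to $\chi$; set $m:=\pm f\cdot m$; if $\tau$ contains a slack variable $y$ with $B(y)$ undefined, set $B(y):=m-1$; multiply every equality and every divisibility (both sides) of $\phi$ by $f$ and replace $f x$ by $-\tau$; divide every constraint (both sides for divisibilities) by $\ell$; conjoin $f\mid\tau$ to $\phi$; set $\ell:=f$.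 3. In each equality $\eta=0$ with a slack variable without bound, delete this variable and write $\eta\le0$ if the current sign is $+$, and $\eta\ge0$ otherwise. Return $\exists\vec w\le B:\phi\wedge\chi$, with $\vec w$ the variables on which $B$ is defined. **Procedure ElimBounded** (non-deterministic). Input: $\exists\vec w\le B:\phi(\vec w,\vec z)$, where $\phi$ is a positive Boolean combination of linear equalities, linear inequalities, and constraints $\sigma(\vec w)+(\tau(\vec z)\bmod f(t))=0$ with $\sigma$ linear and $\tau$ linear and non-shifted. 1. Conjoin $0\le w\wedge w\le B(w)$ for each $w$ in $\vec w$. With $M$ the largest bit size of the $B(w)$, replace each $w$ by $t^My_M+\dots+ty_1+y_0$ with fresh variables ($t$-digits), and conjoin $0\le y_i\wedge y_i\le t-1$. Let $\vec y$ be the vector of all digits and $\phi_\varnothing(\vec y,\vec z)$ the resulting formula. 2. While some (in)equality of the current formula has a non-integer coefficient (in $\mathbb Z[t]$) at some digit, select such an (in)equality (by any fixed selection rule); write it as $\eta=0$, respectively as $\eta<0$ (with $\eta=\eta_0-1$ for an inequality $\eta_0\le0$). Write $\eta=\sigma(\vec y)t+\rho(\vec y)+\tau(\vec z)$ with $\sigma$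 linear, $\rho$ linear without $t$, $\tau$ non-shifted; put $\rho':=\rho+(\tau\bmod t)$ and guess an integer $r\in[-\|\rho'\|_1,\|\rho'\|_1]$. Replace the equality by $t r=\rho'\,\wedge\,\sigma+r+\lfloor\tau/t\rfloor=0$, respectively the inequality by $t r\le\rho'\,\wedge\,\rho'\le t(r+1)-1\,\wedge\,\sigma+(r+1)+\lfloor\tau/t\rfloor\le0$. (A term $\lfloor\lfloor\tau/t^k\rfloor/t\rfloor$ is written $\lfloor\tau/t^{k+1}\rfloor$.) 3. Replace each non-shifted term $\tau(\vec z)$ in the constraints by a fresh variable $z'$; call BoundedQE to eliminate $\vec y$; in its output $\exists\vec w'\le B':\psi$ replace each $w$ in $\vec w'$ by a guessed integer in $[0,B'(w)]$; put the terms $\tau(\vec z)$ back for the variables $z'$; return the result. The *$\vec y$-degree* of an (in)equality is the largest degree in $t$ of a coefficient of a variable of $\vec y$; that of $\phi_1\wedge\phi_2$ and of $\phi_1\vee\phi_2$ is the sum of the $\vec y$-degrees of $\phi_1$ and $\phi_2$. **Lemma.** ElimBounded is correct. That is, for every admissible input $\exists\vec w\le B:\phi(\vec w,\vec z)$ and every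 selection rule in step 2: 1. each iteration of the while loop strictly decreases the $\vec y$-degree of the formula (so the loop terminates); 2. in every output $\exists\vec w'\le B':\psi$ of the call to BoundedQE, all bounds $B'(w)$ are integers, and $\psi$ contains no variables other than those in $\vec w'$ and the variables $z'$; 3. the set of outputs $\psi_\beta$ over all non-deterministic branches $\beta$ of ElimBounded is finite, each $\psi_\beta(\vec z)$ is a quantifier-free positive Boolean combination of constraints with variables in $\vec z$, and in each divisibility constraint $f(t)\mid\tau$ of $\psi_\beta$ the divisor $f(t)$ is an integer; 4. $\exists\vec w\le B:\phi(\vec w,\vec z)$ is equivalent to $\bigvee_\beta\psi_\beta(\vec z)$. -/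

import Mathlib

open Polynomial

/-! ### Syntax and semantics of one-parametric Presburger arithmetic

The parameter `t` is the indeterminate `X` of `ℤ[X]`; its value is an integer `k`. -/

/-- Terms in normal form: a constant `f₀(t)` plus a finite sum of summands
`f(t) * v` (`v` a variable), `f(t) * ⌊τ / t ^ d⌋` and `f(t) * (τ mod g(t))`. -/
inductive Term (V : Type*) where
  | const (f : ℤ[X]) : Term V
  | addVar (f : ℤ[X]) (v : V) (rest : Term V) : Term V
  | addDiv (f : ℤ[X]) (τ : Term V) (d : ℕ) (rest : Term V) : Term V
  | addMod (f : ℤ[X]) (τ : Term V) (g : ℤ[X]) (rest : Term V) : Term V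

namespace Term

variable {V W : Type*}

/-- Value of a term. `Int.fdiv` is division rounded towards `-∞`; `Int.emod x 0 = x`, and
`Int.emod x g ∈ [0, |g| - 1]` for `g ≠ 0`. -/
def eval (k : ℤ) (ν : V → ℤ) : Term V → ℤ
  | const f => f.eval k
  | addVar f v rest => f.eval k * ν v + rest.eval k ν
  | addDiv f τ d rest => f.eval k * Int.fdiv (τ.eval k ν) (k ^ d) + rest.eval k ν
  | addMod f τ g rest => f.eval k * Int.emod (τ.eval k ν) (g.eval k) + rest.eval k ν

/-- No integer division and no integer remainder function occurs. -/
def Linear : Term V → Prop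
  | const _ => True
  | addVar _ _ rest => rest.Linear
  | addDiv _ _ _ _ => False
  | addMod _ _ _ _ => False

/-- The constant `f₀(t)` of the term. -/
def constCoeff : Term V → ℤ[X]
  | const f => f
  | addVar _ _ rest => rest.constCoeff
  | addDiv _ _ _ rest => rest.constCoeff
  | addMod _ _ _ rest => rest.constCoeff

def NonShifted (τ : Term V) : Prop := τ.constCoeff = 0

noncomputable def add : Term V → Term V → Term V
  | const f, const g => const (f + g)
  | const f, addVar g v r => addVar g v (add (const f) r)
  | const f, addDiv g τ d r => addDiv g τ d (add (const f) r)
  | const f, addMod g τ h r => addMod g τ h (add (const f) r)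
  | addVar f v r, s => addVar f v (add r s)
  | addDiv f τ d r, s => addDiv f τ d (add r s)
  | addMod f τ g r, s => addMod f τ g (add r s)

noncomputable def smul (c : ℤ[X]) : Term V → Term V
  | const f => const (c * f)
  | addVar f v r => addVar (c * f) v (smul c r)
  | addDiv f τ d r => addDiv (c * f) τ d (smul c r)
  | addMod f τ g r => addMod (c * f) τ g (smul c r)

/-- Simultaneous substitution of terms for variables. -/
noncomputable def subst (s : V → Term W) : Term V → Term W
  | const f => const f
  | addVar f v r => ((s v).smul f).add (r.subst s)
  | addDiv f τ d r => addDiv f (τ.subst s) d (r.subst s)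
  | addMod f τ g r => addMod f (τ.subst s) g (r.subst s)

/-- The term consisting of a single variable. -/
noncomputable def var (v : V) : Term V := addVar 1 v (const 0)

/-- Renaming of variables. -/
def rename (s : V → W) : Term V → Term W
  | const f => const f
  | addVar f v r => addVar f (s v) (r.rename s)
  | addDiv f τ d r => addDiv f (τ.rename s) d (r.rename s)
  | addMod f τ g r => addMod f (τ.rename s) g (r.rename s)

/-- The term `τ mod t`. -/
noncomputable def modT (τ : Term V) : Term V := addMod 1 τ X (const 0)

open Classical in
/-- The term `⌊τ / t⌋`, where `⌊⌊τ' / t ^ d⌋ / t⌋` is written as `⌊τ' / t ^ (d + 1)⌋`. -/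
noncomputable def divT (τ : Term V) : Term V :=
  match τ with
  | addDiv f τ' d (const g) =>
      if f = 1 ∧ g = 0 then addDiv 1 τ' (d + 1) (const 0) else addDiv 1 τ 1 (const 0)
  | _ => addDiv 1 τ 1 (const 0)

end Term

/-- The constraints `τ = 0`, `τ ≤ 0` and `f(t) ∣ τ`, where `τ` belongs to a type `T` of terms. -/
inductive Constraint (T : Type*) where
  | eq (τ : T) : Constraint T
  | le (τ : T) : Constraint T
  | dvd (f : ℤ[X]) (τ : T) : Constraint T

namespace Constraint

variable {T T' : Type*}

/-- Truth of a constraint, given the value `k` of the parameter and the values of terms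
(in `ℤ`, `0 ∣ x` means `x = 0`). -/
def Holds (k : ℤ) (val : T → ℤ) : Constraint T → Prop
  | eq τ => val τ = 0
  | le τ => val τ ≤ 0
  | dvd f τ => f.eval k ∣ val τ

def map (g : T → T') : Constraint T → Constraint T'
  | eq τ => eq (g τ)
  | le τ => le (g τ)
  | dvd f τ => dvd f (g τ)

/-- The divisor of a divisibility constraint. -/
def divisor? : Constraint T → Option ℤ[X]
  | eq _ => none
  | le _ => none
  | dvd f _ => some f

end Constraint

/-- Positive Boolean combinations of elements of `A`. -/
inductive PosBool (A : Type*) where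
  | atom (a : A) : PosBool A
  | and (φ ψ : PosBool A) : PosBool A
  | or (φ ψ : PosBool A) : PosBool A

namespace PosBool

variable {A A' : Type*}

def Holds (P : A → Prop) : PosBool A → Prop
  | atom a => P a
  | and φ ψ => φ.Holds P ∧ ψ.Holds P
  | or φ ψ => φ.Holds P ∨ ψ.Holds P

/-- Replacement of each atom by a positive Boolean combination. -/
def bind (g : A → PosBool A') : PosBool A → PosBool A'
  | atom a => g a
  | and φ ψ => and (φ.bind g) (ψ.bind g)
  | or φ ψ => or (φ.bind g) (ψ.bind g)

def map (g : A → A') (φ : PosBool A) : PosBool A' := φ.bind fun a => atom (g a)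

/-- The list of occurrences of atoms. -/
def atoms : PosBool A → List A
  | atom a => [a]
  | and φ ψ => φ.atoms ++ ψ.atoms
  | or φ ψ => φ.atoms ++ ψ.atoms

/-- `φ` in conjunction with all the formulae of a list. -/
def andAll (φ : PosBool A) (l : List (PosBool A)) : PosBool A := l.foldl and φ

end PosBool

/-- Positive Boolean combinations of constraints of one-parametric Presburger arithmetic, with
variables in `V`. -/
abbrev Formula (V : Type*) := PosBool (Constraint (Term V))

/-- Truth of a formula when the parameter is `k` and the variables have the values `ν`. -/
def Formula.Sat {V : Type*} (k : ℤ) (ν : V → ℤ) (φ : Formula V) : Prop :=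
  φ.Holds (Constraint.Holds k (Term.eval k ν))

/-- Truth of `∃ w ≤ B : φ(w, z)` when the parameter is `k` and `z` has the values `ζ`. -/
def BoundedSat {n : ℕ} {Z : Type*} (B : Fin n → ℤ[X]) (φ : Formula (Fin n ⊕ Z))
    (k : ℤ) (ζ : Z → ℤ) : Prop :=
  ∃ w : Fin n → ℤ, (∀ i, 0 ≤ w i ∧ w i ≤ (B i).eval k) ∧ φ.Sat k (Sum.elim w ζ)

/-- The admissible inputs: each constraint of `φ(w, z)` is a linear equality or inequality, or
`σ(w) + (τ(z) mod f(t)) = 0` with `σ` linear and `τ` linear and non-shifted. -/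
def IsElimBoundedInput {n : ℕ} {Z : Type*} (φ : Formula (Fin n ⊕ Z)) : Prop :=
  ∀ c ∈ φ.atoms,
    (∃ τ : Term (Fin n ⊕ Z), τ.Linear ∧ (c = .eq τ ∨ c = .le τ)) ∨
    ∃ (σ : Term (Fin n)) (τ : Term Z) (f : ℤ[X]), σ.Linear ∧ τ.Linear ∧ τ.NonShifted ∧
      c = .eq (.addMod 1 (τ.rename Sum.inr) f (σ.rename Sum.inl))

/-! ### Linear terms -/

/-- Linear terms `f₀(t) + ∑ fᵥ(t) * v`: the constant and the coefficients. -/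
abbrev LinTerm (V : Type*) := ℤ[X] × (V →₀ ℤ[X])

/-- Positive Boolean combinations of linear constraints. -/
abbrev LinFormula (V : Type*) := PosBool (Constraint (LinTerm V))

namespace LinTerm

variable {V : Type*}

/-- The linear term `f * v`. -/
noncomputable def mono (v : V) (f : ℤ[X]) : LinTerm V := (0, Finsupp.single v f)

/-- The constant linear term `f`. -/
noncomputable def const (f : ℤ[X]) : LinTerm V := (f, 0)

noncomputable def eval (k : ℤ) (ν : V → ℤ) (ρ : LinTerm V) : ℤ :=
  ρ.1.eval k + ρ.2.sum fun v f => f.eval k * ν v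

/-- The `1`-norm of a linear term with integer coefficients. -/
noncomputable def oneNorm (ρ : LinTerm V) : ℕ :=
  (ρ.1.coeff 0).natAbs + ρ.2.sum fun _ f => (f.coeff 0).natAbs

end LinTerm

/-! ### The procedure `BoundedQE` -/

/-- Variables used by `BoundedQE`: those of the input, and for each linear term `τ` a slack
variable, used for the inequality `τ ≤ 0`. -/
abbrev QVar (V : Type*) := V ⊕ LinTerm V

/-- A formula `∃ w ≤ B : ψ`: the variables in `w` are those to which `bound` assigns a polynomial. -/
structure BoundedFormula (V : Type*) where
  bound : V → Option ℤ[X]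
  body : LinFormula V

namespace BoundedQE

variable {V : Type*}

/-- The values of the program variables `φ`, `m(t)`, `lead`, `±`, `B`, `χ`. -/
structure State (V : Type*) where
  φ : LinFormula (QVar V)
  m : ℤ[X]
  lead : ℤ[X]
  sign : ℤˣ
  B : QVar V → Option ℤ[X]
  χ : LinFormula (QVar V)

open Classical in
/-- The polynomials `f(t)` such that `f(t) ∣ ·` occurs in `φ`. -/
noncomputable def divisors (φ : LinFormula V) : Finset ℤ[X] :=
  (φ.atoms.filterMap Constraint.divisor?).toFinset

/-- The constraint `0 < f(t)`, that is, `0 - f(t) + 1 ≤ 0`. -/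
noncomputable def pos (f : ℤ[X]) : LinFormula V := .atom (.le (LinTerm.const (1 - f)))

open Classical in
/-- Replacement of `f(t) ∣ τ` by `τ = 0`, for each guessed `f ∈ Zs`. -/
noncomputable def replaceZero (Zs : Finset ℤ[X]) : Constraint (LinTerm V) → Constraint (LinTerm V)
  | .eq τ => .eq τ
  | .le τ => .le τ
  | .dvd f τ => if f ∈ Zs then .eq τ else .dvd f τ

/-- The formula once the divisors in `Zs` have been set to zero. -/
noncomputable def zeroOut (Zs : Finset ℤ[X]) (φ : LinFormula V) : LinFormula V :=
  (φ.map (replaceZero Zs)).andAll (Zs.toList.map fun f => .atom (.eq (LinTerm.const f)))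

/-- A linear term of the input, over the larger set of variables. -/
noncomputable def lift (τ : LinTerm V) : LinTerm (QVar V) := (τ.1, τ.2.mapDomain Sum.inl)

/-- Introduction of slack variables: `τ ≤ 0` becomes `τ + y = 0`. -/
noncomputable def addSlack : Constraint (LinTerm V) → Constraint (LinTerm (QVar V))
  | .eq τ => .eq (lift τ)
  | .le τ => .eq (lift τ + LinTerm.mono (Sum.inr τ) 1)
  | .dvd f τ => .dvd f (lift τ)

/-- The state before the main loop, for the guesses `Zs` and `e` (the sign of `m(t)`). -/
noncomputable def init (φ : LinFormula V) (Zs : Finset ℤ[X]) (e : ℤˣ) : State V :=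
  let φ' := zeroOut Zs φ
  let m : ℤ[X] := (e : ℤ) • ∏ f ∈ divisors φ', f
  { φ := φ'.map addSlack, m := m, lead := 1, sign := 1, B := fun _ => none, χ := pos m }

open Classical in
/-- The iteration for `x` in which `x` is not eliminated but bounded by `m(t) - 1`. -/
noncomputable def skip (x : V) (s : State V) : State V :=
  { s with B := Function.update s.B (Sum.inl x) (some (s.m - 1)) }

/-- For `η = f * x + τ`: the linear term obtained from `f * ρ` by replacing `f * x` with `-τ`. -/
noncomputable def vigTerm (x : QVar V) (η ρ : LinTerm (QVar V)) : LinTerm (QVar V) :=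
  let f := η.2 x
  let τ := η - LinTerm.mono x f
  let h := ρ.2 x
  f • (ρ - LinTerm.mono x h) - h • τ

/-- The vigorous substitution of `-τ / f` for `x`, where `η = f * x + τ`
(inequalities do not occur when it is applied). -/
noncomputable def vig (x : QVar V) (η : LinTerm (QVar V)) :
    Constraint (LinTerm (QVar V)) → Constraint (LinTerm (QVar V))
  | .eq ρ => .eq (vigTerm x η ρ)
  | .le ρ => .le ρ
  | .dvd g ρ => .dvd (η.2 x * g) (vigTerm x η ρ)

open Classical in
/-- The quotient of an exact division of polynomials. -/
noncomputable def quot (q p : ℤ[X]) : ℤ[X] := if h : ∃ c, p = q * c then h.choose else 0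

/-- Division of all the coefficients of a linear term. -/
noncomputable def quotTerm (q : ℤ[X]) (ρ : LinTerm V) : LinTerm V :=
  (quot q ρ.1, Finsupp.onFinset ρ.2.support (fun v => if ρ.2 v = 0 then 0 else quot q (ρ.2 v))
    (by intro v hv; rw [Finsupp.mem_support_iff]; intro h; exact hv (by simp [h])))

/-- Division of a constraint, on both sides for divisibility constraints. -/
noncomputable def quotConstraint (q : ℤ[X]) : Constraint (LinTerm V) → Constraint (LinTerm V)
  | .eq ρ => .eq (quotTerm q ρ)
  | .le ρ => .le (quotTerm q ρ)
  | .dvd g ρ => .dvd (quot q g) (quotTerm q ρ)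

open Classical in
/-- The iteration for `x` in which the equality `η = 0`, with `η = f * x + τ`, and the sign `e` of
`f` have been guessed. -/
noncomputable def pivot (x : V) (η : LinTerm (QVar V)) (e : ℤˣ) (s : State V) : State V :=
  let f := η.2 (Sum.inl x)
  let τ := η - LinTerm.mono (Sum.inl x) f
  let m : ℤ[X] := ((e : ℤ) • f) * s.m
  { φ := ((s.φ.map (vig (Sum.inl x) η)).map (quotConstraint s.lead)).and (.atom (.dvd f τ))
    m := m
    lead := f
    sign := e
    B := fun v => if v.isRight ∧ τ.2 v ≠ 0 ∧ s.B v = none then some (m - 1) else s.B v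
    χ := s.χ.and (pos ((e : ℤ) • f)) }

/-- One iteration of the main loop, for some guesses. -/
def Step (x : V) (s s' : State V) : Prop :=
  s' = skip x s ∨
  ∃ (η : LinTerm (QVar V)) (e : ℤˣ),
    Constraint.eq η ∈ s.φ.atoms ∧ η.2 (Sum.inl x) ≠ 0 ∧ s' = pivot x η e s

/-- The main loop. -/
def Loop : List V → State V → State V → Prop
  | [], s, s' => s' = s
  | x :: xs, s, s' => ∃ s₁, Step x s s₁ ∧ Loop xs s₁ s'

open Classical in
/-- In an equality `η = 0` with a slack variable without bound: deletion of this variable, and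
reintroduction of the inequality, `η ≤ 0` or `-η ≤ 0` following the sign. -/
noncomputable def dropSlack (s : State V) :
    Constraint (LinTerm (QVar V)) → Constraint (LinTerm (QVar V))
  | .eq η =>
      if ∃ v, v.isRight ∧ η.2 v ≠ 0 ∧ s.B v = none then
        .le ((s.sign : ℤ) • (η.1, η.2.filter fun v => ¬ (v.isRight ∧ s.B v = none)))
      else .eq η
  | .le η => .le η
  | .dvd f η => .dvd f η

/-- The formula returned in the final state `s`. -/
noncomputable def result (s : State V) : BoundedFormula (QVar V) :=
  { bound := s.B, body := (s.φ.map (dropSlack s)).and s.χ }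

end BoundedQE

/-- `BoundedQE` on `∃ xs : φ`: the set of formulae returned by its non-deterministic branches. -/
def boundedQE {V : Type*} (xs : List V) (φ : LinFormula V) : Set (BoundedFormula (QVar V)) :=
  {β | ∃ Zs ⊆ BoundedQE.divisors φ, ∃ (e : ℤˣ) (s : BoundedQE.State V),
    BoundedQE.Loop xs (BoundedQE.init φ Zs e) s ∧ β = BoundedQE.result s}

/-! ### The procedure `ElimBounded` -/

/-- Terms `σ(y) + τ(z)` with `σ` linear (it includes the constant) and `τ` non-shifted. -/
abbrev MixedTerm (Y Z : Type*) := LinTerm Y × Term Z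

/-- Formulae in which the variables in `Y` occur only linearly. -/
abbrev MixedFormula (Y Z : Type*) := PosBool (Constraint (MixedTerm Y Z))

/-- Decomposition of a term in which the variables in `Y` occur only linearly. -/
noncomputable def Term.split {Y Z : Type*} : Term (Y ⊕ Z) → MixedTerm Y Z
  | .const f => (LinTerm.const f, .const 0)
  | .addVar f (.inl y) r => (LinTerm.mono y f + r.split.1, r.split.2)
  | .addVar f (.inr z) r => (r.split.1, .addVar f z r.split.2)
  | .addDiv f τ d r =>
      (r.split.1, .addDiv f (τ.subst (Sum.elim (fun _ => .const 0) Term.var)) d r.split.2)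
  | .addMod f τ g r =>
      (r.split.1, .addMod f (τ.subst (Sum.elim (fun _ => .const 0) Term.var)) g r.split.2)

namespace ElimBounded

variable {n : ℕ} {Y Z : Type*}

/-- The bit size `(deg f + 1) * (⌈log₂ (h + 1)⌉ + 1)`, where `h` is the largest absolute value of
a coefficient. -/
noncomputable def bitSize (f : ℤ[X]) : ℕ :=
  (f.natDegree + 1) * (Nat.clog 2 ((f.support.sup fun i => (f.coeff i).natAbs) + 1) + 1)

/-- The largest bit size of a bound. -/
noncomputable def maxBitSize (B : Fin n → ℤ[X]) : ℕ := Finset.univ.sup fun w => bitSize (B w)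

/-- The `t`-digits `y₀, …, y_M` of all the variables `w`. -/
abbrev Digit (n M : ℕ) := Fin n × Fin (M + 1)

/-- The sequence of all digits. -/
def digits (n M : ℕ) : List (Digit n M) :=
  (List.finRange n).flatMap fun w => (List.finRange (M + 1)).map fun i => (w, i)

/-- The formula `φ ∧ ⋀ (0 ≤ w ∧ w ≤ B(w))`. -/
noncomputable def addBounds (B : Fin n → ℤ[X]) (φ : Formula (Fin n ⊕ Z)) : Formula (Fin n ⊕ Z) :=
  φ.andAll ((List.finRange n).map fun w =>
    .and (.atom (.le (.addVar (-1) (.inl w) (.const 0))))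
      (.atom (.le (.addVar 1 (.inl w) (.const (-B w))))))

/-- The expansion `t ^ M * y_M + ⋯ + t * y₁ + y₀` of the variable `w`. -/
noncomputable def expansion (Z : Type*) (M : ℕ) (w : Fin n) : Term (Digit n M ⊕ Z) :=
  (List.finRange (M + 1)).foldr (fun (i : Fin (M + 1)) r => .addVar (X ^ (i : ℕ)) (.inl (w, i)) r) (.const 0)

/-- The formula `φ_∅(y, z)` with which the while loop starts: the bounds have been added, each `w`
has been replaced by its expansion, and `0 ≤ y ∧ y ≤ t - 1` has been added for each digit `y`. -/
noncomputable def bitBlast (B : Fin n → ℤ[X]) (φ : Formula (Fin n ⊕ Z)) :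
    MixedFormula (Digit n (maxBitSize B)) Z :=
  let M := maxBitSize B
  let φ₁ : Formula (Digit n M ⊕ Z) := (addBounds B φ).map
    (Constraint.map (Term.subst (Sum.elim (expansion Z M) fun z => Term.var (.inr z))))
  let φ₂ : Formula (Digit n M ⊕ Z) := φ₁.andAll ((digits n M).map fun y =>
    .and (.atom (.le (.addVar (-1) (.inl y) (.const 0))))
      (.atom (.le (.addVar 1 (.inl y) (.const (1 - X))))))
  φ₂.map (Constraint.map Term.split)

/-- An equality or inequality in which a digit has a non-integer coefficient. -/
def NonInteger : Constraint (MixedTerm Y Z) → Prop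
  | .eq η => ∃ y, 0 < (η.1.2 y).natDegree
  | .le η => ∃ y, 0 < (η.1.2 y).natDegree
  | .dvd _ _ => False

/-- The `y`-degree of a constraint. -/
noncomputable def constraintDegree : Constraint (MixedTerm Y Z) → ℕ
  | .eq η => η.1.2.support.sup fun y => (η.1.2 y).natDegree
  | .le η => η.1.2.support.sup fun y => (η.1.2 y).natDegree
  | .dvd _ _ => 0

/-- The `y`-degree of a formula. -/
noncomputable def yDegree : MixedFormula Y Z → ℕ
  | .atom c => constraintDegree c
  | .and φ ψ => yDegree φ + yDegree ψ
  | .or φ ψ => yDegree φ + yDegree ψ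

/-- The part `σ` of a linear term `σ * t + ρ`, where `t` does not occur in `ρ`. -/
noncomputable def quotientT (l : LinTerm Y) : LinTerm Y :=
  (divX l.1, l.2.mapRange divX divX_zero)

/-- The part `ρ` of a linear term `σ * t + ρ`, where `t` does not occur in `ρ`. -/
noncomputable def remainderT (l : LinTerm Y) : LinTerm Y :=
  (C (l.1.coeff 0), l.2.mapRange (fun f => C (f.coeff 0)) (by simp))

/-- The term `η` to be divided: an equality is `η = 0`, and an inequality `η' ≤ 0` is written as
`η < 0`, with `η = η' - 1`. -/
noncomputable def etaOf : Constraint (MixedTerm Y Z) → MixedTerm Y Z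
  | .eq η => η
  | .le η => (η.1 - LinTerm.const 1, η.2)
  | .dvd _ η => η

/-- The `1`-norm of `ρ(y) + (τ(z) mod t)`, where `η = σ(y) * t + ρ(y) + τ(z)`. -/
noncomputable def guessBound (c : Constraint (MixedTerm Y Z)) : ℕ :=
  (remainderT (etaOf c).1).oneNorm + 1

/-- The formula that replaces the constraint `c`, for the guess `r`. -/
noncomputable def divide (c : Constraint (MixedTerm Y Z)) (r : ℤ) : MixedFormula Y Z :=
  let η := etaOf c
  let σ := quotientT η.1
  let ρ := remainderT η.1
  let τmod := η.2.modT
  match c with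
  | .eq _ =>
      .and (.atom (.eq (LinTerm.const (X * C r) - ρ, τmod.smul (-1))))
        (.atom (.eq (σ + LinTerm.const (C r), η.2.divT)))
  | .le _ =>
      .and
        (.and (.atom (.le (LinTerm.const (X * C r) - ρ, τmod.smul (-1))))
          (.atom (.le (ρ - LinTerm.const (X * (C r + 1) - 1), τmod))))
        (.atom (.le (σ + LinTerm.const (C r + 1), η.2.divT)))
  | .dvd f η => .atom (.dvd f η)

open Classical in
/-- Replacement of a constraint in a formula. -/
noncomputable def replace (φ : MixedFormula Y Z) (c : Constraint (MixedTerm Y Z))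
    (ψ : MixedFormula Y Z) : MixedFormula Y Z :=
  φ.bind fun a => if a = c then ψ else .atom a

/-- A rule that selects, in every formula in which there is one, a constraint in which a digit has
a non-integer coefficient. -/
def IsSelection (pick : MixedFormula Y Z → Constraint (MixedTerm Y Z)) : Prop :=
  ∀ φ, (∃ c ∈ φ.atoms, NonInteger c) → pick φ ∈ φ.atoms ∧ NonInteger (pick φ)

/-- One iteration of the while loop, for some guess `r`. -/
def LoopStep (pick : MixedFormula Y Z → Constraint (MixedTerm Y Z))
    (φ φ' : MixedFormula Y Z) : Prop :=
  (∃ c ∈ φ.atoms, NonInteger c) ∧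
  ∃ r : ℤ, |r| ≤ guessBound (pick φ) ∧ φ' = replace φ (pick φ) (divide (pick φ) r)

/-- The formula `φ'` is obtained from `φ` by some number of iterations of the while loop. -/
def Reaches (pick : MixedFormula Y Z → Constraint (MixedTerm Y Z))
    (φ φ' : MixedFormula Y Z) : Prop :=
  Relation.ReflTransGen (LoopStep pick) φ φ'

/-- The formula `φ'` is obtained from `φ` by a complete execution of the while loop. -/
def LoopResult (pick : MixedFormula Y Z → Constraint (MixedTerm Y Z))
    (φ φ' : MixedFormula Y Z) : Prop :=
  Reaches pick φ φ' ∧ ¬ ∃ c ∈ φ'.atoms, NonInteger c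

/-- Replacement of `τ(z)` in `σ(y) + τ(z)` by a fresh variable. The fresh variable that stands
for `τ` is called `Sum.inr τ`. -/
noncomputable def abstractTerm (η : MixedTerm Y Z) : LinTerm (Y ⊕ Term Z) :=
  (η.1.1, η.1.2.mapDomain Sum.inl) + LinTerm.mono (Sum.inr η.2) 1

/-- Replacement of all the non-shifted terms `τ(z)` by fresh variables. -/
noncomputable def abstractFormula (φ : MixedFormula Y Z) : LinFormula (Y ⊕ Term Z) :=
  φ.map (Constraint.map abstractTerm)

/-- The set of formulae returned by the call to `BoundedQE`, which eliminates the variables `ys`. -/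
def callQE (ys : List Y) (φ : MixedFormula Y Z) : Set (BoundedFormula (QVar (Y ⊕ Term Z))) :=
  boundedQE (ys.map Sum.inl) (abstractFormula φ)

/-- The function `g` guesses an integer in `[0, B'(w)]` for each bounded variable `w`. -/
def IsGuess {V : Type*} (bound : V → Option ℤ[X]) (g : V → ℤ) : Prop :=
  ∀ v, (∀ p, bound v = some p → ∃ b : ℤ, p = C b ∧ 0 ≤ g v ∧ g v ≤ b) ∧ (bound v = none → g v = 0)

/-- The term that is substituted for a variable of the output of `BoundedQE`: the stored term `τ`
for the variable that stands for `τ`, and the guessed integer for the bounded variables (no other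
variable occurs). -/
noncomputable def restoreVar (g : QVar (Y ⊕ Term Z) → ℤ) : QVar (Y ⊕ Term Z) → Term Z
  | .inl (.inr τ) => τ
  | v => .const (C (g v))

/-- Substitution in a linear term. -/
noncomputable def restoreTerm (g : QVar (Y ⊕ Term Z) → ℤ) (ρ : LinTerm (QVar (Y ⊕ Term Z))) :
    Term Z :=
  ρ.2.support.toList.foldr (fun v r => ((restoreVar g v).smul (ρ.2 v)).add r) (.const ρ.1)

/-- Substitution in a formula. -/
noncomputable def restore (g : QVar (Y ⊕ Term Z) → ℤ) (ψ : LinFormula (QVar (Y ⊕ Term Z))) :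
    Formula Z :=
  ψ.map (Constraint.map (restoreTerm g))

end ElimBounded

/-- Each variable in a linear term occurring in `β` is either one of the bounded variables or one of
the variables that stand for a term `τ(z)`. -/
def ElimBounded.IsClosed {Y Z : Type*} (β : BoundedFormula (QVar (Y ⊕ Term Z))) : Prop :=
  ∀ c ∈ β.body.atoms, ∀ ρ : LinTerm (QVar (Y ⊕ Term Z)),
    (c = .eq ρ ∨ c = .le ρ ∨ ∃ f, c = .dvd f ρ) →
      ∀ v ∈ ρ.2.support, β.bound v ≠ none ∨ ∃ τ : Term Z, v = .inl (.inr τ)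

/-- `ElimBounded` on `∃ w ≤ B : φ(w, z)`: the set of formulae returned by its non-deterministic
branches, when the while loop treats the constraints selected by `pick`. -/
def elimBounded {n : ℕ} {Z : Type*} (B : Fin n → ℤ[X]) (φ : Formula (Fin n ⊕ Z))
    (pick : MixedFormula (ElimBounded.Digit n (ElimBounded.maxBitSize B)) Z →
      Constraint (MixedTerm (ElimBounded.Digit n (ElimBounded.maxBitSize B)) Z)) :
    Set (Formula Z) :=
  {ψ | ∃ φ', ElimBounded.LoopResult pick (ElimBounded.bitBlast B φ) φ' ∧
    ∃ β ∈ ElimBounded.callQE (ElimBounded.digits n (ElimBounded.maxBitSize B)) φ',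
    ∃ g, ElimBounded.IsGuess β.bound g ∧ ψ = ElimBounded.restore g β.body}

/-! ### Positive Boolean combinations -/

namespace PosBool

variable {A A' A'' : Type*}

/-! Two finite-guess arguments are combined: division by `t` digit by digit, and Gauss–Jordan
elimination over integers. Formulae are positive, hence monotone in their atoms, so it is enough to
transfer the truth of atoms that are true.

Division. For `η = σ t + ρ + τ`, Euclidean division of `τ` by `t` gives `η = t (σ + ⌊τ/t⌋) + ρ'`
with `ρ' = ρ + (τ mod t)` (`eval_etaOf_eq`). When all digits lie in `[0, t - 1]`, the quotient `r`
of `ρ'` by `t` is bounded by a norm independent of `t`, so it can be guessed; the sign of `η` is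
then governed by `σ + r + ⌊τ/t⌋`. Every guess is sound (`holds_of_divide`), the true quotient is
complete (`exists_divide_holds`), and the degree drops (`yDegree_divide_lt`).

Elimination. When the loop stops, every variable has an integer coefficient and there is no
divisibility; only constants may still contain `t`. The state of `BoundedQE` has a closed form in
the original rows: if `A` is the matrix of pivot rows at pivot columns, the current rows are given
by `det A` and the adjugate of `A`. `Invariant` records this. Its preservation is the fraction-free
identity `smul_reduced_extend`, which also shows that division by the previous pivot is exact. All
coefficients are minors of an integer matrix, so leading coefficients, divisors and bounds are
integers. A slack variable without bound occurs in no pivot row, hence only in its own row, with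
coefficient `det A`; this justifies turning that row back into an inequality.

Soundness (`Invariant.exists_holds_of_result`): the divisibilities allow the pivot rows to be solved
over the integers for the eliminated variables. Completeness (`Invariant.exists_step`): a solution
is moved in the direction that fixes all pivot rows until an inequality is nearly tight, which
becomes the next pivot with a small slack; if no true constraint varies in that direction, the
variable itself is reduced modulo the leading coefficient and bounded. -/

theorem Holds.mono {P Q : A → Prop} {φ : PosBool A} (h : ∀ a ∈ φ.atoms, P a → Q a)
    (hφ : φ.Holds P) : φ.Holds Q := by
  induction φ with
  | atom a => exact h a (by simp [atoms]) hφ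
  | and φ ψ ih₁ ih₂ =>
    exact ⟨ih₁ (fun a ha => h a (by simp [atoms, ha])) hφ.1,
      ih₂ (fun a ha => h a (by simp [atoms, ha])) hφ.2⟩
  | or φ ψ ih₁ ih₂ =>
    exact hφ.imp (ih₁ fun a ha => h a (by simp [atoms, ha]))
      (ih₂ fun a ha => h a (by simp [atoms, ha]))

theorem holds_congr {P Q : A → Prop} {φ : PosBool A} (h : ∀ a ∈ φ.atoms, (P a ↔ Q a)) :
    φ.Holds P ↔ φ.Holds Q :=
  ⟨Holds.mono fun a ha => (h a ha).1, Holds.mono fun a ha => (h a ha).2⟩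

theorem holds_bind (g : A → PosBool A') (P : A' → Prop) (φ : PosBool A) :
    (φ.bind g).Holds P ↔ φ.Holds fun a => (g a).Holds P := by
  induction φ with
  | atom a => rfl
  | and φ ψ ih₁ ih₂ => exact and_congr ih₁ ih₂
  | or φ ψ ih₁ ih₂ => exact or_congr ih₁ ih₂

theorem holds_map (g : A → A') (P : A' → Prop) (φ : PosBool A) :
    (φ.map g).Holds P ↔ φ.Holds fun a => P (g a) :=
  holds_bind _ P φ

theorem mem_atoms_bind {g : A → PosBool A'} {φ : PosBool A} {b : A'} :
    b ∈ (φ.bind g).atoms ↔ ∃ a ∈ φ.atoms, b ∈ (g a).atoms := by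
  induction φ with
  | atom a => simp [bind, atoms]
  | and φ ψ ih₁ ih₂ => simp [bind, atoms, ih₁, ih₂, or_and_right, exists_or]
  | or φ ψ ih₁ ih₂ => simp [bind, atoms, ih₁, ih₂, or_and_right, exists_or]

theorem mem_atoms_map {g : A → A'} {φ : PosBool A} {b : A'} :
    b ∈ (φ.map g).atoms ↔ ∃ a ∈ φ.atoms, g a = b := by
  simp [map, mem_atoms_bind, atoms, eq_comm]

theorem map_map (g : A → A') (g' : A' → A'') (φ : PosBool A) :
    (φ.map g).map g' = φ.map fun a => g' (g a) := by
  induction φ with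
  | atom a => rfl
  | and φ ψ ih₁ ih₂ => exact congrArg₂ and ih₁ ih₂
  | or φ ψ ih₁ ih₂ => exact congrArg₂ or ih₁ ih₂

theorem map_congr {g g' : A → A'} {φ : PosBool A} (h : ∀ a ∈ φ.atoms, g a = g' a) :
    φ.map g = φ.map g' := by
  induction φ with
  | atom a => exact congrArg atom (h a (by simp [atoms]))
  | and φ ψ ih₁ ih₂ =>
    exact congrArg₂ and (ih₁ fun a ha => h a (by simp [atoms, ha]))
      (ih₂ fun a ha => h a (by simp [atoms, ha]))
  | or φ ψ ih₁ ih₂ =>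
    exact congrArg₂ or (ih₁ fun a ha => h a (by simp [atoms, ha]))
      (ih₂ fun a ha => h a (by simp [atoms, ha]))

theorem map_andAll (g : A → A') (l : List (PosBool A)) (φ : PosBool A) :
    (φ.andAll l).map g = (φ.map g).andAll (l.map fun ψ => ψ.map g) := by
  induction l generalizing φ with
  | nil => rfl
  | cons ψ l ih => exact ih (φ.and ψ)

theorem andAll_concat (l : List (PosBool A)) (φ ψ : PosBool A) :
    φ.andAll (l ++ [ψ]) = (φ.andAll l).and ψ := by
  simp [andAll]

theorem holds_andAll (P : A → Prop) (l : List (PosBool A)) (φ : PosBool A) :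
    (φ.andAll l).Holds P ↔ φ.Holds P ∧ ∀ ψ ∈ l, ψ.Holds P := by
  induction l generalizing φ with
  | nil => simp [andAll]
  | cons ψ l ih =>
    refine (ih (φ.and ψ)).trans ?_
    simp [Holds, and_assoc]

theorem mem_atoms_andAll {l : List (PosBool A)} {φ : PosBool A} {a : A} :
    a ∈ (φ.andAll l).atoms ↔ a ∈ φ.atoms ∨ ∃ ψ ∈ l, a ∈ ψ.atoms := by
  induction l generalizing φ with
  | nil => simp [andAll]
  | cons ψ l ih =>
    refine (ih (φ := φ.and ψ)).trans ?_
    simp [atoms, or_assoc]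

end PosBool

theorem Constraint.holds_map {T T' : Type*} (k : ℤ) (val : T' → ℤ) (g : T → T')
    (c : Constraint T) : (c.map g).Holds k val ↔ c.Holds k fun τ => val (g τ) := by
  cases c <;> rfl

/-! ### Evaluation of terms -/

namespace Term

variable {V W : Type*}

theorem eval_add (k : ℤ) (ν : V → ℤ) (τ σ : Term V) :
    (τ.add σ).eval k ν = τ.eval k ν + σ.eval k ν := by
  induction τ with
  | const f =>
    induction σ with
    | const g => simp [add, eval]
    | addVar g v r ih => simp only [add, eval] at ih ⊢; rw [ih]; ring
    | addDiv g τ d r _ ih => simp only [add, eval] at ih ⊢; rw [ih]; ring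
    | addMod g τ h r _ ih => simp only [add, eval] at ih ⊢; rw [ih]; ring
  | addVar f v r ih => simp only [add, eval]; rw [ih]; ring
  | addDiv f τ d r _ ih => simp only [add, eval]; rw [ih]; ring
  | addMod f τ g r _ ih => simp only [add, eval]; rw [ih]; ring

theorem eval_smul (k : ℤ) (ν : V → ℤ) (c : ℤ[X]) (τ : Term V) :
    (τ.smul c).eval k ν = c.eval k * τ.eval k ν := by
  induction τ with
  | const f => simp [smul, eval]
  | addVar f v r ih => simp only [smul, eval, eval_mul]; rw [ih]; ring
  | addDiv f τ d r _ ih => simp only [smul, eval, eval_mul]; rw [ih]; ring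
  | addMod f τ g r _ ih => simp only [smul, eval, eval_mul]; rw [ih]; ring

theorem eval_subst (k : ℤ) (ν : W → ℤ) (s : V → Term W) (τ : Term V) :
    (τ.subst s).eval k ν = τ.eval k fun v => (s v).eval k ν := by
  induction τ with
  | const f => rfl
  | addVar f v r ih => simp only [subst, eval, eval_add, eval_smul, ih]
  | addDiv f τ d r ih₁ ih₂ => simp only [subst, eval, ih₁, ih₂]
  | addMod f τ g r ih₁ ih₂ => simp only [subst, eval, ih₁, ih₂]

theorem eval_rename (k : ℤ) (ν : W → ℤ) (s : V → W) (τ : Term V) :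
    (τ.rename s).eval k ν = τ.eval k fun v => ν (s v) := by
  induction τ with
  | const f => rfl
  | addVar f v r ih => simp only [rename, eval, ih]
  | addDiv f τ d r ih₁ ih₂ => simp only [rename, eval, ih₁, ih₂]
  | addMod f τ g r ih₁ ih₂ => simp only [rename, eval, ih₁, ih₂]

theorem eval_var (k : ℤ) (ν : V → ℤ) (v : V) : (var v).eval k ν = ν v := by
  simp [var, eval]

theorem eval_modT (k : ℤ) (ν : V → ℤ) (τ : Term V) :
    τ.modT.eval k ν = τ.eval k ν % k := by
  simp only [modT, eval, eval_X, eval_one, eval_zero]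
  change 1 * (τ.eval k ν % k) + 0 = _
  ring

/-- Positivity of the parameter makes the two conventions for division agree and lets two nested
floors be merged into one. -/
theorem eval_divT {k : ℤ} (hk : 0 < k) (ν : V → ℤ) (τ : Term V) :
    τ.divT.eval k ν = τ.eval k ν / k := by
  have key : ∀ σ : Term V, (addDiv 1 σ 1 (const 0)).eval k ν = σ.eval k ν / k := by
    intro σ
    simp only [eval, eval_one, eval_zero, pow_one]
    rw [Int.fdiv_eq_ediv_of_nonneg _ hk.le]
    ring
  unfold divT
  split
  · split_ifs with h
    · obtain ⟨rfl, rfl⟩ := h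
      simp only [eval, eval_one, eval_zero, one_mul, add_zero]
      rw [Int.fdiv_eq_ediv_of_nonneg _ (by positivity), Int.fdiv_eq_ediv_of_nonneg _ (by positivity),
        pow_succ, Int.ediv_ediv_of_nonneg (by positivity)]
    · exact key _
  · exact key _

theorem Linear.add {τ σ : Term V} (hτ : τ.Linear) (hσ : σ.Linear) : (τ.add σ).Linear := by
  induction τ with
  | const f =>
    induction σ with
    | const g => simp only [Term.add, Linear]
    | addVar g v r ih => simpa only [Term.add, Linear] using ih hσ
    | addDiv g τ d r _ ih => exact hσ.elim
    | addMod g τ h r _ ih => exact hσ.elim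
  | addVar f v r ih => simpa only [Term.add, Linear] using ih hτ
  | addDiv f τ d r _ ih => exact hτ.elim
  | addMod f τ g r _ ih => exact hτ.elim

theorem Linear.smul {τ : Term V} (hτ : τ.Linear) (c : ℤ[X]) : (τ.smul c).Linear := by
  induction τ with
  | const f => trivial
  | addVar f v r ih => exact ih hτ
  | addDiv f τ d r _ ih => exact hτ
  | addMod f τ g r _ ih => exact hτ

theorem Linear.subst {τ : Term V} (hτ : τ.Linear) {s : V → Term W} (hs : ∀ v, (s v).Linear) :
    (τ.subst s).Linear := by
  induction τ with
  | const f => trivial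
  | addVar f v r ih => exact ((hs v).smul f).add (ih hτ)
  | addDiv f τ d r _ ih => exact hτ
  | addMod f τ g r _ ih => exact hτ

theorem Linear.rename {τ : Term V} (hτ : τ.Linear) (s : V → W) : (τ.rename s).Linear := by
  induction τ with
  | const f => trivial
  | addVar f v r ih => exact ih hτ
  | addDiv f τ d r _ ih => exact hτ
  | addMod f τ g r _ ih => exact hτ

end Term

/-! ### Evaluation of linear terms -/

namespace LinTerm

variable {V W : Type*}

/-- The value of a linear term without its constant. -/
noncomputable def dot (k : ℤ) (ν : V → ℤ) (ρ : LinTerm V) : ℤ :=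
  ρ.2.sum fun v f => f.eval k * ν v

theorem eval_eq (k : ℤ) (ν : V → ℤ) (ρ : LinTerm V) :
    eval k ν ρ = ρ.1.eval k + dot k ν ρ := rfl

theorem dot_add (k : ℤ) (ν : V → ℤ) (ρ σ : LinTerm V) :
    dot k ν (ρ + σ) = dot k ν ρ + dot k ν σ := by
  unfold dot
  rw [Prod.snd_add, Finsupp.sum_add_index'] <;> intros <;> simp [add_mul]

theorem dot_smul (k : ℤ) (ν : V → ℤ) (c : ℤ[X]) (ρ : LinTerm V) :
    dot k ν (c • ρ) = c.eval k * dot k ν ρ := by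
  unfold dot
  rw [Prod.smul_snd, Finsupp.sum_smul_index' (by simp), Finsupp.mul_sum]
  simp [mul_assoc]

@[simp] theorem eval_add (k : ℤ) (ν : V → ℤ) (ρ σ : LinTerm V) :
    eval k ν (ρ + σ) = eval k ν ρ + eval k ν σ := by
  simp only [eval_eq, dot_add, Prod.fst_add, Polynomial.eval_add]; ring

@[simp] theorem eval_smul (k : ℤ) (ν : V → ℤ) (c : ℤ[X]) (ρ : LinTerm V) :
    eval k ν (c • ρ) = c.eval k * eval k ν ρ := by
  simp only [eval_eq, dot_smul, Prod.smul_fst, smul_eq_mul, Polynomial.eval_mul]; ring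

@[simp] theorem eval_neg (k : ℤ) (ν : V → ℤ) (ρ : LinTerm V) :
    eval k ν (-ρ) = -eval k ν ρ := by
  rw [← neg_one_smul ℤ[X] ρ, eval_smul]; simp

@[simp] theorem eval_sub (k : ℤ) (ν : V → ℤ) (ρ σ : LinTerm V) :
    eval k ν (ρ - σ) = eval k ν ρ - eval k ν σ := by
  rw [sub_eq_add_neg, eval_add, eval_neg]; ring

@[simp] theorem eval_zero (k : ℤ) (ν : V → ℤ) : eval k ν (0 : LinTerm V) = 0 := by
  simp [eval]

theorem eval_sum {ι : Type*} (k : ℤ) (ν : V → ℤ) (s : Finset ι) (ρ : ι → LinTerm V) :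
    eval k ν (∑ i ∈ s, ρ i) = ∑ i ∈ s, eval k ν (ρ i) := by
  classical
  induction s using Finset.induction_on with
  | empty => simp
  | insert i s hi ih => rw [Finset.sum_insert hi, Finset.sum_insert hi, eval_add, ih]

@[simp] theorem eval_mono (k : ℤ) (ν : V → ℤ) (v : V) (f : ℤ[X]) :
    eval k ν (mono v f) = f.eval k * ν v := by
  simp [eval, mono]

@[simp] theorem eval_const (k : ℤ) (ν : V → ℤ) (f : ℤ[X]) : eval k ν (const f) = f.eval k := by
  simp [eval, const]

theorem eval_congr {k : ℤ} {ν ν' : V → ℤ} {ρ : LinTerm V} (h : ∀ v, ρ.2 v ≠ 0 → ν v = ν' v) :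
    eval k ν ρ = eval k ν' ρ := by
  unfold eval
  congr 1
  exact Finsupp.sum_congr fun v hv => by rw [h v (Finsupp.mem_support_iff.1 hv)]

theorem eval_mapDomain (k : ℤ) (ν : W → ℤ) (g : V → W) (ρ : LinTerm V) :
    eval k ν (ρ.1, ρ.2.mapDomain g) = eval k (fun v => ν (g v)) ρ := by
  unfold eval
  rw [Finsupp.sum_mapDomain_index] <;> intros <;> simp [add_mul]

theorem eval_shift (k : ℤ) (ν u : V → ℤ) (s : ℤ) (ρ : LinTerm V) :
    eval k (fun v => ν v + s * u v) ρ = eval k ν ρ + s * dot k u ρ := by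
  unfold eval dot Finsupp.sum
  rw [Finset.mul_sum, add_assoc, ← Finset.sum_add_distrib]
  congr 1
  exact Finset.sum_congr rfl fun v _ => by ring

end LinTerm

/-! ### The while loop of `ElimBounded` -/

/-- The term of a constraint. -/
def Constraint.term {T : Type*} : Constraint T → T
  | .eq τ => τ
  | .le τ => τ
  | .dvd _ τ => τ

theorem Constraint.term_map {T T' : Type*} (g : T → T') (c : Constraint T) :
    (c.map g).term = g c.term := by
  cases c <;> rfl

theorem Constraint.divisor?_map {T T' : Type*} (g : T → T') (c : Constraint T) :
    (c.map g).divisor? = c.divisor? := by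
  cases c <;> rfl

theorem Constraint.holds_congr {T : Type*} {k : ℤ} {val val' : T → ℤ} {c : Constraint T}
    (h : val c.term = val' c.term) : c.Holds k val ↔ c.Holds k val' := by
  cases c <;> simp only [Constraint.term] at h <;> simp only [Constraint.Holds, h]

/-- The value of a term `σ(y) + τ(z)`. -/
noncomputable def MixedTerm.eval {Y Z : Type*} (k : ℤ) (ν : Y → ℤ) (ζ : Z → ℤ)
    (η : MixedTerm Y Z) : ℤ :=
  LinTerm.eval k ν η.1 + η.2.eval k ζ

/-- Truth of a formula in which the variables in `Y` occur only linearly. -/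
def MixedFormula.Sat {Y Z : Type*} (k : ℤ) (ν : Y → ℤ) (ζ : Z → ℤ) (φ : MixedFormula Y Z) : Prop :=
  φ.Holds (Constraint.Holds k (MixedTerm.eval k ν ζ))

namespace ElimBounded

variable {n : ℕ} {Y Z : Type*}

theorem constraintDegree_le {c : Constraint (MixedTerm Y Z)} {N : ℕ}
    (h : ∀ y, (c.term.1.2 y).natDegree ≤ N) : constraintDegree c ≤ N := by
  cases c
  · exact Finset.sup_le fun y _ => h y
  · exact Finset.sup_le fun y _ => h y
  · exact Nat.zero_le N

theorem natDegree_le_constraintDegree {c : Constraint (MixedTerm Y Z)} (hc : c.divisor? = none)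
    (y : Y) : (c.term.1.2 y).natDegree ≤ constraintDegree c := by
  have key : ∀ l : Y →₀ ℤ[X], (l y).natDegree ≤ l.support.sup fun y => (l y).natDegree := by
    intro l
    by_cases hy : l y = 0
    · simp [hy]
    · exact Finset.le_sup (f := fun y => (l y).natDegree) (Finsupp.mem_support_iff.2 hy)
  cases c with
  | eq η => exact key _
  | le η => exact key _
  | dvd f η => cases hc

theorem NonInteger.divisor?_eq_none {c : Constraint (MixedTerm Y Z)} (hc : NonInteger c) :
    c.divisor? = none := by
  cases c with
  | eq η => rfl
  | le η => rfl
  | dvd f η => exact hc.elim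

/-- The constraints on `r` contain only `ρ`, of degree zero in the digits; the remaining one
contains `σ`, whose coefficients are those of `η` with their degree lowered by one. The drop is
strict because some coefficient had positive degree. -/
theorem yDegree_divide_lt {c : Constraint (MixedTerm Y Z)} (hc : NonInteger c) (r : ℤ) :
    yDegree (divide c r) < constraintDegree c := by
  have hdeg := natDegree_le_constraintDegree hc.divisor?_eq_none
  cases c with
  | eq η =>
    obtain ⟨y₀, hy₀⟩ := hc
    have hpos := hy₀.trans_le (hdeg y₀)
    have h₁ : constraintDegree (.eq (LinTerm.const (X * C r) - remainderT η.1,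
        η.2.modT.smul (-1)) : Constraint (MixedTerm Y Z)) ≤ 0 :=
      constraintDegree_le fun y => by simp [Constraint.term, LinTerm.const, remainderT]
    have h₂ : constraintDegree (.eq (quotientT η.1 + LinTerm.const (C r), η.2.divT) :
        Constraint (MixedTerm Y Z)) ≤ constraintDegree (.eq η) - 1 :=
      constraintDegree_le fun y => by
        simpa [Constraint.term, LinTerm.const, quotientT, natDegree_divX_eq_natDegree_tsub_one]
          using (hdeg y).trans le_tsub_add
    change constraintDegree _ + constraintDegree _ < _
    simp only [etaOf] at *
    omega
  | le η =>
    obtain ⟨y₀, hy₀⟩ := hc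
    have hpos := hy₀.trans_le (hdeg y₀)
    have h₁ : constraintDegree (.le (LinTerm.const (X * C r) - remainderT (etaOf (.le η)).1,
        (etaOf (.le η)).2.modT.smul (-1)) : Constraint (MixedTerm Y Z)) ≤ 0 :=
      constraintDegree_le fun y => by simp [Constraint.term, LinTerm.const, remainderT]
    have h₂ : constraintDegree (.le (remainderT (etaOf (.le η)).1 -
        LinTerm.const (X * (C r + 1) - 1), (etaOf (.le η)).2.modT) :
        Constraint (MixedTerm Y Z)) ≤ 0 :=
      constraintDegree_le fun y => by simp [Constraint.term, LinTerm.const, remainderT]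
    have h₃ : constraintDegree (.le (quotientT (etaOf (.le η)).1 + LinTerm.const (C r + 1),
        (etaOf (.le η)).2.divT) : Constraint (MixedTerm Y Z)) ≤ constraintDegree (.le η) - 1 :=
      constraintDegree_le fun y => by
        simpa [Constraint.term, LinTerm.const, quotientT, etaOf,
          natDegree_divX_eq_natDegree_tsub_one] using
          (hdeg y).trans le_tsub_add
    change constraintDegree _ + constraintDegree _ + constraintDegree _ < _
    omega
  | dvd f η => exact hc.elim

/-- All occurrences of the constraint are replaced at once. The weak inequality handles the
subformulae in which it does not occur. -/
theorem yDegree_replace {c : Constraint (MixedTerm Y Z)} {ψ : MixedFormula Y Z}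
    (h : yDegree ψ < constraintDegree c) (φ : MixedFormula Y Z) :
    yDegree (replace φ c ψ) ≤ yDegree φ ∧ (c ∈ φ.atoms → yDegree (replace φ c ψ) < yDegree φ) := by
  induction φ with
  | atom a =>
    simp only [replace, PosBool.bind, PosBool.atoms, List.mem_singleton]
    split_ifs with hac
    · subst hac
      exact ⟨h.le, fun _ => h⟩
    · exact ⟨le_rfl, fun hca => (hac hca.symm).elim⟩
  | and φ₁ φ₂ ih₁ ih₂ =>
    simp only [replace, PosBool.bind, PosBool.atoms, List.mem_append, yDegree] at *
    refine ⟨add_le_add ih₁.1 ih₂.1, ?_⟩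
    rintro (hc | hc)
    · exact add_lt_add_of_lt_of_le (ih₁.2 hc) ih₂.1
    · exact add_lt_add_of_le_of_lt ih₁.1 (ih₂.2 hc)
  | or φ₁ φ₂ ih₁ ih₂ =>
    simp only [replace, PosBool.bind, PosBool.atoms, List.mem_append, yDegree] at *
    refine ⟨add_le_add ih₁.1 ih₂.1, ?_⟩
    rintro (hc | hc)
    · exact add_lt_add_of_lt_of_le (ih₁.2 hc) ih₂.1
    · exact add_lt_add_of_le_of_lt ih₁.1 (ih₂.2 hc)

variable {pick : MixedFormula Y Z → Constraint (MixedTerm Y Z)}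

theorem LoopStep.yDegree_lt (hpick : IsSelection pick) {φ φ' : MixedFormula Y Z}
    (h : LoopStep pick φ φ') : yDegree φ' < yDegree φ := by
  obtain ⟨hφ, r, -, rfl⟩ := h
  obtain ⟨hmem, hint⟩ := hpick φ hφ
  exact (yDegree_replace (yDegree_divide_lt hint r) φ).2 hmem

theorem finite_setOf_loopStep (φ : MixedFormula Y Z) : {φ' | LoopStep pick φ φ'}.Finite := by
  refine ((Set.finite_Icc (-(guessBound (pick φ) : ℤ)) (guessBound (pick φ))).image
    fun r => replace φ (pick φ) (divide (pick φ) r)).subset ?_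
  rintro φ' ⟨-, r, hr, rfl⟩
  exact ⟨r, abs_le.1 hr, rfl⟩

/-- The loop is finitely branching and the degree decreases along every branch, so the tree of
executions is finite. -/
theorem finite_setOf_reaches (hpick : IsSelection pick) (φ : MixedFormula Y Z) :
    {φ' | Reaches pick φ φ'}.Finite := by
  induction hN : yDegree φ using Nat.strong_induction_on generalizing φ with
  | _ N ih =>
    subst hN
    refine (((finite_setOf_loopStep (pick := pick) φ).biUnion fun ψ hψ =>
      ih _ (LoopStep.yDegree_lt hpick hψ) ψ rfl).union (Set.finite_singleton φ)).subset ?_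
    intro φ' hφ'
    rcases Relation.ReflTransGen.cases_head hφ' with rfl | ⟨ψ, hψ, hψ'⟩
    · exact Or.inr rfl
    · exact Or.inl (Set.mem_biUnion (x := ψ) hψ hψ')

theorem divide_divisor? {c : Constraint (MixedTerm Y Z)} (hc : c.divisor? = none) (r : ℤ) :
    ∀ a ∈ (divide c r).atoms, a.divisor? = none := by
  cases c with
  | eq η => simp [divide, PosBool.atoms, Constraint.divisor?]
  | le η => simp [divide, PosBool.atoms, Constraint.divisor?]
  | dvd f η => cases hc

/-- Division creates no divisibility constraint. Consequently `BoundedQE` is called without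
divisors, and its initial guess is trivial. -/
theorem Reaches.divisor? (hpick : IsSelection pick) {φ φ' : MixedFormula Y Z}
    (h : Reaches pick φ φ') (hφ : ∀ a ∈ φ.atoms, a.divisor? = none) :
    ∀ a ∈ φ'.atoms, a.divisor? = none := by
  induction h with
  | refl => exact hφ
  | tail _ h ih =>
    obtain ⟨hex, r, -, rfl⟩ := h
    intro a ha
    obtain ⟨b, hb, hab⟩ := PosBool.mem_atoms_bind.1 ha
    split_ifs at hab with hb'
    · exact divide_divisor? (hpick _ hex).2.divisor?_eq_none r a hab
    · simp only [PosBool.atoms, List.mem_singleton] at hab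
      exact hab ▸ ih b hb

theorem quotientT_remainderT (l : LinTerm Y) : (X : ℤ[X]) • quotientT l + remainderT l = l := by
  refine Prod.ext ?_ (Finsupp.ext fun y => ?_)
  · simp only [quotientT, remainderT, Prod.fst_add, Prod.smul_fst, smul_eq_mul]
    rw [mul_comm, divX_mul_X_add]
  · simp only [quotientT, remainderT, Prod.snd_add, Prod.smul_snd, Finsupp.add_apply,
      Finsupp.smul_apply, Finsupp.mapRange_apply, smul_eq_mul]
    rw [mul_comm, divX_mul_X_add]

theorem abs_eval_remainderT_le {k : ℤ} (hk : 2 ≤ k) {ν : Y → ℤ}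
    (hν : ∀ y, 0 ≤ ν y ∧ ν y ≤ k - 1) (l : LinTerm Y) :
    |LinTerm.eval k ν (remainderT l)| ≤ k * (remainderT l).oneNorm := by
  have h₁ : |(remainderT l).1.eval k| ≤ k * |(remainderT l).1.coeff 0| := by
    simp only [remainderT, eval_C, coeff_C_zero]
    exact le_mul_of_one_le_left (abs_nonneg _) (by omega)
  have h₂ : |(remainderT l).2.sum fun v f => f.eval k * ν v| ≤
      k * (remainderT l).2.sum fun _ f => |f.coeff 0| := by
    rw [Finsupp.sum, Finsupp.sum, Finset.mul_sum]
    refine (Finset.abs_sum_le_sum_abs _ _).trans (Finset.sum_le_sum fun v _ => ?_)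
    simp only [remainderT, Finsupp.mapRange_apply, eval_C, coeff_C_zero]
    rw [abs_mul, mul_comm, abs_of_nonneg (hν v).1]
    exact mul_le_mul_of_nonneg_right (by linarith [(hν v).2]) (abs_nonneg _)
  rw [LinTerm.oneNorm, LinTerm.eval]
  refine (abs_add_le _ _).trans ?_
  simp only [Finsupp.sum] at h₂ ⊢
  push_cast [Int.natCast_natAbs]
  rw [mul_add]
  exact add_le_add h₁ h₂

/-- The identity behind the loop: the multiples of `k` are separated from the small part `ρ + (τ mod
k)`. -/
theorem eval_etaOf_eq {k : ℤ} (ν : Y → ℤ) (ζ : Z → ℤ) (η : MixedTerm Y Z) :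
    MixedTerm.eval k ν ζ η = k * (LinTerm.eval k ν (quotientT η.1) + η.2.eval k ζ / k) +
      (LinTerm.eval k ν (remainderT η.1) + η.2.eval k ζ % k) := by
  have h := congrArg (LinTerm.eval k ν) (quotientT_remainderT η.1)
  simp only [LinTerm.eval_add, LinTerm.eval_smul, eval_X] at h
  have h' := Int.mul_ediv_add_emod (η.2.eval k ζ) k
  simp only [MixedTerm.eval]
  linear_combination -h - h'

/-- Adding `k` times the constraint on `σ` to those on `r` recovers `η`. No bound on the digits is
used, and `r` is arbitrary. -/
theorem holds_of_divide {k : ℤ} (hk : 2 ≤ k) {ν : Y → ℤ} {ζ : Z → ℤ}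
    {c : Constraint (MixedTerm Y Z)} {r : ℤ}
    (h : MixedFormula.Sat k ν ζ (divide c r)) : c.Holds k (MixedTerm.eval k ν ζ) := by
  have hk0 : 0 < k := by omega
  cases c with
  | eq η =>
    simp only [MixedFormula.Sat, divide, etaOf, PosBool.Holds, Constraint.Holds] at h ⊢
    rw [eval_etaOf_eq]
    simp only [MixedTerm.eval, LinTerm.eval_add, LinTerm.eval_sub, LinTerm.eval_const,
      Term.eval_smul, Term.eval_modT, Term.eval_divT hk0, eval_mul, eval_X, eval_C, eval_neg,
      eval_one] at h
    linear_combination k * h.2 - h.1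
  | le η =>
    simp only [MixedFormula.Sat, divide, PosBool.Holds, Constraint.Holds] at h ⊢
    have he := eval_etaOf_eq (k := k) ν ζ (etaOf (.le η))
    have he' : MixedTerm.eval k ν ζ (etaOf (.le η)) = MixedTerm.eval k ν ζ η - 1 := by
      simp only [MixedTerm.eval, etaOf, LinTerm.eval_sub, LinTerm.eval_const, eval_one]; ring
    simp only [MixedTerm.eval, LinTerm.eval_add, LinTerm.eval_sub, LinTerm.eval_const,
      Term.eval_smul, Term.eval_modT, Term.eval_divT hk0, eval_mul, eval_X, eval_C, eval_neg,
      eval_one, eval_add, eval_sub] at h he he' ⊢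
    nlinarith [h.2, h.1.1, h.1.2]
  | dvd f η => exact h

/-- The guess `r` is fixed by the values of the variables, whether or not the constraint is true, so
one `r` serves all occurrences. -/
theorem exists_divide_holds {k : ℤ} (hk : 2 ≤ k) {ν : Y → ℤ} (hν : ∀ y, 0 ≤ ν y ∧ ν y ≤ k - 1)
    {ζ : Z → ℤ} (c : Constraint (MixedTerm Y Z)) :
    ∃ r : ℤ, |r| ≤ guessBound c ∧ (c.Holds k (MixedTerm.eval k ν ζ) →
      MixedFormula.Sat k ν ζ (divide c r)) := by
  have hk0 : 0 < k := by omega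
  set ρ := LinTerm.eval k ν (remainderT (etaOf c).1) + (etaOf c).2.eval k ζ % k with hρ
  have hmod₀ := Int.emod_nonneg ((etaOf c).2.eval k ζ) hk0.ne'
  have hmod₁ := Int.emod_lt_of_pos ((etaOf c).2.eval k ζ) hk0
  have habs := abs_le.1 (abs_eval_remainderT_le hk hν (etaOf c).1)
  have hdm := Int.mul_ediv_add_emod ρ k
  have hr₀ := Int.emod_nonneg ρ hk0.ne'
  have hr₁ := Int.emod_lt_of_pos ρ hk0
  have hgb : (guessBound c : ℤ) = (remainderT (etaOf c).1).oneNorm + 1 := by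
    simp [guessBound]
  -- The linear part is at most `k` times its norm and `τ mod k` is below `k`; the latter accounts
  -- for the extra 1 in `guessBound`.
  refine ⟨ρ / k, ?_, fun h => ?_⟩
  · rw [abs_le]
    constructor
    · rw [Int.le_ediv_iff_mul_le hk0]
      rw [hgb]; nlinarith
    · refine Int.ediv_le_of_le_mul hk0 ?_
      rw [hgb]; nlinarith
  · cases c with
    | eq η =>
      simp only [MixedFormula.Sat, divide, etaOf, PosBool.Holds, Constraint.Holds] at h hρ ⊢
      rw [eval_etaOf_eq, ← hρ] at h
      have hz : ρ % k = 0 := Int.emod_eq_zero_of_dvd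
        ((dvd_add_right (Dvd.intro _ rfl)).1 (h ▸ dvd_zero k))
      simp only [MixedTerm.eval, LinTerm.eval_add, LinTerm.eval_sub, LinTerm.eval_const,
        Term.eval_smul, Term.eval_modT, Term.eval_divT hk0, eval_mul, eval_X, eval_C, eval_neg,
        eval_one]
      refine ⟨by linarith, mul_left_cancel₀ hk0.ne' ?_⟩
      linarith
    | le η =>
      simp only [MixedFormula.Sat, divide, PosBool.Holds, Constraint.Holds] at h ⊢
      have he := eval_etaOf_eq (k := k) ν ζ (etaOf (.le η))
      rw [← hρ] at he
      have he' : MixedTerm.eval k ν ζ (etaOf (.le η)) = MixedTerm.eval k ν ζ η - 1 := by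
        simp only [MixedTerm.eval, etaOf, LinTerm.eval_sub, LinTerm.eval_const, eval_one]; ring
      rw [he'] at he
      -- Here `η - 1 < 0`, and dropping the remainder of `ρ` modulo `k` keeps it negative. After
      -- division by `k`, strictness gives the `+ 1` in the new inequality.
      have hlt : k * (LinTerm.eval k ν (quotientT (etaOf (.le η)).1) +
          (etaOf (.le η)).2.eval k ζ / k + ρ / k) < k * 0 := by linarith
      have hlt' := lt_of_mul_lt_mul_left hlt hk0.le
      simp only [MixedTerm.eval, LinTerm.eval_add, LinTerm.eval_sub, LinTerm.eval_const,
        Term.eval_smul, Term.eval_modT, Term.eval_divT hk0, eval_mul, eval_X, eval_C, eval_neg,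
        eval_one, eval_add, eval_sub]
      exact ⟨⟨by linarith, by linarith⟩, by linarith⟩
    | dvd f η => exact h

theorem Reaches.sat_of_sat {k : ℤ} (hk : 2 ≤ k) {ν : Y → ℤ} {ζ : Z → ℤ} {φ φ' : MixedFormula Y Z}
    (h : Reaches pick φ φ') (hφ' : MixedFormula.Sat k ν ζ φ') : MixedFormula.Sat k ν ζ φ := by
  induction h with
  | refl => exact hφ'
  | tail _ h ih =>
    obtain ⟨-, r, -, rfl⟩ := h
    refine ih (PosBool.Holds.mono (fun a _ ha => ?_) ((PosBool.holds_bind _ _ _).1 hφ'))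
    split_ifs at ha with hac
    · rw [hac]; exact holds_of_divide hk ha
    · exact ha

theorem exists_loopResult_sat (hpick : IsSelection pick) {k : ℤ} (hk : 2 ≤ k) {ν : Y → ℤ}
    (hν : ∀ y, 0 ≤ ν y ∧ ν y ≤ k - 1) {ζ : Z → ℤ} (φ : MixedFormula Y Z)
    (hφ : MixedFormula.Sat k ν ζ φ) :
    ∃ φ', LoopResult pick φ φ' ∧ MixedFormula.Sat k ν ζ φ' := by
  induction hN : yDegree φ using Nat.strong_induction_on generalizing φ with
  | _ N ih =>
    subst hN
    by_cases hex : ∃ c ∈ φ.atoms, NonInteger c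
    · obtain ⟨r, hr, hdiv⟩ := exists_divide_holds hk hν (ζ := ζ) (pick φ)
      have hstep : LoopStep pick φ (replace φ (pick φ) (divide (pick φ) r)) := ⟨hex, r, hr, rfl⟩
      obtain ⟨φ', ⟨hreach, hdone⟩, hsat⟩ := ih _ (hstep.yDegree_lt hpick) _
        ((PosBool.holds_bind _ _ _).2 (PosBool.Holds.mono (fun a _ ha => by
          split_ifs with hac
          · exact hdiv (hac ▸ ha)
          · exact ha) hφ)) rfl
      exact ⟨φ', ⟨Relation.ReflTransGen.head hstep hreach, hdone⟩, hsat⟩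
    · exact ⟨φ, ⟨Relation.ReflTransGen.refl, hex⟩, hφ⟩

/-! ### Expansion into digits -/

/-- With `h` the height, `f(k) ≤ h k ^ (deg f + 1)` by a geometric sum, and `h < 2 ^ ⌈log₂ (h + 1)⌉
≤ k ^ ⌈log₂ (h + 1)⌉`. This guarantees that the chosen number of digits suffices for every `k ≥ 2`.
-/
theorem eval_lt_pow_bitSize {k : ℤ} (hk : 2 ≤ k) (f : ℤ[X]) : f.eval k < k ^ bitSize f := by
  set h := f.support.sup fun i => (f.coeff i).natAbs with hh
  have hk1 : 1 ≤ k := by omega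
  have hcoeff : ∀ i, f.coeff i ≤ h := by
    intro i
    by_cases hi : f.coeff i = 0
    · rw [hi]; positivity
    · have := Finset.le_sup (f := fun i => (f.coeff i).natAbs) (mem_support_iff.2 hi)
      exact Int.le_natAbs.trans (by exact_mod_cast this)
  have hgeom : ∀ m : ℕ, ∑ i ∈ Finset.range m, k ^ i ≤ k ^ m := by
    intro m
    induction m with
    | zero => simp
    | succ m ih =>
      rw [Finset.sum_range_succ, pow_succ]
      nlinarith [pow_pos (show 0 < k by omega) m]
  have hle : f.eval k ≤ h * k ^ (f.natDegree + 1) := by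
    rw [eval_eq_sum_range]
    refine (Finset.sum_le_sum fun i _ =>
      mul_le_mul_of_nonneg_right (hcoeff i) (pow_nonneg (by omega) i)).trans ?_
    rw [← Finset.mul_sum]
    exact mul_le_mul_of_nonneg_left (hgeom _) (by positivity)
  have hlog : (h : ℤ) < k ^ Nat.clog 2 (h + 1) := by
    have h₁ : h + 1 ≤ 2 ^ Nat.clog 2 (h + 1) := Nat.le_pow_clog (by norm_num) _
    have h₂ : (2 : ℤ) ^ Nat.clog 2 (h + 1) ≤ k ^ Nat.clog 2 (h + 1) :=
      pow_le_pow_left₀ (by norm_num) hk _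
    have h₃ : ((h + 1 : ℕ) : ℤ) ≤ 2 ^ Nat.clog 2 (h + 1) := by exact_mod_cast h₁
    push_cast at h₃
    linarith
  -- Sum against product: `a + b ≤ b (a + 1)` because `b = deg f + 1` is at least 1.
  have hexp : Nat.clog 2 (h + 1) + (f.natDegree + 1) ≤ bitSize f := by
    rw [bitSize, ← hh]
    nlinarith
  calc f.eval k ≤ h * k ^ (f.natDegree + 1) := hle
    _ < k ^ Nat.clog 2 (h + 1) * k ^ (f.natDegree + 1) :=
        mul_lt_mul_of_pos_right hlog (pow_pos (by omega) _)
    _ = k ^ (Nat.clog 2 (h + 1) + (f.natDegree + 1)) := (pow_add _ _ _).symm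
    _ ≤ k ^ bitSize f := pow_le_pow_right₀ hk1 hexp

theorem exists_digits {k : ℤ} (hk : 2 ≤ k) (m : ℕ) (w : ℤ) (h₀ : 0 ≤ w) (h₁ : w < k ^ m) :
    ∃ d : Fin m → ℤ, (∀ i, 0 ≤ d i ∧ d i ≤ k - 1) ∧ ∑ i : Fin m, k ^ (i : ℕ) * d i = w := by
  have hk0 : 0 < k := by omega
  induction m generalizing w with
  | zero => exact ⟨fun _ => 0, fun i => i.elim0, by simp at h₁ ⊢; omega⟩
  | succ m ih =>
    obtain ⟨d, hd, hsum⟩ := ih (w / k) (Int.ediv_nonneg h₀ hk0.le)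
      (Int.ediv_lt_of_lt_mul hk0 (by rwa [pow_succ] at h₁))
    refine ⟨Fin.cons (w % k) d, fun i => ?_, ?_⟩
    · refine Fin.cases ?_ (fun i => ?_) i
      · exact ⟨Int.emod_nonneg _ hk0.ne', Int.le_sub_one_of_lt (Int.emod_lt_of_pos _ hk0)⟩
      · exact hd i
    · rw [Fin.sum_univ_succ]
      simp only [Fin.cons_zero, Fin.cons_succ, Fin.val_zero, pow_zero, one_mul, Fin.val_succ,
        pow_succ']
      simp only [mul_assoc]
      rw [← Finset.mul_sum, hsum, add_comm]
      exact Int.mul_ediv_add_emod w k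

theorem eval_expansion (k : ℤ) {M : ℕ} (ν : Digit n M → ℤ) (ζ : Z → ℤ) (w : Fin n) :
    (expansion Z M w).eval k (Sum.elim ν ζ) = ∑ i : Fin (M + 1), k ^ (i : ℕ) * ν (w, i) := by
  have key : ∀ l : List (Fin (M + 1)),
      Term.eval k (Sum.elim ν ζ) (l.foldr (fun (i : Fin (M + 1)) r =>
        Term.addVar (X ^ (i : ℕ)) (Sum.inl (w, i)) r) (Term.const 0)) =
      (l.map fun i : Fin (M + 1) => k ^ (i : ℕ) * ν (w, i)).sum := by
    intro l
    induction l with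
    | nil => simp [Term.eval]
    | cons i l ih => simp [Term.eval, ih]
  rw [expansion, key, ← List.ofFn_eq_map, List.sum_ofFn]

theorem linear_expansion (M : ℕ) (w : Fin n) : (expansion Z M w).Linear := by
  unfold expansion
  generalize List.finRange (M + 1) = l
  induction l with
  | nil => trivial
  | cons i l ih => exact ih

/-- The splitting of `τ` has the same values as `τ`. -/
def SplitsExactly (τ : Term (Y ⊕ Z)) : Prop :=
  ∀ (k : ℤ) (ν : Y → ℤ) (ζ : Z → ℤ), MixedTerm.eval k ν ζ τ.split = τ.eval k (Sum.elim ν ζ)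

theorem _root_.Term.Linear.splitsExactly {τ : Term (Y ⊕ Z)} (hτ : τ.Linear) : SplitsExactly τ := by
  intro k ν ζ
  induction τ with
  | const f => simp [Term.split, MixedTerm.eval, Term.eval]
  | addVar f v r ih =>
    specialize ih hτ
    rcases v with y | z
    · simp only [Term.split, MixedTerm.eval, Term.eval, LinTerm.eval_add, LinTerm.eval_mono,
        Sum.elim_inl] at ih ⊢
      linarith
    · simp only [Term.split, MixedTerm.eval, Term.eval, Sum.elim_inr] at ih ⊢
      linarith
  | addDiv f τ d r _ _ => exact hτ.elim
  | addMod f τ g r _ _ => exact hτ.elim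

/-- Splitting puts 0 for the variables of `Y` under the remainder, which is harmless exactly when
the inner term does not depend on them. -/
theorem splitsExactly_addMod {τ : Term (Y ⊕ Z)} {σ : Term (Y ⊕ Z)} (hσ : σ.Linear) (f g : ℤ[X])
    (hτ : ∀ (k : ℤ) (ν ν' : Y → ℤ) (ζ : Z → ℤ),
      τ.eval k (Sum.elim ν ζ) = τ.eval k (Sum.elim ν' ζ)) :
    SplitsExactly (.addMod f τ g σ) := by
  intro k ν ζ
  have h := hσ.splitsExactly k ν ζ
  have hs : (fun v => (Sum.elim (fun _ => Term.const 0) Term.var v : Term Z).eval k ζ) =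
      Sum.elim (fun _ : Y => (0 : ℤ)) ζ := by
    funext v
    rcases v with y | z
    · simp [Term.eval]
    · simp [Term.eval_var]
  simp only [Term.split, MixedTerm.eval, Term.eval, Term.eval_subst] at h ⊢
  rw [hs, hτ k (fun _ => 0) ν ζ]
  linarith

/-- The constraints of `φ(w, z)` allowed in an input of `ElimBounded`. -/
def IsAdmissible (c : Constraint (Term (Fin n ⊕ Z))) : Prop :=
  (∃ τ : Term (Fin n ⊕ Z), τ.Linear ∧ (c = .eq τ ∨ c = .le τ)) ∨
    ∃ (σ : Term (Fin n)) (τ : Term Z) (f : ℤ[X]), σ.Linear ∧ τ.Linear ∧ τ.NonShifted ∧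
      c = .eq (.addMod 1 (τ.rename Sum.inr) f (σ.rename Sum.inl))

theorem IsAdmissible.divisor? {c : Constraint (Term (Fin n ⊕ Z))} (hc : IsAdmissible c) :
    c.divisor? = none := by
  rcases hc with ⟨τ, -, rfl | rfl⟩ | ⟨σ, τ, f, -, -, -, rfl⟩ <;> rfl

theorem IsAdmissible.splitsExactly {c : Constraint (Term (Fin n ⊕ Z))} (hc : IsAdmissible c)
    (M : ℕ) : SplitsExactly (c.term.subst (Sum.elim (expansion Z M) fun z => Term.var (.inr z))) := by
  have hs : ∀ v, (Sum.elim (expansion (n := n) Z M) (fun z => Term.var (.inr z)) v).Linear := by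
    rintro (w | z)
    · exact linear_expansion M w
    · trivial
  rcases hc with ⟨τ, hτ, rfl | rfl⟩ | ⟨σ, τ, f, hσ, -, -, rfl⟩
  · exact (hτ.subst hs).splitsExactly
  · exact (hτ.subst hs).splitsExactly
  · refine splitsExactly_addMod ((hσ.rename _).subst hs) _ _ fun k ν ν' ζ => ?_
    simp only [Term.eval_subst, Term.eval_rename, Sum.elim_inr, Term.eval_var]

theorem isAdmissible_of_mem_addBounds {B : Fin n → ℤ[X]} {φ : Formula (Fin n ⊕ Z)}
    (hφ : IsElimBoundedInput φ) {c : Constraint (Term (Fin n ⊕ Z))}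
    (hc : c ∈ (addBounds B φ).atoms) : IsAdmissible c := by
  rcases PosBool.mem_atoms_andAll.1 hc with hc | ⟨ψ, hψ, hc⟩
  · exact hφ c hc
  · obtain ⟨w, -, rfl⟩ := List.mem_map.1 hψ
    simp only [PosBool.atoms, List.singleton_append, List.mem_cons, List.not_mem_nil,
      or_false] at hc
    rcases hc with rfl | rfl
    · refine Or.inl ⟨_, ?_, Or.inr rfl⟩; trivial
    · refine Or.inl ⟨_, ?_, Or.inr rfl⟩; trivial

theorem mem_digits {M : ℕ} (y : Digit n M) : y ∈ digits n M := by
  simp only [digits, List.mem_flatMap, List.mem_map, List.mem_finRange, true_and]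
  exact ⟨y.1, y.2, rfl⟩

theorem nodup_digits (n M : ℕ) : (digits n M).Nodup := by
  have h : digits n M = (List.finRange n).product (List.finRange (M + 1)) := rfl
  rw [h]
  exact (List.nodup_finRange n).product (List.nodup_finRange _)

theorem bitBlast_divisor? {B : Fin n → ℤ[X]} {φ : Formula (Fin n ⊕ Z)}
    (hφ : IsElimBoundedInput φ) : ∀ c ∈ (bitBlast B φ).atoms, c.divisor? = none := by
  intro b hb
  obtain ⟨c, hc, rfl⟩ := PosBool.mem_atoms_map.1 hb
  rw [Constraint.divisor?_map]
  rcases PosBool.mem_atoms_andAll.1 hc with hc' | ⟨ψ, hψ, hc⟩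
  · obtain ⟨a, ha, rfl⟩ := PosBool.mem_atoms_map.1 hc'
    rw [Constraint.divisor?_map]
    exact (isAdmissible_of_mem_addBounds hφ ha).divisor?
  · obtain ⟨w, -, rfl⟩ := List.mem_map.1 hψ
    simp only [PosBool.atoms, List.singleton_append, List.mem_cons, List.not_mem_nil,
      or_false] at hc
    rcases hc with rfl | rfl <;> rfl

/-- The values of the bounded variables are determined by the digits, and the digit bounds are
themselves conjuncts of the formula. This is why soundness later gets them for free. -/
theorem sat_bitBlast {B : Fin n → ℤ[X]} {φ : Formula (Fin n ⊕ Z)} (hφ : IsElimBoundedInput φ)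
    (k : ℤ) (ν : Digit n (maxBitSize B) → ℤ) (ζ : Z → ℤ) (w : Fin n → ℤ)
    (hw : ∀ i, ∑ j : Fin (maxBitSize B + 1), k ^ (j : ℕ) * ν (i, j) = w i) :
    MixedFormula.Sat k ν ζ (bitBlast B φ) ↔ (∀ y, 0 ≤ ν y ∧ ν y ≤ k - 1) ∧
      (∀ i, 0 ≤ w i ∧ w i ≤ (B i).eval k) ∧ φ.Sat k (Sum.elim w ζ) := by
  set s : Fin n ⊕ Z → Term (Digit n (maxBitSize B) ⊕ Z) :=
    Sum.elim (expansion Z (maxBitSize B)) fun z => Term.var (.inr z) with hs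
  have hval : (fun v => (s v).eval k (Sum.elim ν ζ)) = Sum.elim w ζ := by
    funext v
    rcases v with i | z
    · simp only [hs, Sum.elim_inl, eval_expansion, hw]
    · simp only [hs, Sum.elim_inr, Term.eval_var]
  have hsplit : ∀ c ∈ (PosBool.andAll ((addBounds B φ).map (Constraint.map (Term.subst s)))
      ((digits n (maxBitSize B)).map fun y =>
        .and (.atom (.le (.addVar (-1) (.inl y) (.const 0))))
          (.atom (.le (.addVar 1 (.inl y) (.const (1 - X))))))).atoms,
      (Constraint.Holds k (MixedTerm.eval k ν ζ) (c.map Term.split) ↔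
        c.Holds k (Term.eval k (Sum.elim ν ζ))) := by
    intro c hc
    rw [Constraint.holds_map]
    refine Constraint.holds_congr ?_
    suffices h : SplitsExactly c.term from h k ν ζ
    rcases PosBool.mem_atoms_andAll.1 hc with hc' | ⟨ψ, hψ, hc⟩
    · obtain ⟨a, ha, rfl⟩ := PosBool.mem_atoms_map.1 hc'
      rw [Constraint.term_map]
      exact (isAdmissible_of_mem_addBounds hφ ha).splitsExactly _
    · obtain ⟨w, -, rfl⟩ := List.mem_map.1 hψ
      simp only [PosBool.atoms, List.singleton_append, List.mem_cons, List.not_mem_nil,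
        or_false] at hc
      rcases hc with rfl | rfl <;> exact Term.Linear.splitsExactly trivial
  have hfun : (fun a => Constraint.Holds k (Term.eval k (Sum.elim ν ζ))
      (Constraint.map (Term.subst s) a)) = Constraint.Holds k (Term.eval k (Sum.elim w ζ)) := by
    funext a
    rw [Constraint.holds_map]
    congr 1
    funext τ
    rw [Term.eval_subst, hval]
  rw [MixedFormula.Sat, bitBlast, PosBool.holds_map, PosBool.holds_congr hsplit,
    PosBool.holds_andAll, PosBool.holds_map, hfun, addBounds, PosBool.holds_andAll]
  simp only [List.forall_mem_map, mem_digits, List.mem_finRange, PosBool.Holds, Constraint.Holds, Term.eval, Sum.elim_inl, eval_neg,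
    eval_one, eval_zero, eval_sub, eval_X, forall_const, Formula.Sat]
  constructor
  · rintro ⟨⟨h₁, h₂⟩, h₃⟩
    exact ⟨fun y => ⟨by linarith [h₃ y], by linarith [h₃ y]⟩,
      fun i => ⟨by linarith [h₂ i], by linarith [h₂ i]⟩, h₁⟩
  · rintro ⟨h₃, h₂, h₁⟩
    exact ⟨⟨h₁, fun i => ⟨by linarith [h₂ i], by linarith [h₂ i]⟩⟩,
      fun y => ⟨by linarith [h₃ y], by linarith [h₃ y]⟩⟩

theorem boundedSat_iff_exists_digits {B : Fin n → ℤ[X]} {φ : Formula (Fin n ⊕ Z)}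
    (hφ : IsElimBoundedInput φ) {k : ℤ} (hk : 2 ≤ k) (ζ : Z → ℤ) :
    BoundedSat B φ k ζ ↔ ∃ ν : Digit n (maxBitSize B) → ℤ,
      (∀ y, 0 ≤ ν y ∧ ν y ≤ k - 1) ∧ MixedFormula.Sat k ν ζ (bitBlast B φ) := by
  constructor
  · rintro ⟨w, hw, hsat⟩
    have hlt : ∀ i, w i < k ^ (maxBitSize B + 1) := by
      intro i
      refine ((hw i).2.trans_lt (eval_lt_pow_bitSize hk (B i))).trans_le
        (pow_le_pow_right₀ (by omega) ?_)
      exact (Finset.le_sup (f := fun w => bitSize (B w)) (Finset.mem_univ i)).trans (Nat.le_succ _)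
    choose d hd hsum using fun i => exists_digits hk _ (w i) (hw i).1 (hlt i)
    exact ⟨fun y => d y.1 y.2, fun y => hd y.1 y.2,
      (sat_bitBlast hφ k _ ζ w hsum).2 ⟨fun y => hd y.1 y.2, hw, hsat⟩⟩
  · rintro ⟨ν, -, hsat⟩
    obtain ⟨-, hw, hφ'⟩ := (sat_bitBlast hφ k ν ζ _ fun i => rfl).1 hsat
    exact ⟨_, hw, hφ'⟩

end ElimBounded

/-! ### Fraction-free Gauss–Jordan elimination -/

namespace LinTerm

variable {W : Type*}

theorem smul_left_cancel {q : ℤ[X]} (hq : q ≠ 0) {ρ σ : LinTerm W} (h : q • ρ = q • σ) : ρ = σ := by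
  refine Prod.ext (mul_left_cancel₀ hq (congrArg Prod.fst h)) (Finsupp.ext fun w => ?_)
  exact mul_left_cancel₀ hq (DFunLike.congr_fun (congrArg Prod.snd h) w)

theorem sum_smul_apply {ι : Type*} (s : Finset ι) (a : ι → ℤ[X]) (r : ι → LinTerm W) (w : W) :
    (∑ i ∈ s, a i • r i).2 w = ∑ i ∈ s, a i * (r i).2 w := by
  simp [Prod.snd_sum]

theorem smul_mono (q : ℤ[X]) (w : W) (f : ℤ[X]) : q • mono w f = mono w (q * f) := by
  ext <;> simp [mono]

theorem mono_apply_self (w : W) (f : ℤ[X]) : (mono w f).2 w = f := by simp [mono]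

theorem mono_apply_of_ne {w w' : W} (h : w ≠ w') (f : ℤ[X]) : (mono w f).2 w' = 0 := by
  simp [mono, h]

end LinTerm

namespace BoundedQE

/-! ### Elimination in closed form by determinants and adjugates -/

section Elimination

variable {W ι : Type*} [Fintype ι] [DecidableEq ι]

/-- The coefficients of the pivot rows at the pivot columns. -/
noncomputable def pivotMatrix (x : ι → W) (r : ι → LinTerm W) : Matrix ι ι ℤ[X] :=
  Matrix.of fun i l => (r i).2 (x l)

/-- The pivot row for `x l` after the elimination: its coefficients at the pivot columns vanish,
except at `x l`. -/
noncomputable def reducedPivot (x : ι → W) (r : ι → LinTerm W) (l : ι) : LinTerm W :=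
  ∑ i, (pivotMatrix x r).adjugate l i • r i

/-- The linear term obtained from `ρ` by the elimination. -/
noncomputable def reduced (x : ι → W) (r : ι → LinTerm W) (ρ : LinTerm W) : LinTerm W :=
  (pivotMatrix x r).det • ρ - ∑ l, ρ.2 (x l) • reducedPivot x r l

variable (x : ι → W) (r : ι → LinTerm W)

theorem reducedPivot_apply (l l' : ι) :
    (reducedPivot x r l).2 (x l') = if l = l' then (pivotMatrix x r).det else 0 := by
  rw [reducedPivot, LinTerm.sum_smul_apply]
  have h := congrFun (congrFun (Matrix.adjugate_mul (pivotMatrix x r)) l) l'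
  rw [Matrix.mul_apply, Matrix.smul_apply, Matrix.one_apply] at h
  simpa [pivotMatrix] using h

theorem reduced_apply (ρ : LinTerm W) (w : W) : (reduced x r ρ).2 w =
    (pivotMatrix x r).det * ρ.2 w - ∑ l, ρ.2 (x l) * (reducedPivot x r l).2 w := by
  rw [reduced, Prod.snd_sub, Finsupp.sub_apply, LinTerm.sum_smul_apply]
  rfl

theorem reduced_apply_col (ρ : LinTerm W) (l : ι) : (reduced x r ρ).2 (x l) = 0 := by
  simp [reduced_apply, reducedPivot_apply, mul_comm]

theorem sum_smul_reducedPivot (i : ι) :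
    ∑ l, (r i).2 (x l) • reducedPivot x r l = (pivotMatrix x r).det • r i := by
  simp only [reducedPivot, Finset.smul_sum, smul_smul]
  rw [Finset.sum_comm]
  simp only [← Finset.sum_smul]
  have h : ∀ j, ∑ l, (r i).2 (x l) * (pivotMatrix x r).adjugate l j =
      if i = j then (pivotMatrix x r).det else 0 := by
    intro j
    have h := congrFun (congrFun (Matrix.mul_adjugate (pivotMatrix x r)) i) j
    rw [Matrix.mul_apply, Matrix.smul_apply, Matrix.one_apply] at h
    simpa [pivotMatrix] using h
  simp [h]

/-- Up to the factor `det A`, a combination of pivot rows is determined by its coefficients at the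
pivot columns. The identities for an added pivot follow by computing those coefficients only. -/
theorem det_smul_of_mem_span {q : LinTerm W} (hq : q ∈ Submodule.span ℤ[X] (Set.range r)) :
    (pivotMatrix x r).det • q = ∑ l, q.2 (x l) • reducedPivot x r l := by
  induction hq using Submodule.span_induction with
  | mem q hq =>
    obtain ⟨i, rfl⟩ := hq
    exact (sum_smul_reducedPivot x r i).symm
  | zero => simp
  | add q q' _ _ h h' =>
    rw [smul_add, h, h', ← Finset.sum_add_distrib]
    exact Finset.sum_congr rfl fun l _ => (add_smul _ _ _).symm
  | smul a q _ h =>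
    rw [smul_comm, h, Finset.smul_sum]
    simp [smul_smul]

theorem reducedPivot_mem_span (l : ι) :
    reducedPivot x r l ∈ Submodule.span ℤ[X] (Set.range r) :=
  Submodule.sum_mem _ fun i _ => Submodule.smul_mem _ _ (Submodule.subset_span ⟨i, rfl⟩)

variable {x r} (hD : (pivotMatrix x r).det ≠ 0) {v : W} {ρ₀ : LinTerm W}

-- A Schur complement: the bordered determinant is the next pivot coefficient. It identifies the
-- leading coefficient of every state with a minor of the original rows.
include hD in
theorem det_pivotMatrix_extend :
    (pivotMatrix (Sum.elim x fun _ : Unit => v) (Sum.elim r fun _ : Unit => ρ₀)).det =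
      (reduced x r ρ₀).2 v := by
  set A := pivotMatrix x r with hA
  set c : Matrix ι Unit ℤ[X] := Matrix.of fun i _ => (r i).2 v with hc
  set b : Matrix Unit ι ℤ[X] := Matrix.of fun _ l => ρ₀.2 (x l) with hb
  set d : Matrix Unit Unit ℤ[X] := Matrix.of fun _ _ => ρ₀.2 v with hd
  have hblocks : pivotMatrix (Sum.elim x fun _ : Unit => v) (Sum.elim r fun _ : Unit => ρ₀) =
      Matrix.fromBlocks A c b d := by
    ext i j
    rcases i with i | i <;> rcases j with j | j <;> rfl
  -- Block elimination with the adjugate in place of the inverse, so no fractions occur. Taking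
  -- determinants introduces an extra factor `det A`, cancelled by `hD`.
  have hmul : Matrix.fromBlocks 1 0 (-(b * A.adjugate)) (A.det • (1 : Matrix Unit Unit ℤ[X])) *
      Matrix.fromBlocks A c b d = Matrix.fromBlocks A c 0 (A.det • d - b * A.adjugate * c) := by
    rw [Matrix.fromBlocks_multiply]
    congr 1
    · simp
    · simp
    · rw [Matrix.neg_mul, Matrix.mul_assoc, Matrix.adjugate_mul]
      simp
    · rw [Matrix.neg_mul, Matrix.smul_mul, Matrix.one_mul]
      abel
  have hdet := congrArg Matrix.det hmul
  rw [Matrix.det_mul, Matrix.det_fromBlocks_zero₁₂, Matrix.det_fromBlocks_zero₂₁, Matrix.det_one,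
    one_mul, Matrix.det_unique (n := Unit), Matrix.det_unique (n := Unit)] at hdet
  rw [hblocks]
  refine mul_left_cancel₀ hD ?_
  simp only [Matrix.smul_apply, Matrix.one_apply_eq, smul_eq_mul, mul_one, Matrix.sub_apply] at hdet
  rw [hdet]
  congr 1
  rw [reduced_apply]
  congr 1
  simp only [Matrix.mul_assoc]
  rw [Matrix.mul_apply]
  refine Finset.sum_congr rfl fun l _ => ?_
  rw [reducedPivot, LinTerm.sum_smul_apply, Matrix.mul_apply]
  rfl

variable (r) in
omit [Fintype ι] [DecidableEq ι] in
theorem range_subset_extend : Submodule.span ℤ[X] (Set.range r) ≤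
    Submodule.span ℤ[X] (Set.range (Sum.elim r fun _ : Unit => ρ₀)) :=
  Submodule.span_mono (by rintro _ ⟨i, rfl⟩; exact ⟨Sum.inl i, rfl⟩)

variable (x r ρ₀) in
theorem reduced_mem_span : reduced x r ρ₀ ∈
    Submodule.span ℤ[X] (Set.range (Sum.elim r fun _ : Unit => ρ₀)) :=
  Submodule.sub_mem _ (Submodule.smul_mem _ _ (Submodule.subset_span ⟨Sum.inr (), rfl⟩))
    (Submodule.sum_mem _ fun l _ => Submodule.smul_mem _ _
      (range_subset_extend r (reducedPivot_mem_span x r l)))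

-- `reduced x r ρ₀` lies in the span of the extended rows, vanishes at the old columns and equals
-- the new determinant at `v`; these coefficients characterize the new reduced pivot row.
include hD in
theorem reducedPivot_extend_inr (hf : (reduced x r ρ₀).2 v ≠ 0) :
    reducedPivot (Sum.elim x fun _ : Unit => v) (Sum.elim r fun _ : Unit => ρ₀) (.inr ()) =
      reduced x r ρ₀ := by
  have h := det_smul_of_mem_span (Sum.elim x fun _ : Unit => v) _ (reduced_mem_span x r ρ₀)
  rw [det_pivotMatrix_extend hD, Fintype.sum_sum_type] at h
  simp only [Sum.elim_inl, reduced_apply_col, zero_smul, Finset.sum_const_zero, zero_add,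
    Finset.univ_unique, Finset.sum_singleton, Sum.elim_inr] at h
  exact (LinTerm.smul_left_cancel hf h).symm

-- The right-hand side is in the span of the extended rows, vanishes at `v`, and at the old columns
-- has the same coefficients as the left-hand side.
include hD in
theorem smul_reducedPivot_extend_inl (hf : (reduced x r ρ₀).2 v ≠ 0) (l : ι) :
    (pivotMatrix x r).det •
      reducedPivot (Sum.elim x fun _ : Unit => v) (Sum.elim r fun _ : Unit => ρ₀) (.inl l) =
      (reduced x r ρ₀).2 v • reducedPivot x r l - (reducedPivot x r l).2 v • reduced x r ρ₀ := by
  set q := (reduced x r ρ₀).2 v • reducedPivot x r l - (reducedPivot x r l).2 v • reduced x r ρ₀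
    with hq
  have h := det_smul_of_mem_span (Sum.elim x fun _ : Unit => v) _
    (Submodule.sub_mem _
      (Submodule.smul_mem _ ((reduced x r ρ₀).2 v)
        (range_subset_extend r (ρ₀ := ρ₀) (reducedPivot_mem_span x r l)))
      (Submodule.smul_mem _ ((reducedPivot x r l).2 v) (reduced_mem_span x r ρ₀)))
  have happly : ∀ w, q.2 w = (reduced x r ρ₀).2 v * (reducedPivot x r l).2 w -
      (reducedPivot x r l).2 v * (reduced x r ρ₀).2 w := fun w => rfl
  have hcol : ∀ l', q.2 (x l') =
      if l = l' then (reduced x r ρ₀).2 v * (pivotMatrix x r).det else 0 := by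
    intro l'
    rw [happly, reduced_apply_col, reducedPivot_apply, mul_zero, sub_zero, mul_ite, mul_zero]
  have hv : q.2 v = 0 := by rw [happly, mul_comm, sub_self]
  rw [← hq, det_pivotMatrix_extend hD, Fintype.sum_sum_type] at h
  simp only [Sum.elim_inl, Sum.elim_inr, hv, hcol, zero_smul, ite_smul, Finset.sum_ite_eq,
    Finset.mem_univ, if_true, Finset.sum_const_zero, add_zero, mul_smul] at h
  exact (LinTerm.smul_left_cancel hf h).symm

-- The Bareiss identity. The right-hand side is what the vigorous substitution computes, so dividing
-- by the previous pivot is exact and yields the reduced row for the enlarged set of pivots.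
include hD in
theorem smul_reduced_extend (hf : (reduced x r ρ₀).2 v ≠ 0) (ρ : LinTerm W) :
    (pivotMatrix x r).det •
      reduced (Sum.elim x fun _ : Unit => v) (Sum.elim r fun _ : Unit => ρ₀) ρ =
      (reduced x r ρ₀).2 v • reduced x r ρ - (reduced x r ρ).2 v • reduced x r ρ₀ := by
  have hmul : (reduced x r ρ).2 v • reduced x r ρ₀ =
      (pivotMatrix x r).det • ρ.2 v • reduced x r ρ₀ -
        ∑ l, ρ.2 (x l) • (reducedPivot x r l).2 v • reduced x r ρ₀ := by
    rw [reduced_apply]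
    refine (sub_smul ((pivotMatrix x r).det * ρ.2 v)
      (∑ l, ρ.2 (x l) * (reducedPivot x r l).2 v) (reduced x r ρ₀)).trans ?_
    simp only [Finset.sum_smul, mul_smul]
  rw [hmul, reduced, det_pivotMatrix_extend hD, Fintype.sum_sum_type, smul_sub, smul_add,
    Finset.smul_sum]
  simp only [Finset.univ_unique, Finset.sum_singleton, Sum.elim_inl, Sum.elim_inr,
    smul_comm (pivotMatrix x r).det (ρ.2 (_ : W)) (_ : LinTerm W), smul_reducedPivot_extend_inl hD hf,
    PUnit.default_eq_unit, reducedPivot_extend_inr hD hf]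
  rw [reduced.eq_def x r ρ]
  simp only [smul_sub, Finset.sum_sub_distrib, Finset.smul_sum,
    smul_comm (_ : ℤ[X]) ((reduced x r ρ₀).2 v) (_ : LinTerm W)]
  abel

theorem adjugate_mem (S : Subring ℤ[X]) {A : Matrix ι ι ℤ[X]} (hA : ∀ i j, A i j ∈ S) :
    A.det ∈ S ∧ ∀ i j, A.adjugate i j ∈ S := by
  have hdet : ∀ A : Matrix ι ι ℤ[X], (∀ i j, A i j ∈ S) → A.det ∈ S := by
    intro A hA
    rw [Matrix.det_apply']
    exact S.sum_mem fun σ _ => S.mul_mem (intCast_mem S _) (S.prod_mem fun i _ => hA _ _)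
  refine ⟨hdet A hA, fun i j => ?_⟩
  rw [Matrix.adjugate_apply]
  refine hdet _ fun i' j' => ?_
  rw [Matrix.updateRow_apply]
  split_ifs
  · rw [Pi.single_apply]
    split_ifs
    · exact S.one_mem
    · exact S.zero_mem
  · exact hA _ _

/-- Only ring operations are used, so coefficients remain in any subring containing the input
coefficients. Applied to the constant polynomials, this gives integer bounds and divisors; nothing
is claimed about the constants of the terms. -/
theorem reduced_mem (S : Subring ℤ[X]) (hr : ∀ i w, (r i).2 w ∈ S) :
    (pivotMatrix x r).det ∈ S ∧ (∀ l w, (reducedPivot x r l).2 w ∈ S) ∧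
      ∀ ρ : LinTerm W, (∀ w, ρ.2 w ∈ S) → ∀ w, (reduced x r ρ).2 w ∈ S := by
  obtain ⟨hdet, hadj⟩ := adjugate_mem S (A := pivotMatrix x r) fun i l => hr i (x l)
  have hp : ∀ l w, (reducedPivot x r l).2 w ∈ S := by
    intro l w
    rw [reducedPivot, LinTerm.sum_smul_apply]
    exact S.sum_mem fun i _ => S.mul_mem (hadj l i) (hr i w)
  refine ⟨hdet, hp, fun ρ hρ w => ?_⟩
  rw [reduced_apply]
  exact S.sub_mem (S.mul_mem hdet (hρ w)) (S.sum_mem fun l _ => S.mul_mem (hρ _) (hp l w))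

end Elimination

/-! ### Exact division and the vigorous substitution -/

section Quotients

variable {W : Type*}

theorem quot_mul {q : ℤ[X]} (hq : q ≠ 0) (p : ℤ[X]) : quot q (q * p) = p := by
  have h : ∃ c, q * p = q * c := ⟨p, rfl⟩
  rw [quot, dif_pos h]
  exact (mul_left_cancel₀ hq h.choose_spec).symm

theorem quotTerm_smul {q : ℤ[X]} (hq : q ≠ 0) (ρ : LinTerm W) : quotTerm q (q • ρ) = ρ := by
  refine Prod.ext (quot_mul hq ρ.1) (Finsupp.ext fun w => ?_)
  simp only [quotTerm, Finsupp.onFinset_apply, Prod.smul_snd, Finsupp.smul_apply, smul_eq_mul,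
    quot_mul hq, mul_eq_zero, hq, false_or]
  split_ifs with h
  · exact h.symm
  · rfl

theorem vigTerm_eq {V : Type*} (x : QVar V) (η ρ : LinTerm (QVar V)) :
    vigTerm x η ρ = η.2 x • ρ - ρ.2 x • η := by
  simp only [vigTerm, smul_sub, LinTerm.smul_mono, mul_comm (ρ.2 x)]
  abel

end Quotients

end BoundedQE

/-! ### The invariant of `BoundedQE` -/

theorem PosBool.map_id' {A : Type*} (φ : PosBool A) : (φ.map fun a => a) = φ := by
  induction φ with
  | atom a => rfl
  | and φ ψ ih₁ ih₂ => exact congrArg₂ PosBool.and ih₁ ih₂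
  | or φ ψ ih₁ ih₂ => exact congrArg₂ PosBool.or ih₁ ih₂

namespace BoundedQE

variable {V : Type*}

/-- The linear term of the equality into which a constraint is turned by `addSlack`. -/
noncomputable def slackRow (c : Constraint (LinTerm V)) : LinTerm (QVar V) := (addSlack c).term

theorem lift_apply_inl (τ : LinTerm V) (v : V) : (lift τ).2 (.inl v) = τ.2 v :=
  Finsupp.mapDomain_apply Sum.inl_injective _ _

theorem lift_apply_inr (τ : LinTerm V) (σ : LinTerm V) : (lift τ).2 (.inr σ) = 0 :=
  Finsupp.mapDomain_of_notMem_range _ _ (by simp)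

theorem slackRow_apply_inl (c : Constraint (LinTerm V)) (v : V) :
    (slackRow c).2 (.inl v) = c.term.2 v := by
  cases c with
  | eq τ => exact lift_apply_inl τ v
  | le τ =>
    have h : (slackRow (.le τ)).2 (.inl v) =
      (lift τ).2 (.inl v) + (LinTerm.mono (Sum.inr τ : QVar V) 1).2 (.inl v) := rfl
    rw [h, lift_apply_inl, LinTerm.mono_apply_of_ne (by simp), add_zero]
    rfl
  | dvd f τ => exact lift_apply_inl τ v

open Classical in
theorem slackRow_apply_inr (c : Constraint (LinTerm V)) (σ : LinTerm V) :
    (slackRow c).2 (.inr σ) = if c = .le σ then 1 else 0 := by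
  cases c with
  | eq τ =>
    have h : (slackRow (.eq τ)).2 (.inr σ) = 0 := lift_apply_inr τ σ
    simp [h]
  | le τ =>
    have h : (slackRow (.le τ)).2 (.inr σ) =
      (lift τ).2 (.inr σ) + (LinTerm.mono (Sum.inr τ : QVar V) 1).2 (.inr σ) := rfl
    rw [h, lift_apply_inr, zero_add]
    simp only [Constraint.le.injEq]
    split_ifs with hσ
    · rw [hσ, LinTerm.mono_apply_self]
    · rw [LinTerm.mono_apply_of_ne (by simpa using hσ)]
  | dvd f τ =>
    have h : (slackRow (.dvd f τ)).2 (.inr σ) = 0 := lift_apply_inr τ σ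
    simp [h]

theorem slackRow_apply_inr_ne_zero {c : Constraint (LinTerm V)} {σ : LinTerm V} :
    (slackRow c).2 (.inr σ) ≠ 0 ↔ c = .le σ := by
  classical
  rw [slackRow_apply_inr]
  split_ifs with h <;> simp [h]

/-- The inputs considered here: there are no divisibility constraints, and the coefficients of
the variables are integers. -/
structure IsIntegral (φ : LinFormula V) : Prop where
  divisor : ∀ c ∈ φ.atoms, c.divisor? = none
  coeff : ∀ c ∈ φ.atoms, ∀ v, c.term.2 v ∈ (C : ℤ →+* ℤ[X]).range

theorem IsIntegral.slackRow_mem {φ : LinFormula V} (hφ : IsIntegral φ) {c : Constraint (LinTerm V)}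
    (hc : c ∈ φ.atoms) (w : QVar V) : (slackRow c).2 w ∈ (C : ℤ →+* ℤ[X]).range := by
  classical
  rcases w with v | σ
  · rw [slackRow_apply_inl]; exact hφ.coeff c hc v
  · rw [slackRow_apply_inr]
    split_ifs
    · exact one_mem _
    · exact zero_mem _

/-- The variables `x l` have been eliminated with the equalities obtained from the constraints
`row l` of the input `φ`; the variables in `done` have been treated. -/
structure Invariant (φ : LinFormula V) (done : List V) (s : State V) {ι : Type} [Fintype ι]
    [DecidableEq ι] (x : ι → V) (row : ι → Constraint (LinTerm V)) : Prop where
  row_mem : ∀ i, row i ∈ φ.atoms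
  det_eq : (pivotMatrix (fun l => (Sum.inl (x l) : QVar V)) fun i => slackRow (row i)).det = s.lead
  lead_ne : s.lead ≠ 0
  formula : ∃ L : List (Constraint (LinTerm (QVar V))),
    s.φ = (φ.map fun c => .eq (reduced (fun l => (Sum.inl (x l) : QVar V))
      (fun i => slackRow (row i)) (slackRow c))).andAll (L.map .atom) ∧
    ∀ c, c ∈ L ↔ ∃ l, c = .dvd s.lead (reducedPivot (fun l => (Sum.inl (x l) : QVar V))
      (fun i => slackRow (row i)) l - LinTerm.mono (.inl (x l)) s.lead)
  bound_inr : ∀ τ, s.B (.inr τ) ≠ none ↔ ∃ i, row i = .le τ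
  col_mem : ∀ l, x l ∈ done
  covered : ∀ v ∈ done, s.B (.inl v) ≠ none ∨ ∃ l, x l = v
  bound_inl : ∀ v, s.B (.inl v) ≠ none → v ∈ done ∧ ∀ l, x l ≠ v
  m_mem : s.m ∈ (C : ℤ →+* ℤ[X]).range
  bound_mem : ∀ v p, s.B v = some p → p ∈ (C : ℤ →+* ℤ[X]).range
  bound_finite : {v | s.B v ≠ none}.Finite
  χ_atoms : ∀ c ∈ s.χ.atoms, ∃ f, c = .le (LinTerm.const f)
  sign_pos : ∀ k ν, s.χ.Holds (Constraint.Holds k (LinTerm.eval k ν)) →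
    0 < (s.sign : ℤ) * s.lead.eval k

theorem divisors_eq_empty {φ : LinFormula V} (h : ∀ c ∈ φ.atoms, c.divisor? = none) :
    divisors φ = ∅ := by
  have h' : φ.atoms.filterMap Constraint.divisor? = [] := List.filterMap_eq_nil_iff.2 h
  simp [divisors, h']

theorem zeroOut_empty (φ : LinFormula V) : zeroOut ∅ φ = φ := by
  have h : φ.map (replaceZero ∅) = φ := by
    refine (PosBool.map_congr fun c _ => ?_).trans (PosBool.map_id' φ)
    cases c <;> simp [replaceZero]
  simp [zeroOut, h, PosBool.andAll]

theorem init_empty {φ : LinFormula V} (h : ∀ c ∈ φ.atoms, c.divisor? = none) (e : ℤˣ) :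
    init φ ∅ e = ⟨φ.map addSlack, C (e : ℤ), 1, 1, fun _ => none, pos (C (e : ℤ))⟩ := by
  simp [init, zeroOut_empty, divisors_eq_empty h]

/-- There is no pivot yet: the empty matrix has determinant 1, which is the initial leading
coefficient, and reduction is the identity. -/
theorem invariant_init {φ : LinFormula V} (hφ : IsIntegral φ) (e : ℤˣ) :
    Invariant φ [] (init φ ∅ e) (ι := Empty) Empty.elim Empty.elim := by
  rw [init_empty hφ.divisor]
  refine ⟨fun i => i.elim, ?_, one_ne_zero, ⟨[], ?_, ?_⟩, ?_, fun l => l.elim, by simp, by simp,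
    ⟨_, rfl⟩, by simp, by simp, ?_, by simp⟩
  · simp [Matrix.det_isEmpty]
  · refine PosBool.map_congr fun c hc => ?_
    have h : ∀ ρ, reduced (ι := Empty) (fun l => (Sum.inl (Empty.elim l) : QVar V))
        (fun i => slackRow (Empty.elim i)) ρ = ρ := by
      intro ρ
      simp [reduced, Matrix.det_isEmpty]
    rw [h]
    have hc' := hφ.divisor c hc
    cases c with
    | eq τ => rfl
    | le τ => rfl
    | dvd f τ => cases hc'
  · simp
  · simp
  · simp [pos, PosBool.atoms]

/-! ### Preservation of the invariant by an iteration -/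

section Steps

variable {φ : LinFormula V} {done : List V} {s : State V} {ι : Type} [Fintype ι]
  [DecidableEq ι] {x : ι → V} {row : ι → Constraint (LinTerm V)}

theorem skip_bound_self (v : V) : (skip v s).B (.inl v) = some (s.m - 1) := by
  simp [skip]

theorem skip_bound_of_ne {v : V} {w : QVar V} (hw : w ≠ .inl v) : (skip v s).B w = s.B w := by
  simp [skip, hw]

theorem Invariant.skip (h : Invariant φ done s x row) {v : V} (hv : v ∉ done) :
    Invariant φ (v :: done) (skip v s) x row where
  row_mem := h.row_mem
  det_eq := h.det_eq
  lead_ne := h.lead_ne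
  formula := h.formula
  bound_inr τ := by
    rw [← h.bound_inr τ, skip_bound_of_ne (by simp)]
  col_mem l := List.mem_cons_of_mem _ (h.col_mem l)
  covered u hu := by
    by_cases huv : u = v
    · left; rw [huv, skip_bound_self]; simp
    · have hB : (BoundedQE.skip v s).B (.inl u) = s.B (.inl u) := skip_bound_of_ne (by simpa using huv)
      rw [hB]
      exact h.covered u ((List.mem_cons.1 hu).resolve_left huv)
  bound_inl u hu := by
    by_cases huv : u = v
    · subst huv
      exact ⟨List.mem_cons_self, fun l hl => hv (hl ▸ h.col_mem l)⟩
    · have hB : (BoundedQE.skip v s).B (.inl u) = s.B (.inl u) := skip_bound_of_ne (by simpa using huv)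
      rw [hB] at hu
      exact ⟨List.mem_cons_of_mem _ (h.bound_inl u hu).1, (h.bound_inl u hu).2⟩
  m_mem := h.m_mem
  bound_mem w p hp := by
    by_cases hw : w = .inl v
    · subst hw
      rw [skip_bound_self] at hp
      exact Option.some.inj hp ▸ sub_mem h.m_mem (one_mem _)
    · rw [skip_bound_of_ne hw] at hp
      exact h.bound_mem w p hp
  bound_finite := by
    refine (h.bound_finite.insert (.inl v)).subset fun w hw => ?_
    by_cases hwv : w = .inl v
    · exact Or.inl hwv
    · rw [Set.mem_ofPred_eq, skip_bound_of_ne hwv] at hw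
      exact Or.inr hw
  χ_atoms := h.χ_atoms
  sign_pos := h.sign_pos

theorem Invariant.exists_of_eq_mem (h : Invariant φ done s x row) {η : LinTerm (QVar V)}
    (hη : Constraint.eq η ∈ s.φ.atoms) : ∃ c ∈ φ.atoms,
      η = reduced (fun l => (Sum.inl (x l) : QVar V)) (fun i => slackRow (row i)) (slackRow c) := by
  obtain ⟨L, hL, hLmem⟩ := h.formula
  rw [hL] at hη
  rcases PosBool.mem_atoms_andAll.1 hη with hη | ⟨ψ, hψ, hη⟩
  · obtain ⟨c, hc, hcη⟩ := PosBool.mem_atoms_map.1 hη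
    exact ⟨c, hc, (Constraint.eq.inj hcη).symm⟩
  · obtain ⟨c, hc, rfl⟩ := List.mem_map.1 hψ
    obtain ⟨l, rfl⟩ := (hLmem c).1 hc
    simp [PosBool.atoms] at hη

theorem reducedPivot_apply_eq_zero {W : Type*} {X : ι → W} {R : ι → LinTerm W} {w : W}
    (hw : ∀ i, (R i).2 w = 0) (l : ι) : (reducedPivot X R l).2 w = 0 := by
  rw [reducedPivot, LinTerm.sum_smul_apply]
  exact Finset.sum_eq_zero fun i _ => by rw [hw, mul_zero]

theorem reduced_apply_of_eq_zero {W : Type*} {X : ι → W} {R : ι → LinTerm W} {w : W}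
    (hw : ∀ i, (R i).2 w = 0) (ρ : LinTerm W) :
    (reduced X R ρ).2 w = (pivotMatrix X R).det * ρ.2 w := by
  rw [reduced_apply, Finset.sum_eq_zero, sub_zero]
  intro l _
  rw [reducedPivot_apply_eq_zero hw, mul_zero]

/-- The coefficients of a slack variable without bound. -/
theorem Invariant.slack_apply (h : Invariant φ done s x row) {τ : LinTerm V}
    (hτ : s.B (.inr τ) = none) (i : ι) : (slackRow (row i)).2 (.inr τ) = 0 := by
  by_contra hne
  exact ((h.bound_inr τ).2 ⟨i, slackRow_apply_inr_ne_zero.1 hne⟩) hτ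

/-- The index type grows by one point. Equality rows are handled by `smul_reduced_extend`, old
divisibilities by `smul_reducedPivot_extend_inl`, and the new one by `reducedPivot_extend_inr`. -/
theorem Invariant.pivot (hφ : IsIntegral φ) (h : Invariant φ done s x row) {v : V} (hv : v ∉ done)
    {c : Constraint (LinTerm V)} (hc : c ∈ φ.atoms) {η : LinTerm (QVar V)}
    (hη : η = reduced (fun l => (Sum.inl (x l) : QVar V)) (fun i => slackRow (row i)) (slackRow c))
    (hf : η.2 (.inl v) ≠ 0) (e : ℤˣ) :
    Invariant φ (v :: done) (pivot v η e s) (Sum.elim x fun _ : Unit => v)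
      (Sum.elim row fun _ : Unit => c) := by
  set X : ι → QVar V := fun l => Sum.inl (x l) with hX
  set R : ι → LinTerm (QVar V) := fun i => slackRow (row i) with hR
  have hX' : (fun l => (Sum.inl ((Sum.elim x fun _ : Unit => v) l) : QVar V)) =
      Sum.elim X fun _ : Unit => Sum.inl v := by
    funext l; rcases l with l | l <;> rfl
  have hR' : (fun i => slackRow ((Sum.elim row fun _ : Unit => c) i)) =
      Sum.elim R fun _ : Unit => slackRow c := by
    funext l; rcases l with l | l <;> rfl
  have hD : (pivotMatrix X R).det ≠ 0 := h.det_eq ▸ h.lead_ne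
  have hdet : (pivotMatrix (Sum.elim X fun _ : Unit => Sum.inl v)
      (Sum.elim R fun _ : Unit => slackRow c)).det = η.2 (.inl v) := by
    rw [det_pivotMatrix_extend hD, hη]
  have hRmem : ∀ i w, (R i).2 w ∈ (C : ℤ →+* ℤ[X]).range := fun i => hφ.slackRow_mem (h.row_mem i)
  have hηmem : ∀ w, η.2 w ∈ (C : ℤ →+* ℤ[X]).range := by
    intro w
    rw [hη]
    exact (reduced_mem _ hRmem).2.2 _ (hφ.slackRow_mem hc) w
  have hmmem : ((e : ℤ) • η.2 (.inl v)) * s.m ∈ (C : ℤ →+* ℤ[X]).range :=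
    mul_mem (zsmul_mem (hηmem _) _) h.m_mem
  have hηcol : ∀ l, η.2 (X l) = 0 := fun l => by rw [hη, reduced_apply_col]
  have hne : ∀ l, X l ≠ .inl v := fun l hl => hf (hl ▸ hηcol l)
  -- No earlier pivot row contains an unbounded slack variable, so reduction only multiplies its
  -- coefficient by the determinant. The equality guessed can therefore contain only the slack
  -- variable of its own constraint among those without bound.
  have hηslack : ∀ τ, s.B (.inr τ) = none → (η.2 (.inr τ) ≠ 0 ↔ c = .le τ) := by
    intro τ hτ
    rw [hη, reduced_apply_of_eq_zero (h.slack_apply hτ), ← slackRow_apply_inr_ne_zero]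
    exact ⟨right_ne_zero_of_mul, mul_ne_zero hD⟩
  have hBinl : ∀ u, (BoundedQE.pivot v η e s).B (.inl u) = s.B (.inl u) := by
    intro u; simp [BoundedQE.pivot]
  have hBinr : ∀ τ, (BoundedQE.pivot v η e s).B (.inr τ) =
      if η.2 (.inr τ) ≠ 0 ∧ s.B (.inr τ) = none then
        some (((e : ℤ) • η.2 (.inl v)) * s.m - 1) else s.B (.inr τ) := by
    intro τ
    have : (η - LinTerm.mono (Sum.inl v : QVar V) (η.2 (.inl v))).2 (.inr τ) = η.2 (.inr τ) := by
      rw [Prod.snd_sub, Finsupp.sub_apply, LinTerm.mono_apply_of_ne (by simp), sub_zero]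
    simp only [BoundedQE.pivot, this, Sum.isRight_inr, true_and]
  refine ⟨?_, ?_, hf, ?_, ?_, ?_, ?_, ?_, hmmem, ?_, ?_, ?_, ?_⟩
  · rintro (i | i)
    · exact h.row_mem i
    · exact hc
  · rw [hX', hR', hdet]; rfl
  · obtain ⟨L, hL, hLmem⟩ := h.formula
    rw [hX', hR']
    refine ⟨L.map (fun a => quotConstraint s.lead (vig (.inl v) η a)) ++
      [.dvd (η.2 (.inl v)) (η - LinTerm.mono (.inl v) (η.2 (.inl v)))], ?_, ?_⟩
    · simp only [BoundedQE.pivot]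
      rw [List.map_append, List.map_singleton, PosBool.andAll_concat, hL, PosBool.map_map,
        PosBool.map_andAll, PosBool.map_map]
      congr 2
      · refine PosBool.map_congr fun a _ => ?_
        simp only [vig, quotConstraint, vigTerm_eq]
        rw [← quotTerm_smul h.lead_ne (reduced (Sum.elim X _) _ _), ← h.det_eq,
          smul_reduced_extend hD (hη ▸ hf), ← hη]
      · rw [List.map_map, List.map_map]
        rfl
    · have hL' : ∀ l, quotConstraint s.lead (vig (.inl v) η
          (.dvd s.lead (reducedPivot X R l - LinTerm.mono (X l) s.lead))) =
          .dvd (η.2 (.inl v)) (reducedPivot (Sum.elim X fun _ : Unit => Sum.inl v)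
            (Sum.elim R fun _ : Unit => slackRow c) (.inl l) -
            LinTerm.mono (X l) (η.2 (.inl v))) := by
        intro l
        have hsmul := smul_reducedPivot_extend_inl (v := .inl v) (ρ₀ := slackRow c) hD (hη ▸ hf) l
        rw [← hη, h.det_eq] at hsmul
        simp only [vig, quotConstraint, vigTerm_eq, mul_comm _ s.lead, quot_mul h.lead_ne]
        congr 1
        rw [← quotTerm_smul h.lead_ne (reducedPivot (Sum.elim X _) _ _ - LinTerm.mono (X l) _),
          smul_sub s.lead (reducedPivot (Sum.elim X _) _ _), hsmul,
          Prod.snd_sub, Finsupp.sub_apply, LinTerm.mono_apply_of_ne (hne l), sub_zero, smul_sub,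
          LinTerm.smul_mono, LinTerm.smul_mono, mul_comm s.lead]
        congr 1
        abel
      have hnew := reducedPivot_extend_inr (v := .inl v) (ρ₀ := slackRow c) hD (hη ▸ hf)
      rw [← hη] at hnew
      intro a
      rw [List.mem_append, List.mem_map, List.mem_singleton]
      constructor
      · rintro (⟨b, hb, rfl⟩ | rfl)
        · obtain ⟨l, rfl⟩ := (hLmem b).1 hb
          exact ⟨.inl l, hL' l⟩
        · exact ⟨.inr (), by rw [hnew]; rfl⟩
      · rintro ⟨l | l, rfl⟩
        · exact Or.inl ⟨_, (hLmem _).2 ⟨l, rfl⟩, hL' l⟩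
        · refine Or.inr ?_
          rw [hnew]; rfl
  · intro τ
    rw [hBinr, Sum.exists]
    simp only [Sum.elim_inl, Sum.elim_inr, exists_const]
    by_cases hτ : s.B (.inr τ) = none
    · have hno : ¬ ∃ i, row i = .le τ := fun hex => (h.bound_inr τ).2 hex hτ
      rw [← hηslack τ hτ]
      simp only [hτ, and_true, hno, false_or]
      split_ifs with h0 <;> simp [h0]
    · simp only [hτ, and_false, if_false]
      simp [hτ, (h.bound_inr τ).1 hτ]
  · rintro (l | l)
    · exact List.mem_cons_of_mem _ (h.col_mem l)
    · exact List.mem_cons_self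
  · intro u hu
    rcases List.mem_cons.1 hu with rfl | hu
    · exact Or.inr ⟨.inr (), rfl⟩
    · rw [hBinl]
      exact (h.covered u hu).imp_right fun ⟨l, hl⟩ => ⟨.inl l, hl⟩
  · intro u hu
    rw [hBinl] at hu
    obtain ⟨hu₁, hu₂⟩ := h.bound_inl u hu
    refine ⟨List.mem_cons_of_mem _ hu₁, ?_⟩
    rintro (l | l)
    · exact hu₂ l
    · rintro rfl; exact hv hu₁
  · rintro (u | τ) p hp
    · rw [hBinl] at hp
      exact h.bound_mem _ p hp
    · rw [hBinr] at hp
      split_ifs at hp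
      · exact Option.some.inj hp ▸ sub_mem hmmem (one_mem _)
      · exact h.bound_mem _ p hp
  · refine (h.bound_finite.union η.2.support.finite_toSet).subset ?_
    rintro (u | τ) hw
    · rw [Set.mem_ofPred_eq, hBinl] at hw
      exact Or.inl hw
    · rw [Set.mem_ofPred_eq, hBinr] at hw
      split_ifs at hw with h0
      · exact Or.inr (Finsupp.mem_support_iff.2 h0.1)
      · exact Or.inl hw
  · intro a ha
    simp only [BoundedQE.pivot, PosBool.atoms, pos, List.mem_append, List.mem_singleton] at ha
    rcases ha with ha | ha
    · exact h.χ_atoms a ha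
    · exact ⟨_, ha⟩
  · intro k ν hχ
    have hp := hχ.2
    simp only [pos, PosBool.Holds, Constraint.Holds, LinTerm.eval_const, zsmul_eq_mul, eval_sub,
      eval_one, eval_mul, eval_intCast] at hp
    simp only [BoundedQE.pivot]
    push_cast at hp
    linarith

end Steps

theorem Loop.exists_invariant {φ : LinFormula V} (hφ : IsIntegral φ) (xs : List V) :
    ∀ {done : List V} {s s' : State V} {ι : Type} [Fintype ι] [DecidableEq ι] {x : ι → V}
      {row : ι → Constraint (LinTerm V)}, Invariant φ done s x row → xs.Nodup →
      (∀ v ∈ xs, v ∉ done) → Loop xs s s' →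
      ∃ (κ : Type) (_ : Fintype κ) (_ : DecidableEq κ) (x' : κ → V)
        (row' : κ → Constraint (LinTerm V)), Invariant φ (xs.reverse ++ done) s' x' row' := by
  induction xs with
  | nil =>
    rintro done s s' ι _ _ x row h - - rfl
    exact ⟨ι, _, _, x, row, h⟩
  | cons v xs ih =>
    rintro done s s' ι _ _ x row h hnd hdisj ⟨s₁, hstep, hloop⟩
    have hv : v ∉ done := hdisj v List.mem_cons_self
    have hdisj' : ∀ u ∈ xs, u ∉ v :: done := by
      intro u hu hu'
      rcases List.mem_cons.1 hu' with rfl | hu'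
      · exact (List.nodup_cons.1 hnd).1 hu
      · exact hdisj u (List.mem_cons_of_mem _ hu) hu'
    rw [List.reverse_cons, List.append_assoc, List.singleton_append]
    rcases hstep with rfl | ⟨η, e, hη, hf, rfl⟩
    · exact ih (h.skip hv) (List.nodup_cons.1 hnd).2 hdisj' hloop
    · obtain ⟨c, hc, hηc⟩ := h.exists_of_eq_mem hη
      exact ih (h.pivot hφ hv hc hηc hf e) (List.nodup_cons.1 hnd).2 hdisj' hloop

/-! ### Finiteness of the set of branches of `BoundedQE` -/

theorem finite_setOf_step (v : V) (s : State V) : {s' | Step v s s'}.Finite := by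
  have hη : {η | Constraint.eq η ∈ s.φ.atoms}.Finite :=
    (List.finite_toSet s.φ.atoms).preimage fun _ _ _ _ h => Constraint.eq.inj h
  refine ((Set.finite_singleton (skip v s)).union
    ((hη.prod (Set.finite_univ (α := ℤˣ))).image fun q => pivot v q.1 q.2 s)).subset ?_
  rintro s' (rfl | ⟨η, e, h, -, rfl⟩)
  · exact Or.inl rfl
  · exact Or.inr ⟨(η, e), ⟨h, trivial⟩, rfl⟩

theorem finite_setOf_loop (xs : List V) (s : State V) : {s' | Loop xs s s'}.Finite := by
  induction xs generalizing s with
  | nil => exact Set.finite_singleton s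
  | cons v xs ih =>
    refine ((finite_setOf_step v s).biUnion fun s₁ _ => ih s₁).subset ?_
    rintro s' ⟨s₁, h₁, h₂⟩
    exact Set.mem_biUnion (x := s₁) h₁ h₂

end BoundedQE

theorem finite_boundedQE {V : Type*} (xs : List V) (φ : LinFormula V) :
    (boundedQE xs φ).Finite := by
  refine (((BoundedQE.divisors φ).powerset.finite_toSet).biUnion fun Zs _ =>
    (Set.finite_univ (α := ℤˣ)).biUnion fun e _ =>
      (BoundedQE.finite_setOf_loop xs (BoundedQE.init φ Zs e)).image BoundedQE.result).subset ?_
  rintro β ⟨Zs, hZs, e, s, hs, rfl⟩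
  exact Set.mem_biUnion (Finset.mem_coe.2 (Finset.mem_powerset.2 hZs))
    (Set.mem_biUnion (Set.mem_univ e) ⟨s, hs, rfl⟩)

/-! ### The output of `BoundedQE` -/

namespace BoundedQE

variable {V : Type*} {φ : LinFormula V} {done : List V} {s : State V} {ι : Type} [Fintype ι]
  [DecidableEq ι] {x : ι → V} {row : ι → Constraint (LinTerm V)}

theorem Invariant.reduced_apply_inr (h : Invariant φ done s x row) {σ : LinTerm V}
    (hσ : s.B (.inr σ) = none) (c : Constraint (LinTerm V)) :
    ((reduced (fun l => (Sum.inl (x l) : QVar V)) (fun i => slackRow (row i)) (slackRow c)).2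
      (.inr σ) ≠ 0 ↔ c = .le σ) := by
  rw [reduced_apply_of_eq_zero (h.slack_apply hσ), h.det_eq, ← slackRow_apply_inr_ne_zero]
  exact ⟨right_ne_zero_of_mul, mul_ne_zero h.lead_ne⟩

theorem Invariant.reducedPivot_sub_apply (h : Invariant φ done s x row) (l l' : ι) :
    (reducedPivot (fun l => (Sum.inl (x l) : QVar V)) (fun i => slackRow (row i)) l -
      LinTerm.mono (Sum.inl (x l) : QVar V) s.lead).2 (.inl (x l')) = 0 := by
  have hp := reducedPivot_apply (fun l => (Sum.inl (x l) : QVar V)) (fun i => slackRow (row i))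
  rw [h.det_eq] at hp
  rw [Prod.snd_sub, Finsupp.sub_apply, hp l l']
  split_ifs with hl
  · rw [hl, LinTerm.mono_apply_self, sub_self]
  · rw [LinTerm.mono_apply_of_ne, sub_zero]
    -- Two distinct indices cannot share a column, since the reduced pivot row would have both the
    -- nonzero determinant and 0 there.
    intro hx
    have h₁ := hp l l
    have h₂ := hp l l'
    simp only [if_true, if_neg hl] at h₁ h₂
    exact h.lead_ne (by rw [← h₁, hx, h₂])

theorem Invariant.injective (h : Invariant φ done s x row) : Function.Injective x := by
  intro l l' hl
  by_contra hne
  have hp := reducedPivot_apply (fun l => (Sum.inl (x l) : QVar V)) (fun i => slackRow (row i)) l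
  have h₁ := hp l
  have h₂ := hp l'
  simp only [if_true, if_neg hne] at h₁ h₂
  rw [hl, h₂, h.det_eq] at h₁
  exact h.lead_ne h₁.symm

theorem Invariant.dropSlack_of_bound (h : Invariant φ done s x row) {c : Constraint (LinTerm V)}
    (hc : ∀ τ, c = .le τ → s.B (.inr τ) ≠ none) :
    dropSlack s (.eq (reduced (fun l => (Sum.inl (x l) : QVar V)) (fun i => slackRow (row i))
      (slackRow c))) = .eq (reduced (fun l => (Sum.inl (x l) : QVar V))
        (fun i => slackRow (row i)) (slackRow c)) := by
  refine if_neg ?_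
  rintro ⟨u | σ, hright, hne, hnone⟩
  · simp at hright
  · exact hc σ ((h.reduced_apply_inr hnone c).1 hne) hnone

/-- The deleted slack variable has coefficient exactly `s.lead` in its own reduced row, and no other
unbounded slack variable occurs there. -/
theorem Invariant.dropSlack_of_unbounded (h : Invariant φ done s x row) {τ : LinTerm V}
    (hτ : s.B (.inr τ) = none) :
    dropSlack s (.eq (reduced (fun l => (Sum.inl (x l) : QVar V)) (fun i => slackRow (row i))
      (slackRow (.le τ)))) = .le ((s.sign : ℤ) • (reduced (fun l => (Sum.inl (x l) : QVar V))
        (fun i => slackRow (row i)) (slackRow (.le τ)) - LinTerm.mono (.inr τ) s.lead)) := by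
  classical
  refine (if_pos ⟨.inr τ, rfl, (h.reduced_apply_inr hτ _).2 rfl, hτ⟩).trans ?_
  congr 2
  refine Prod.ext (by simp [LinTerm.mono]) (Finsupp.ext fun w => ?_)
  rw [Prod.snd_sub, Finsupp.sub_apply, Finsupp.filter_apply]
  split_ifs with hw
  · rcases w with u | σ
    · simp at hw
    · by_cases hσ : τ = σ
      · subst hσ
        rw [LinTerm.mono_apply_self, reduced_apply_of_eq_zero (h.slack_apply hτ), h.det_eq,
          slackRow_apply_inr, if_pos rfl, mul_one, sub_self]
      · rw [LinTerm.mono_apply_of_ne (by simpa using hσ), sub_zero]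
        by_contra hne
        exact hσ (Constraint.le.inj ((h.reduced_apply_inr hw.2 _).1 (Ne.symm hne)))
  · rw [LinTerm.mono_apply_of_ne, sub_zero]
    rintro rfl
    exact hw ⟨rfl, hτ⟩

/-- The atoms of the output. -/
theorem Invariant.mem_atoms_result (h : Invariant φ done s x row)
    {a : Constraint (LinTerm (QVar V))} (ha : a ∈ (result s).body.atoms) :
    (∃ c ∈ φ.atoms, a = dropSlack s (.eq (reduced (fun l => (Sum.inl (x l) : QVar V))
      (fun i => slackRow (row i)) (slackRow c)))) ∨
    (∃ l, a = .dvd s.lead (reducedPivot (fun l => (Sum.inl (x l) : QVar V))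
      (fun i => slackRow (row i)) l - LinTerm.mono (.inl (x l)) s.lead)) ∨
    ∃ f, a = .le (LinTerm.const f) := by
  obtain ⟨L, hL, hLmem⟩ := h.formula
  simp only [result, PosBool.atoms, List.mem_append] at ha
  rcases ha with ha | ha
  · obtain ⟨b, hb, rfl⟩ := PosBool.mem_atoms_map.1 ha
    rw [hL] at hb
    rcases PosBool.mem_atoms_andAll.1 hb with hb | ⟨ψ, hψ, hb⟩
    · obtain ⟨c, hc, rfl⟩ := PosBool.mem_atoms_map.1 hb
      exact Or.inl ⟨c, hc, rfl⟩
    · obtain ⟨d, hd, rfl⟩ := List.mem_map.1 hψ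
      obtain ⟨l, rfl⟩ := (hLmem d).1 hd
      simp only [PosBool.atoms, List.mem_singleton] at hb
      subst hb
      exact Or.inr (Or.inl ⟨l, rfl⟩)
  · exact Or.inr (Or.inr (h.χ_atoms a ha))

theorem Invariant.holds_result (h : Invariant φ done s x row) (k : ℤ) (ω : QVar V → ℤ) :
    (result s).body.Holds (Constraint.Holds k (LinTerm.eval k ω)) ↔
      (φ.Holds fun c => (dropSlack s (.eq (reduced (fun l => (Sum.inl (x l) : QVar V))
        (fun i => slackRow (row i)) (slackRow c)))).Holds k (LinTerm.eval k ω)) ∧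
      (∀ l, s.lead.eval k ∣ LinTerm.eval k ω (reducedPivot (fun l => (Sum.inl (x l) : QVar V))
        (fun i => slackRow (row i)) l - LinTerm.mono (.inl (x l)) s.lead)) ∧
      s.χ.Holds (Constraint.Holds k (LinTerm.eval k ω)) := by
  obtain ⟨L, hL, hLmem⟩ := h.formula
  have hiff : (∀ c ∈ L, (PosBool.atom c).Holds
      fun a => (dropSlack s a).Holds k (LinTerm.eval k ω)) ↔
      ∀ l, s.lead.eval k ∣ LinTerm.eval k ω (reducedPivot (fun l => (Sum.inl (x l) : QVar V))
        (fun i => slackRow (row i)) l - LinTerm.mono (.inl (x l)) s.lead) := by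
    constructor
    · intro hall l
      exact hall _ ((hLmem _).2 ⟨l, rfl⟩)
    · intro hall c hc
      obtain ⟨l, rfl⟩ := (hLmem c).1 hc
      exact hall l
  rw [← hiff]
  change ((s.φ.map (dropSlack s)).Holds _ ∧ s.χ.Holds _) ↔ _
  rw [PosBool.holds_map, hL, PosBool.holds_andAll, PosBool.holds_map, List.forall_mem_map, and_assoc]

theorem Invariant.reduced_apply_inl (h : Invariant φ done s x row) {c : Constraint (LinTerm V)}
    {u : V} (hu : (reduced (fun l => (Sum.inl (x l) : QVar V)) (fun i => slackRow (row i))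
      (slackRow c)).2 (.inl u) ≠ 0) : s.B (.inl u) ≠ none ∨ u ∉ done := by
  by_contra! hcon
  obtain ⟨l, rfl⟩ := (h.covered u hcon.2).resolve_left (not_not.2 hcon.1)
  exact hu (reduced_apply_col _ _ _ l)

/-- In the output, all variables are either bounded or have not been treated. -/
theorem Invariant.closed (h : Invariant φ done s x row) {a : Constraint (LinTerm (QVar V))}
    (ha : a ∈ (result s).body.atoms) {w : QVar V} (hw : a.term.2 w ≠ 0) :
    s.B w ≠ none ∨ ∃ u, u ∉ done ∧ w = .inl u := by
  rcases h.mem_atoms_result ha with ⟨c, -, rfl⟩ | ⟨l, rfl⟩ | ⟨f, rfl⟩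
  · by_cases hc : ∀ τ, c = .le τ → s.B (.inr τ) ≠ none
    · rw [h.dropSlack_of_bound hc] at hw
      rcases w with u | σ
      · exact (h.reduced_apply_inl hw).imp_right fun hu => ⟨u, hu, rfl⟩
      · refine Or.inl fun hσ => ?_
        exact hc σ ((h.reduced_apply_inr hσ c).1 hw) hσ
    · push Not at hc
      obtain ⟨τ, rfl, hτ⟩ := hc
      rw [h.dropSlack_of_unbounded hτ] at hw
      have hw' := right_ne_zero_of_smul hw
      rw [Prod.snd_sub, Finsupp.sub_apply] at hw'
      rcases w with u | σ
      · rw [LinTerm.mono_apply_of_ne (by simp), sub_zero] at hw'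
        exact (h.reduced_apply_inl hw').imp_right fun hu => ⟨u, hu, rfl⟩
      · refine Or.inl fun hσ => ?_
        by_cases hτσ : τ = σ
        · subst hτσ
          rw [LinTerm.mono_apply_self, reduced_apply_of_eq_zero (h.slack_apply hτ), h.det_eq,
            slackRow_apply_inr, if_pos rfl, mul_one, sub_self] at hw'
          exact hw' rfl
        · rw [LinTerm.mono_apply_of_ne (by simpa using hτσ), sub_zero] at hw'
          exact hτσ (Constraint.le.inj ((h.reduced_apply_inr hσ _).1 hw'))
  · rcases w with u | σ
    · by_contra! hcon
      have hu : u ∈ done := by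
        by_contra hu
        exact hcon.2 u hu rfl
      obtain ⟨l', rfl⟩ := (h.covered u hu).resolve_left (not_not.2 hcon.1)
      exact hw (h.reducedPivot_sub_apply l l')
    · refine Or.inl fun hσ => hw ?_
      change (_ - LinTerm.mono _ _ : LinTerm (QVar V)).2 _ = 0
      rw [Prod.snd_sub, Finsupp.sub_apply, LinTerm.mono_apply_of_ne (by simp),
        reducedPivot_apply_eq_zero (h.slack_apply hσ), sub_zero]
  · exact (hw rfl).elim

/-- The values of the slack variables. -/
noncomputable def withSlack (k : ℤ) (ν : V → ℤ) : QVar V → ℤ :=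
  Sum.elim ν fun τ => -LinTerm.eval k ν τ

theorem eval_lift (k : ℤ) (ω : QVar V → ℤ) (τ : LinTerm V) :
    LinTerm.eval k ω (lift τ) = LinTerm.eval k (fun v => ω (.inl v)) τ :=
  LinTerm.eval_mapDomain k ω Sum.inl τ

theorem eval_slackRow_le (k : ℤ) (ω : QVar V → ℤ) (τ : LinTerm V) :
    LinTerm.eval k ω (slackRow (.le τ)) =
      LinTerm.eval k (fun v => ω (.inl v)) τ + ω (.inr τ) := by
  have h : slackRow (.le τ) = lift τ + LinTerm.mono (.inr τ) 1 := rfl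
  rw [h, LinTerm.eval_add, eval_lift, LinTerm.eval_mono, eval_one, one_mul]

theorem eval_withSlack_slackRow_le (k : ℤ) (ν : V → ℤ) (τ : LinTerm V) :
    LinTerm.eval k (withSlack k ν) (slackRow (.le τ)) = 0 := by
  rw [eval_slackRow_le]
  exact add_neg_cancel _

theorem eval_withSlack_slackRow_eq (k : ℤ) (ν : V → ℤ) (τ : LinTerm V) :
    LinTerm.eval k (withSlack k ν) (slackRow (.eq τ)) = LinTerm.eval k ν τ :=
  eval_lift k _ τ

theorem eval_reducedPivot_eq_zero {W : Type*} {X : ι → W} {R : ι → LinTerm W} {k : ℤ} {ω : W → ℤ}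
    (h : ∀ i, LinTerm.eval k ω (R i) = 0) (l : ι) : LinTerm.eval k ω (reducedPivot X R l) = 0 := by
  rw [reducedPivot, LinTerm.eval_sum]
  exact Finset.sum_eq_zero fun i _ => by rw [LinTerm.eval_smul, h, mul_zero]

theorem eval_reduced {W : Type*} {X : ι → W} {R : ι → LinTerm W} {k : ℤ} {ω : W → ℤ}
    (h : ∀ i, LinTerm.eval k ω (R i) = 0) (ρ : LinTerm W) :
    LinTerm.eval k ω (reduced X R ρ) = (pivotMatrix X R).det.eval k * LinTerm.eval k ω ρ := by
  rw [reduced, LinTerm.eval_sub, LinTerm.eval_sum, LinTerm.eval_smul, Finset.sum_eq_zero, sub_zero]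
  exact fun l _ => by rw [LinTerm.eval_smul, eval_reducedPivot_eq_zero h, mul_zero]

/-- The original pivot rows are recovered from the reduced ones, up to a factor that does not vanish
at `k`. -/
theorem eval_row_eq_zero {W : Type*} {X : ι → W} {R : ι → LinTerm W} {k : ℤ} {ω : W → ℤ}
    (hD : (pivotMatrix X R).det.eval k ≠ 0)
    (h : ∀ l, LinTerm.eval k ω (reducedPivot X R l) = 0) (i : ι) : LinTerm.eval k ω (R i) = 0 := by
  have hs := congrArg (LinTerm.eval k ω) (sum_smul_reducedPivot X R i)
  rw [LinTerm.eval_sum, LinTerm.eval_smul, Finset.sum_eq_zero] at hs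
  · exact (mul_eq_zero.1 hs.symm).resolve_left hD
  · exact fun l _ => by rw [LinTerm.eval_smul, h, mul_zero]

theorem eval_units_smul {W : Type*} (k : ℤ) (ω : W → ℤ) (e : ℤ) (ρ : LinTerm W) :
    LinTerm.eval k ω (e • ρ) = e * LinTerm.eval k ω ρ := by
  rw [← Int.cast_smul_eq_zsmul ℤ[X], LinTerm.eval_smul, eval_intCast]
  rfl

/-- The constraints of the output have the same truth value as those of the input. -/
theorem Invariant.holds_dropSlack_iff (h : Invariant φ done s x row) (hφ : IsIntegral φ) {k : ℤ}
    {ν : V → ℤ} (hrow : ∀ i, LinTerm.eval k (withSlack k ν) (slackRow (row i)) = 0)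
    (hsign : 0 < (s.sign : ℤ) * s.lead.eval k)
    (hB : ∀ τ, s.B (.inr τ) ≠ none → LinTerm.eval k ν τ ≤ 0)
    {c : Constraint (LinTerm V)} (hc : c ∈ φ.atoms) :
    (dropSlack s (.eq (reduced (fun l => (Sum.inl (x l) : QVar V)) (fun i => slackRow (row i))
      (slackRow c)))).Holds k (LinTerm.eval k (withSlack k ν)) ↔
      c.Holds k (LinTerm.eval k ν) := by
  have hred := eval_reduced (X := fun l => (Sum.inl (x l) : QVar V)) hrow
  rw [h.det_eq] at hred
  have hne : s.lead.eval k ≠ 0 := right_ne_zero_of_mul hsign.ne'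
  have hdiv := hφ.divisor c hc
  cases c with
  | eq τ =>
    rw [h.dropSlack_of_bound (by simp)]
    simp only [Constraint.Holds, hred, eval_withSlack_slackRow_eq, mul_eq_zero, hne, false_or]
  | le τ =>
    by_cases hτ : s.B (.inr τ) = none
    · rw [h.dropSlack_of_unbounded hτ]
      simp only [Constraint.Holds, eval_units_smul, LinTerm.eval_sub, hred,
        eval_withSlack_slackRow_le, LinTerm.eval_mono]
      have hval : withSlack k ν (.inr τ) = -LinTerm.eval k ν τ := rfl
      rw [hval]
      constructor
      · intro h0
        by_contra! hpos
        nlinarith [mul_pos hsign hpos]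
      · intro h0
        nlinarith [mul_nonneg hsign.le (neg_nonneg.2 h0)]
    · rw [h.dropSlack_of_bound (by rintro _ ⟨⟩; exact hτ)]
      simp only [Constraint.Holds, hred, eval_withSlack_slackRow_le, mul_zero, true_iff]
      exact hB τ hτ
  | dvd f τ => cases hdiv

/-- Every solution of the output can be completed to a solution of the input. -/
theorem Invariant.exists_holds_of_result (h : Invariant φ done s x row) (hφ : IsIntegral φ) {k : ℤ}
    {ω : QVar V → ℤ} (hω : ∀ w p, s.B w = some p → 0 ≤ ω w)
    (hres : (result s).body.Holds (Constraint.Holds k (LinTerm.eval k ω))) :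
    ∃ ν : V → ℤ, (∀ v, v ∉ done → ν v = ω (.inl v)) ∧
      φ.Holds (Constraint.Holds k (LinTerm.eval k ν)) := by
  obtain ⟨hatoms, hdvd, hχ⟩ := (h.holds_result k ω).1 hres
  have hsign := h.sign_pos k ω hχ
  have hne : s.lead.eval k ≠ 0 := right_ne_zero_of_mul hsign.ne'
  choose q hq using hdvd
  -- The reduced pivot row for `x l` reads `lead * x l + (rest) = 0`, and the divisibility writes
  -- the rest as `lead * q l`. Hence `x l = -q l`.
  set ν : V → ℤ := Function.extend x (fun l => -q l) fun v => ω (.inl v) with hν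
  have hνcol : ∀ l, ν (x l) = -q l := fun l => h.injective.extend_apply _ _ l
  have hνne : ∀ v, (∀ l, x l ≠ v) → ν v = ω (.inl v) := fun v hv =>
    Function.extend_apply' _ _ _ fun ⟨l, hl⟩ => hv l hl
  set ω' : QVar V → ℤ := Sum.elim ν fun τ => ω (.inr τ) with hω'
  have hpiv : ∀ l, LinTerm.eval k ω' (reducedPivot (fun l => (Sum.inl (x l) : QVar V))
      (fun i => slackRow (row i)) l) = 0 := by
    intro l
    have hcongr : LinTerm.eval k ω' (reducedPivot (fun l => (Sum.inl (x l) : QVar V))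
        (fun i => slackRow (row i)) l - LinTerm.mono (.inl (x l)) s.lead) = s.lead.eval k * q l := by
      rw [← hq]
      refine LinTerm.eval_congr fun w hw => ?_
      rcases w with u | σ
      · refine hνne u fun l' hl' => hw ?_
        rw [← hl']
        exact h.reducedPivot_sub_apply l l'
      · rfl
    rw [LinTerm.eval_sub, LinTerm.eval_mono] at hcongr
    have hval : ω' (.inl (x l)) = -q l := hνcol l
    rw [hval] at hcongr
    linarith
  have hrow' := eval_row_eq_zero (by rwa [h.det_eq]) hpiv
  -- A bounded slack variable belongs to a pivot row, and the vanishing of that row forces its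
  -- value. Unbounded ones no longer occur in the output and may be given their natural value.
  have hslack : ∀ τ, s.B (.inr τ) ≠ none → ω (.inr τ) = -LinTerm.eval k ν τ := by
    intro τ hτ
    obtain ⟨i, hi⟩ := (h.bound_inr τ).1 hτ
    have := hrow' i
    simp only [hi] at this
    rw [eval_slackRow_le] at this
    exact eq_neg_of_add_eq_zero_right this
  have hrow : ∀ i, LinTerm.eval k (withSlack k ν) (slackRow (row i)) = 0 := by
    intro i
    rw [← hrow' i]
    refine LinTerm.eval_congr fun w hw => ?_
    rcases w with u | σ
    · rfl
    · exact (hslack σ ((h.bound_inr σ).2 ⟨i, slackRow_apply_inr_ne_zero.1 hw⟩)).symm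
  refine ⟨ν, fun v hv => hνne v fun l hl => hv (hl ▸ h.col_mem l), ?_⟩
  refine PosBool.Holds.mono (fun c hc hcω => ?_) hatoms
  refine (h.holds_dropSlack_iff hφ hrow hsign (fun τ hτ => ?_) hc).1 ?_
  · obtain ⟨p, hp⟩ := Option.ne_none_iff_exists'.1 hτ
    have h₁ := hω _ p hp
    have h₂ := hslack τ hτ
    linarith
  · refine (Constraint.holds_congr ?_).1 hcω
    refine LinTerm.eval_congr fun w hw => ?_
    have hmem : dropSlack s (.eq (reduced (fun l => (Sum.inl (x l) : QVar V))
        (fun i => slackRow (row i)) (slackRow c))) ∈ (result s).body.atoms := by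
      obtain ⟨L, hL, -⟩ := h.formula
      refine List.mem_append_left _ (PosBool.mem_atoms_map.2 ⟨_, ?_, rfl⟩)
      rw [hL]
      exact PosBool.mem_atoms_andAll.2 (Or.inl (PosBool.mem_atoms_map.2 ⟨c, hc, rfl⟩))
    rcases h.closed hmem hw with hB | ⟨u, hu, rfl⟩
    · rcases w with u | σ
      · exact (hνne u (h.bound_inl u hB).2).symm
      · exact hslack σ hB
    · exact (hνne u fun l hl => hu (hl ▸ h.col_mem l)).symm

end BoundedQE

/-! ### Completeness of `BoundedQE` -/

namespace LinTerm

variable {V : Type*}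

theorem dot_add_right (k : ℤ) (u u' : V → ℤ) (ρ : LinTerm V) :
    dot k (u + u') ρ = dot k u ρ + dot k u' ρ := by
  unfold dot Finsupp.sum
  rw [← Finset.sum_add_distrib]
  exact Finset.sum_congr rfl fun v _ => mul_add _ _ _

theorem dot_smul_right (k a : ℤ) (u : V → ℤ) (ρ : LinTerm V) :
    dot k (a • u) ρ = a * dot k u ρ := by
  unfold dot Finsupp.sum
  rw [Finset.mul_sum]
  exact Finset.sum_congr rfl fun v _ => mul_left_comm _ _ _

theorem dot_sum_right {ι : Type*} (k : ℤ) (t : Finset ι) (u : ι → V → ℤ) (ρ : LinTerm V) :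
    dot k (∑ i ∈ t, u i) ρ = ∑ i ∈ t, dot k (u i) ρ := by
  classical
  induction t using Finset.induction_on with
  | empty => simp [dot]
  | insert i t hi ih => rw [Finset.sum_insert hi, Finset.sum_insert hi, dot_add_right, ih]

theorem dot_single [DecidableEq V] (k : ℤ) (v : V) (ρ : LinTerm V) :
    dot k (Pi.single v 1) ρ = (ρ.2 v).eval k := by
  unfold dot Finsupp.sum
  by_cases hv : v ∈ ρ.2.support
  · rw [Finset.sum_eq_single_of_mem v hv]
    · simp
    · intro w _ hw
      simp [hw]
  · rw [Finset.sum_eq_zero, Finsupp.notMem_support_iff.1 hv, Polynomial.eval_zero]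
    intro w hw
    have : w ≠ v := fun h => hv (h ▸ hw)
    simp [this]

end LinTerm

namespace BoundedQE

variable {V : Type*} {φ : LinFormula V} {done : List V} {s : State V} {ι : Type} [Fintype ι]
  [DecidableEq ι] {x : ι → V} {row : ι → Constraint (LinTerm V)}

theorem pivot_bound_inl (v : V) (η : LinTerm (QVar V)) (e : ℤˣ) (s : State V) (u : V) :
    (pivot v η e s).B (.inl u) = s.B (.inl u) := by
  simp [pivot]

theorem pivot_bound_inr (v : V) (η : LinTerm (QVar V)) (e : ℤˣ) (s : State V) (τ : LinTerm V)
    {p : ℤ[X]} (hp : (pivot v η e s).B (.inr τ) = some p) :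
    s.B (.inr τ) = some p ∨ (s.B (.inr τ) = none ∧ η.2 (.inr τ) ≠ 0 ∧
      p = ((e : ℤ) • η.2 (.inl v)) * s.m - 1) := by
  have hη : (η - LinTerm.mono (Sum.inl v : QVar V) (η.2 (.inl v))).2 (.inr τ) = η.2 (.inr τ) := by
    rw [Prod.snd_sub, Finsupp.sub_apply, LinTerm.mono_apply_of_ne (by simp), sub_zero]
  simp only [pivot, hη, Sum.isRight_inr, true_and] at hp
  split_ifs at hp with h0
  · exact Or.inr ⟨h0.2, h0.1, (Option.some.inj hp).symm⟩
  · exact Or.inl hp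

/-- The values `ν` of the variables of the input satisfy `φ`, and with the corresponding values of
the slack variables they agree with the choices made so far. -/
structure Witness (φ : LinFormula V) (s : State V) (row : ι → Constraint (LinTerm V)) (k : ℤ)
    (ν : V → ℤ) : Prop where
  holds : φ.Holds (Constraint.Holds k (LinTerm.eval k ν))
  row_eq : ∀ i, LinTerm.eval k (withSlack k ν) (slackRow (row i)) = 0
  bound : ∀ w p, s.B w = some p → 0 ≤ withSlack k ν w ∧ withSlack k ν w ≤ p.eval k
  lead_le : |s.lead.eval k| ≤ s.m.eval k
  χ_holds : ∀ ω, s.χ.Holds (Constraint.Holds k (LinTerm.eval k ω))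

open Classical in
/-- The direction in which `v` can be shifted, the pivot rows being preserved. -/
noncomputable def direction (k : ℤ) (s : State V) (x : ι → V) (row : ι → Constraint (LinTerm V))
    (v : V) : V → ℤ :=
  s.lead.eval k • Pi.single v 1 + ∑ l, (-((reducedPivot (fun l => (Sum.inl (x l) : QVar V))
    (fun i => slackRow (row i)) l).2 (.inl v)).eval k) • Pi.single (x l) 1

theorem direction_apply_self {k : ℤ} {v : V} (hv : ∀ l, x l ≠ v) :
    direction k s x row v v = s.lead.eval k := by
  simp [direction, fun l => (hv l).symm]

theorem direction_apply_of_ne {k : ℤ} {v u : V} (hvu : u ≠ v) (hu : ∀ l, x l ≠ u) :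
    direction k s x row v u = 0 := by
  simp [direction, fun l => (hu l).symm, hvu]

/-- Along this direction a constraint changes at the rate given by the coefficient of `v` in its
reduced row. In particular a nonzero rate makes that row eligible as the next pivot. -/
theorem Invariant.dot_direction (h : Invariant φ done s x row) (k : ℤ) (v : V)
    (c : Constraint (LinTerm V)) : LinTerm.dot k (direction k s x row v) c.term =
      ((reduced (fun l => (Sum.inl (x l) : QVar V)) (fun i => slackRow (row i)) (slackRow c)).2
        (.inl v)).eval k := by
  classical
  rw [direction, LinTerm.dot_add_right, LinTerm.dot_smul_right, LinTerm.dot_sum_right,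
    LinTerm.dot_single, reduced_apply, h.det_eq]
  simp only [LinTerm.dot_smul_right, LinTerm.dot_single, slackRow_apply_inl, eval_sub, eval_mul,
    eval_finsetSum]
  rw [sub_eq_add_neg, ← Finset.sum_neg_distrib]
  congr 1
  exact Finset.sum_congr rfl fun l _ => by ring

theorem reduced_row {W : Type*} (X : ι → W) (R : ι → LinTerm W) (i : ι) :
    reduced X R (R i) = 0 := by
  rw [reduced, sum_smul_reducedPivot, sub_self]

theorem Invariant.dot_direction_row (h : Invariant φ done s x row) (k : ℤ) (v : V) (i : ι) :
    LinTerm.dot k (direction k s x row v) (row i).term = 0 := by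
  rw [h.dot_direction k v, reduced_row _ (fun i => slackRow (row i)) i]
  simp

/-- Pivot rows do not vary along the direction, so bounded slack variables keep their values;
bounded input variables are neither `v` nor pivot columns. Only the truth of the formula has to be
supplied. -/
theorem Witness.shift (h : Invariant φ done s x row) (hφ : IsIntegral φ) {k : ℤ} {ν : V → ℤ}
    (hw : Witness φ s row k ν) {v : V} (hv : v ∉ done) (a : ℤ)
    (hholds : φ.Holds (Constraint.Holds k
      (LinTerm.eval k fun u => ν u + a * direction k s x row v u))) :
    Witness φ s row k fun u => ν u + a * direction k s x row v u where
  holds := hholds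
  row_eq i := by
    have hdot := h.dot_direction_row k v i
    have hrow := hw.row_eq i
    have hdiv := hφ.divisor _ (h.row_mem i)
    cases hi : row i with
    | eq τ =>
      rw [hi] at hdot hrow
      rw [eval_withSlack_slackRow_eq] at hrow ⊢
      rw [LinTerm.eval_shift, hrow]
      simp only [Constraint.term] at hdot
      rw [hdot, mul_zero, add_zero]
    | le τ => exact eval_withSlack_slackRow_le k _ τ
    | dvd f τ => rw [hi] at hdiv; cases hdiv
  bound w p hp := by
    have hwp := hw.bound w p hp
    suffices hval : withSlack k (fun u => ν u + a * direction k s x row v u) w =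
        withSlack k ν w by rwa [hval]
    rcases w with u | τ
    · obtain ⟨hu, hcol⟩ := h.bound_inl u (by rw [hp]; simp)
      have huv : u ≠ v := fun huv => hv (huv ▸ hu)
      change ν u + _ = ν u
      rw [direction_apply_of_ne huv hcol, mul_zero, add_zero]
    · obtain ⟨i, hi⟩ := (h.bound_inr τ).1 (by rw [hp]; simp)
      have hdot := h.dot_direction_row k v i
      rw [hi] at hdot
      change -LinTerm.eval k _ τ = -LinTerm.eval k ν τ
      simp only [Constraint.term] at hdot
      rw [LinTerm.eval_shift, hdot, mul_zero, add_zero]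
  lead_le := hw.lead_le
  χ_holds := hw.χ_holds

theorem Invariant.lead_eval_ne (h : Invariant φ done s x row) {k : ℤ} {ν : V → ℤ}
    (hw : Witness φ s row k ν) : s.lead.eval k ≠ 0 :=
  right_ne_zero_of_mul (h.sign_pos k (fun _ => 0) (hw.χ_holds _)).ne'

omit [Fintype ι] [DecidableEq ι] in
theorem Witness.skip {k : ℤ} {ν : V → ℤ}
    (hw : Witness φ s row k ν) {v : V} (hv₀ : 0 ≤ ν v) (hv₁ : ν v < |s.lead.eval k|) :
    Witness φ (skip v s) row k ν where
  holds := hw.holds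
  row_eq := hw.row_eq
  bound w p hp := by
    by_cases hwv : w = .inl v
    · subst hwv
      rw [skip_bound_self] at hp
      rw [← Option.some.inj hp, eval_sub, eval_one]
      have := hw.lead_le
      exact ⟨hv₀, Int.le_sub_one_of_lt (hv₁.trans_le this)⟩
    · rw [skip_bound_of_ne hwv] at hp
      exact hw.bound w p hp
  lead_le := hw.lead_le
  χ_holds := hw.χ_holds

/-- The new bound is `|f(k)| m(k) - 1` once the sign is chosen to make the pivot positive at `k`. A
slack value below `|f(k)|` fits because `m(k) ≥ 1`. -/
theorem Invariant.exists_pivot (h : Invariant φ done s x row) (hφ : IsIntegral φ) {k : ℤ}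
    {ν : V → ℤ} (hw : Witness φ s row k ν) {v : V} (hv : v ∉ done) {c : Constraint (LinTerm V)}
    (hc : c ∈ φ.atoms) (hcν : LinTerm.eval k (withSlack k ν) (slackRow c) = 0)
    (hdot : LinTerm.dot k (direction k s x row v) c.term ≠ 0)
    (hslack : ∀ τ, c = .le τ → LinTerm.eval k ν τ ≤ 0 ∧
      -LinTerm.eval k ν τ < |LinTerm.dot k (direction k s x row v) c.term|) :
    ∃ s₁, Step v s s₁ ∧ Invariant φ (v :: done) s₁ (Sum.elim x fun _ : Unit => v)
      (Sum.elim row fun _ : Unit => c) ∧ Witness φ s₁ (Sum.elim row fun _ : Unit => c) k ν := by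
  rw [h.dot_direction k v c] at hdot hslack
  set η := reduced (fun l => (Sum.inl (x l) : QVar V)) (fun i => slackRow (row i)) (slackRow c)
    with hη
  have hf : η.2 (.inl v) ≠ 0 := fun h0 => hdot (by rw [h0, eval_zero])
  obtain ⟨e, he⟩ : ∃ e : ℤˣ, (e : ℤ) * (η.2 (.inl v)).eval k = |(η.2 (.inl v)).eval k| := by
    rcases le_total 0 ((η.2 (.inl v)).eval k) with h0 | h0
    · exact ⟨1, by rw [abs_of_nonneg h0]; simp⟩
    · exact ⟨-1, by rw [abs_of_nonpos h0]; simp⟩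
  have hmem : Constraint.eq η ∈ s.φ.atoms := by
    obtain ⟨L, hL, -⟩ := h.formula
    rw [hL]
    exact PosBool.mem_atoms_andAll.2 (Or.inl (PosBool.mem_atoms_map.2 ⟨c, hc, rfl⟩))
  -- The leading coefficient is a nonzero integer at `k`, and `m` dominates its absolute value.
  have hm : 1 ≤ s.m.eval k :=
    (Int.one_le_abs (h.lead_eval_ne hw)).trans hw.lead_le
  have hef : (((e : ℤ) • η.2 (.inl v)) : ℤ[X]).eval k = |(η.2 (.inl v)).eval k| := by
    rw [← he, zsmul_eq_mul, eval_mul, eval_intCast]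
    rfl
  have habs : |(η.2 (.inl v)).eval k| ≤ |(η.2 (.inl v)).eval k| * s.m.eval k :=
    le_mul_of_one_le_right (abs_nonneg _) hm
  refine ⟨BoundedQE.pivot v η e s, Or.inr ⟨η, e, hmem, hf, rfl⟩, h.pivot hφ hv hc hη hf e, ?_⟩
  refine ⟨hw.holds, ?_, ?_, ?_, ?_⟩
  · rintro (i | i)
    · exact hw.row_eq i
    · exact hcν
  · rintro (u | τ) p hp
    · rw [pivot_bound_inl] at hp
      exact hw.bound _ p hp
    · rcases pivot_bound_inr v η e s τ hp with hp | ⟨hnone, hτ, rfl⟩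
      · exact hw.bound _ p hp
      · obtain ⟨h₁, h₂⟩ := hslack τ ((h.reduced_apply_inr hnone c).1 hτ)
        rw [eval_sub, eval_mul, hef, eval_one]
        have hval : withSlack k ν (.inr τ) = -LinTerm.eval k ν τ := rfl
        rw [hval]
        exact ⟨by linarith, Int.le_sub_one_of_lt (h₂.trans_le habs)⟩
  · change |(η.2 (.inl v)).eval k| ≤ (((e : ℤ) • η.2 (.inl v)) * s.m : ℤ[X]).eval k
    rw [eval_mul, hef]
    exact habs
  · intro ω
    refine ⟨hw.χ_holds ω, ?_⟩
    simp only [pos, PosBool.Holds, Constraint.Holds, LinTerm.eval_const, eval_sub, eval_one, hef]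
    have := Int.one_le_abs hdot
    linarith

/-- A solution can be shifted until some slack variable becomes small. -/
theorem exists_shift {k : ℤ} {ν u : V → ℤ} {τ₀ : LinTerm V} (hmem : Constraint.le τ₀ ∈ φ.atoms)
    (hτ₀ : LinTerm.eval k ν τ₀ ≤ 0) (hdot₀ : LinTerm.dot k u τ₀ ≠ 0) :
    ∃ a : ℤ, (∀ τ, Constraint.le τ ∈ φ.atoms → LinTerm.eval k ν τ ≤ 0 →
        LinTerm.eval k ν τ + a * LinTerm.dot k u τ ≤ 0) ∧
      ∃ τ, Constraint.le τ ∈ φ.atoms ∧ LinTerm.dot k u τ ≠ 0 ∧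
        LinTerm.eval k ν τ + a * LinTerm.dot k u τ ≤ 0 ∧
        -(LinTerm.eval k ν τ + a * LinTerm.dot k u τ) < |LinTerm.dot k u τ| := by
  classical
  obtain ⟨t, ht, htpos⟩ : ∃ t : ℤ, (t = 1 ∨ t = -1) ∧ 0 < t * LinTerm.dot k u τ₀ := by
    rcases lt_or_gt_of_ne hdot₀ with h0 | h0
    · exact ⟨-1, Or.inr rfl, by linarith⟩
    · exact ⟨1, Or.inl rfl, by linarith⟩
  -- The smallest number of unit moves, oriented so that `τ₀` increases, after which some initially
  -- true inequality fails. Just before it, all of them hold, and one has slack smaller than its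
  -- rate of change. Initially false inequalities are ignored.
  set P : ℕ → Prop := fun m => ∃ τ, Constraint.le τ ∈ φ.atoms ∧ LinTerm.eval k ν τ ≤ 0 ∧
    0 < LinTerm.eval k ν τ + m * (t * LinTerm.dot k u τ) with hP
  have hex : ∃ m, P m := by
    refine ⟨(LinTerm.eval k ν τ₀).natAbs + 1, τ₀, hmem, hτ₀, ?_⟩
    push_cast [Int.natCast_natAbs]
    rw [abs_of_nonpos hτ₀]
    nlinarith
  have hzero : ¬ P 0 := by
    rintro ⟨τ, -, hle, hlt⟩
    push_cast at hlt
    linarith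
  obtain ⟨m, hm⟩ := Nat.exists_eq_succ_of_ne_zero
    (fun h0 => hzero (h0 ▸ Nat.find_spec hex) : Nat.find hex ≠ 0)
  have hnot : ¬ P m := Nat.find_min hex (by omega)
  have hall : ∀ τ, Constraint.le τ ∈ φ.atoms → LinTerm.eval k ν τ ≤ 0 →
      LinTerm.eval k ν τ + m * t * LinTerm.dot k u τ ≤ 0 := by
    intro τ hτ hle
    by_contra! hlt
    exact hnot ⟨τ, hτ, hle, by linarith⟩
  refine ⟨m * t, hall, ?_⟩
  obtain ⟨τ, hτ, hle, hlt⟩ := Nat.find_spec hex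
  rw [hm] at hlt
  push_cast at hlt
  have hbound := hall τ hτ hle
  have htle : t * LinTerm.dot k u τ ≤ |LinTerm.dot k u τ| := by
    rcases ht with rfl | rfl
    · rw [one_mul]; exact le_abs_self _
    · rw [neg_one_mul]; exact neg_le_abs _
  refine ⟨τ, hτ, fun h0 => ?_, hbound, by linarith⟩
  rw [h0] at hlt
  linarith

/-- Only constraints true at `ν` matter. A varying true equality is a pivot at once. Otherwise a
varying true inequality allows a shift up to a nearly tight one, the true equalities being constant.
If nothing true varies, the shift is free and `v` can be brought into the range of a bounded
variable. -/
theorem Invariant.exists_step (h : Invariant φ done s x row) (hφ : IsIntegral φ) {k : ℤ}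
    {ν : V → ℤ} (hw : Witness φ s row k ν) {v : V} (hv : v ∉ done) :
    ∃ (s₁ : State V) (ν₁ : V → ℤ) (κ : Type) (_ : Fintype κ) (_ : DecidableEq κ) (x' : κ → V)
      (row' : κ → Constraint (LinTerm V)), Step v s s₁ ∧ Invariant φ (v :: done) s₁ x' row' ∧
      Witness φ s₁ row' k ν₁ ∧ ∀ u, u ∉ v :: done → ν₁ u = ν u := by
  have hcol : ∀ l, x l ≠ v := fun l hl => hv (hl ▸ h.col_mem l)
  have hfix : ∀ (a : ℤ) (u), u ∉ v :: done → ν u + a * direction k s x row v u = ν u := by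
    intro a u hu
    obtain ⟨huv, hud⟩ := List.ne_and_not_mem_of_not_mem_cons hu
    rw [direction_apply_of_ne huv fun l hl => hud (hl ▸ h.col_mem l), mul_zero, add_zero]
  by_cases hA : ∃ τ, Constraint.eq τ ∈ φ.atoms ∧ LinTerm.eval k ν τ = 0 ∧
      LinTerm.dot k (direction k s x row v) τ ≠ 0
  · obtain ⟨τ, hτ, hval, hdot⟩ := hA
    obtain ⟨s₁, h₁, h₂, h₃⟩ := h.exists_pivot hφ hw hv hτ
      ((eval_withSlack_slackRow_eq k ν τ).trans hval) hdot (by simp)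
    exact ⟨s₁, ν, _, _, _, _, _, h₁, h₂, h₃, fun u _ => rfl⟩
  · push Not at hA
    by_cases hB : ∃ τ, Constraint.le τ ∈ φ.atoms ∧ LinTerm.eval k ν τ ≤ 0 ∧
        LinTerm.dot k (direction k s x row v) τ ≠ 0
    · obtain ⟨τ₀, hτ₀, hval₀, hdot₀⟩ := hB
      obtain ⟨a, hall, τ, hτ, hdot, hle, hlt⟩ := exists_shift hτ₀ hval₀ hdot₀
      have hholds : φ.Holds (Constraint.Holds k
          (LinTerm.eval k fun u => ν u + a * direction k s x row v u)) := by
        refine PosBool.Holds.mono (fun c hc hcν => ?_) hw.holds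
        have hdiv := hφ.divisor c hc
        cases c with
        | eq σ =>
          simp only [Constraint.Holds] at hcν ⊢
          rw [LinTerm.eval_shift, hA σ hc hcν, hcν, mul_zero, add_zero]
        | le σ =>
          simp only [Constraint.Holds] at hcν ⊢
          rw [LinTerm.eval_shift]
          exact hall σ hc hcν
        | dvd f σ => cases hdiv
      obtain ⟨s₁, h₁, h₂, h₃⟩ := h.exists_pivot hφ (hw.shift h hφ hv a hholds) hv hτ
        (eval_withSlack_slackRow_le k _ τ) hdot (by
          rintro _ ⟨⟩
          rw [LinTerm.eval_shift]
          exact ⟨hle, hlt⟩)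
      exact ⟨s₁, _, _, _, _, _, _, h₁, h₂, h₃, hfix a⟩
    · push Not at hB
      set D := s.lead.eval k with hD
      have hD0 : D ≠ 0 := h.lead_eval_ne hw
      -- The coordinate `v` moves in steps of `D`, so this shift replaces it by its remainder modulo
      -- `D`, which is below `|D| ≤ m(k)`.
      have hholds : φ.Holds (Constraint.Holds k
          (LinTerm.eval k fun u => ν u + -(ν v / D) * direction k s x row v u)) := by
        refine PosBool.Holds.mono (fun c hc hcν => ?_) hw.holds
        have hdiv := hφ.divisor c hc
        cases c with
        | eq σ =>
          simp only [Constraint.Holds] at hcν ⊢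
          rw [LinTerm.eval_shift, hA σ hc hcν, hcν, mul_zero, add_zero]
        | le σ =>
          simp only [Constraint.Holds] at hcν ⊢
          rw [LinTerm.eval_shift, hB σ hc hcν, mul_zero, add_zero]
          exact hcν
        | dvd f σ => cases hdiv
      have hval : ν v + -(ν v / D) * direction k s x row v v = ν v % D := by
        rw [direction_apply_self hcol, ← hD, Int.emod_def]
        ring
      exact ⟨_, _, _, _, _, _, _, Or.inl rfl, h.skip hv,
        (hw.shift h hφ hv _ hholds).skip (hval ▸ Int.emod_nonneg _ hD0)
          (by rw [hval]; exact Int.emod_lt_abs _ hD0), hfix _⟩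

theorem Invariant.exists_loop (hφ : IsIntegral φ) {k : ℤ} (xs : List V) :
    ∀ {done : List V} {s : State V} {ι : Type} [Fintype ι] [DecidableEq ι] {x : ι → V}
      {row : ι → Constraint (LinTerm V)} {ν : V → ℤ}, Invariant φ done s x row →
      Witness φ s row k ν → xs.Nodup → (∀ v ∈ xs, v ∉ done) →
      ∃ (s' : State V) (ν' : V → ℤ) (κ : Type) (_ : Fintype κ) (_ : DecidableEq κ) (x' : κ → V)
        (row' : κ → Constraint (LinTerm V)), Loop xs s s' ∧
        Invariant φ (xs.reverse ++ done) s' x' row' ∧ Witness φ s' row' k ν' ∧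
        ∀ u, u ∉ xs.reverse ++ done → ν' u = ν u := by
  induction xs with
  | nil =>
    rintro done s ι _ _ x row ν h hw - -
    exact ⟨s, ν, ι, _, _, x, row, rfl, h, hw, fun _ _ => rfl⟩
  | cons v xs ih =>
    rintro done s ι _ _ x row ν h hw hnd hdisj
    have hv : v ∉ done := hdisj v List.mem_cons_self
    have hdisj' : ∀ u ∈ xs, u ∉ v :: done := by
      intro u hu hu'
      rcases List.mem_cons.1 hu' with rfl | hu'
      · exact (List.nodup_cons.1 hnd).1 hu
      · exact hdisj u (List.mem_cons_of_mem _ hu) hu'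
    obtain ⟨s₁, ν₁, κ, _, _, x₁, row₁, hstep, h₁, hw₁, hfix₁⟩ := h.exists_step hφ hw hv
    obtain ⟨s', ν', κ', i₁, i₂, x', row', hloop, h', hw', hfix'⟩ :=
      ih h₁ hw₁ (List.nodup_cons.1 hnd).2 hdisj'
    rw [List.reverse_cons, List.append_assoc, List.singleton_append]
    exact ⟨s', ν', κ', i₁, i₂, x', row', ⟨s₁, hstep, hloop⟩, h', hw', fun u hu =>
      (hfix' u hu).trans (hfix₁ u fun hu' => hu (List.mem_append_right _ hu'))⟩

theorem Witness.holds_result (h : Invariant φ done s x row) (hφ : IsIntegral φ) {k : ℤ}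
    {ν : V → ℤ} (hw : Witness φ s row k ν) :
    (result s).body.Holds (Constraint.Holds k (LinTerm.eval k (withSlack k ν))) := by
  refine (h.holds_result k _).2 ⟨?_, fun l => ?_, hw.χ_holds _⟩
  · refine PosBool.Holds.mono (fun c hc hcν => ?_) hw.holds
    refine (h.holds_dropSlack_iff hφ hw.row_eq (h.sign_pos k _ (hw.χ_holds fun _ => 0))
      (fun τ hτ => ?_) hc).2 hcν
    obtain ⟨p, hp⟩ := Option.ne_none_iff_exists'.1 hτ
    exact neg_nonneg.1 (hw.bound _ p hp).1
  · rw [LinTerm.eval_sub, eval_reducedPivot_eq_zero hw.row_eq, LinTerm.eval_mono, zero_sub]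
    exact (Dvd.intro _ rfl).neg_right

/-! ### Shape, soundness and completeness of `BoundedQE` -/

theorem exists_invariant_of_mem_boundedQE (hφ : IsIntegral φ) {xs : List V} (hxs : xs.Nodup)
    {β : BoundedFormula (QVar V)} (hβ : β ∈ boundedQE xs φ) :
    ∃ (s : State V) (κ : Type) (_ : Fintype κ) (_ : DecidableEq κ) (x' : κ → V)
      (row' : κ → Constraint (LinTerm V)), β = result s ∧ Invariant φ xs.reverse s x' row' := by
  obtain ⟨Zs, hZs, e, s, hloop, rfl⟩ := hβ
  rw [divisors_eq_empty hφ.divisor, Finset.subset_empty] at hZs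
  subst hZs
  obtain ⟨κ, i₁, i₂, x', row', h⟩ := hloop.exists_invariant hφ xs (invariant_init hφ e) hxs (by simp)
  rw [List.append_nil] at h
  exact ⟨s, κ, i₁, i₂, x', row', rfl, h⟩

/-- The shape of the outputs of `BoundedQE`. -/
theorem boundedQE_shape (hφ : IsIntegral φ) {xs : List V} (hxs : xs.Nodup)
    {β : BoundedFormula (QVar V)} (hβ : β ∈ boundedQE xs φ) :
    (∀ w p, β.bound w = some p → ∃ b : ℤ, p = C b) ∧ {w | β.bound w ≠ none}.Finite ∧
    (∀ a ∈ β.body.atoms, ∀ w, a.term.2 w ≠ 0 → β.bound w ≠ none ∨ ∃ u, u ∉ xs ∧ w = .inl u) ∧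
    (∀ v, β.bound (.inl v) ≠ none → v ∈ xs) ∧
    ∀ f τ, Constraint.dvd f τ ∈ β.body.atoms → ∃ d : ℤ, f = C d := by
  obtain ⟨s, κ, _, _, x', row', rfl, h⟩ := exists_invariant_of_mem_boundedQE hφ hxs hβ
  refine ⟨fun w p hp => ?_, h.bound_finite, fun a ha w hw => ?_,
    fun v hv => List.mem_reverse.1 (h.bound_inl v hv).1, fun f τ hf => ?_⟩
  · obtain ⟨b, hb⟩ := h.bound_mem w p hp
    exact ⟨b, hb.symm⟩
  · have hcl := h.closed ha hw
    simp only [List.mem_reverse] at hcl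
    exact hcl
  · rcases h.mem_atoms_result hf with ⟨c, hc, heq⟩ | ⟨l, heq⟩ | ⟨f', heq⟩
    · exfalso
      by_cases hc : ∀ τ, c = .le τ → s.B (.inr τ) ≠ none
      · rw [h.dropSlack_of_bound hc] at heq
        cases heq
      · push Not at hc
        obtain ⟨τ, rfl, hτ⟩ := hc
        rw [h.dropSlack_of_unbounded hτ] at heq
        cases heq
    · obtain ⟨d, hd⟩ := (reduced_mem (x := fun l => (Sum.inl (x' l) : QVar V)) _
        fun i => hφ.slackRow_mem (h.row_mem i)).1
      rw [h.det_eq] at hd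
      exact ⟨d, (Constraint.dvd.inj heq).1.trans hd.symm⟩
    · cases heq

/-- Only the lower bounds on the guessed variables matter here: for slack variables they encode the
inequalities. The upper bounds serve to make the set of guesses finite. -/
theorem boundedQE_sound (hφ : IsIntegral φ) {xs : List V} (hxs : xs.Nodup)
    {β : BoundedFormula (QVar V)} (hβ : β ∈ boundedQE xs φ) {k : ℤ} {ω : QVar V → ℤ}
    (hω : ∀ w p, β.bound w = some p → 0 ≤ ω w)
    (hbody : β.body.Holds (Constraint.Holds k (LinTerm.eval k ω))) :
    ∃ ν : V → ℤ, (∀ v, v ∉ xs → ν v = ω (.inl v)) ∧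
      φ.Holds (Constraint.Holds k (LinTerm.eval k ν)) := by
  obtain ⟨s, κ, _, _, x', row', rfl, h⟩ := exists_invariant_of_mem_boundedQE hφ hxs hβ
  simpa using h.exists_holds_of_result hφ hω hbody

theorem boundedQE_complete (hφ : IsIntegral φ) {xs : List V} (hxs : xs.Nodup) {k : ℤ} {ν : V → ℤ}
    (hν : φ.Holds (Constraint.Holds k (LinTerm.eval k ν))) :
    ∃ β ∈ boundedQE xs φ, ∃ ω : QVar V → ℤ,
      (∀ w p, β.bound w = some p → 0 ≤ ω w ∧ ω w ≤ p.eval k) ∧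
      (∀ v, v ∉ xs → ω (.inl v) = ν v) ∧
      β.body.Holds (Constraint.Holds k (LinTerm.eval k ω)) := by
  have hinit : Witness φ (init φ ∅ 1) (ι := Empty) Empty.elim k ν := by
    rw [init_empty hφ.divisor]
    refine ⟨hν, fun i => i.elim, by simp, by simp, fun ω => ?_⟩
    simp [pos, PosBool.Holds, Constraint.Holds]
  obtain ⟨s, ν', κ, _, _, x', row', hloop, h, hw, hfix⟩ :=
    Invariant.exists_loop hφ xs (invariant_init hφ 1) hinit hxs (by simp)
  refine ⟨result s, ⟨∅, Finset.empty_subset _, 1, s, hloop, rfl⟩, withSlack k ν', hw.bound,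
    fun v hv => hfix v (by simpa using hv), hw.holds_result h hφ⟩

end BoundedQE

/-! ### Correctness of `ElimBounded` -/

namespace ElimBounded

variable {n : ℕ} {Y Z : Type*}

theorem eval_abstractTerm (k : ℤ) (ν : Y ⊕ Term Z → ℤ) (η : MixedTerm Y Z) :
    LinTerm.eval k ν (abstractTerm η) =
      LinTerm.eval k (fun y => ν (.inl y)) η.1 + ν (.inr η.2) := by
  rw [abstractTerm, LinTerm.eval_add, LinTerm.eval_mono, eval_one, one_mul]
  congr 1
  exact LinTerm.eval_mapDomain k ν Sum.inl η.1

theorem holds_abstractFormula {k : ℤ} {ν : Y ⊕ Term Z → ℤ} {ζ : Z → ℤ}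
    (hν : ∀ τ, ν (.inr τ) = τ.eval k ζ) (φ : MixedFormula Y Z) :
    (abstractFormula φ).Holds (Constraint.Holds k (LinTerm.eval k ν)) ↔
      MixedFormula.Sat k (fun y => ν (.inl y)) ζ φ := by
  rw [abstractFormula, PosBool.holds_map, MixedFormula.Sat]
  refine PosBool.holds_congr fun c _ => ?_
  rw [Constraint.holds_map]
  refine Constraint.holds_congr ?_
  rw [eval_abstractTerm, hν, MixedTerm.eval]

/-- The exit condition of the loop makes the digit coefficients constant polynomials, and each
stored term enters with coefficient 1. -/
theorem isIntegral_abstractFormula {φ : MixedFormula Y Z}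
    (hdvd : ∀ c ∈ φ.atoms, c.divisor? = none) (hint : ¬ ∃ c ∈ φ.atoms, NonInteger c) :
    BoundedQE.IsIntegral (abstractFormula φ) where
  divisor c hc := by
    obtain ⟨a, ha, rfl⟩ := PosBool.mem_atoms_map.1 hc
    rw [Constraint.divisor?_map]
    exact hdvd a ha
  coeff c hc v := by
    obtain ⟨a, ha, rfl⟩ := PosBool.mem_atoms_map.1 hc
    rw [Constraint.term_map, abstractTerm, Prod.snd_add, Finsupp.add_apply]
    have hdeg : ∀ y, (a.term.1.2 y).natDegree = 0 := by
      intro y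
      by_contra hne
      refine hint ⟨a, ha, ?_⟩
      have hdiv := hdvd a ha
      cases a with
      | eq η => exact ⟨y, Nat.pos_of_ne_zero hne⟩
      | le η => exact ⟨y, Nat.pos_of_ne_zero hne⟩
      | dvd f η => cases hdiv
    refine add_mem ?_ ?_
    · rcases v with y | τ
      · change (a.term.1.2.mapDomain Sum.inl) (Sum.inl y) ∈ _
        rw [Finsupp.mapDomain_apply Sum.inl_injective]
        exact ⟨_, (eq_C_of_natDegree_eq_zero (hdeg y)).symm⟩
      · change (a.term.1.2.mapDomain Sum.inl) (Sum.inr τ) ∈ _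
        rw [Finsupp.mapDomain_of_notMem_range _ _ (by simp)]
        exact zero_mem _
    · by_cases hv : Sum.inr a.term.2 = v
      · subst hv
        rw [LinTerm.mono_apply_self]
        exact one_mem _
      · rw [LinTerm.mono_apply_of_ne hv]
        exact zero_mem _

theorem eval_restoreTerm (k : ℤ) (ζ : Z → ℤ) (g : QVar (Y ⊕ Term Z) → ℤ)
    (ρ : LinTerm (QVar (Y ⊕ Term Z))) : (restoreTerm g ρ).eval k ζ =
      LinTerm.eval k (fun v => (restoreVar g v).eval k ζ) ρ := by
  have key : ∀ l : List (QVar (Y ⊕ Term Z)),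
      (l.foldr (fun v r => ((restoreVar g v).smul (ρ.2 v)).add r) (.const ρ.1)).eval k ζ =
        ρ.1.eval k + (l.map fun v => (ρ.2 v).eval k * (restoreVar g v).eval k ζ).sum := by
    intro l
    induction l with
    | nil => simp [Term.eval]
    | cons v l ih =>
      rw [List.foldr_cons, Term.eval_add, Term.eval_smul, ih, List.map_cons, List.sum_cons]
      ring
  rw [restoreTerm, key, Finset.sum_map_toList]
  rfl

theorem sat_restore (k : ℤ) (ζ : Z → ℤ) (g : QVar (Y ⊕ Term Z) → ℤ)
    (ψ : LinFormula (QVar (Y ⊕ Term Z))) : (restore g ψ).Sat k ζ ↔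
      ψ.Holds (Constraint.Holds k (LinTerm.eval k fun v => (restoreVar g v).eval k ζ)) := by
  rw [restore, Formula.Sat, PosBool.holds_map]
  refine PosBool.holds_congr fun c _ => ?_
  rw [Constraint.holds_map]
  exact Constraint.holds_congr (eval_restoreTerm k ζ g _)

theorem finite_setOf_isGuess {V : Type*} {bound : V → Option ℤ[X]}
    (h : {v | bound v ≠ none}.Finite) : {g | IsGuess bound g}.Finite := by
  classical
  have : Finite {v | bound v ≠ none} := h
  -- A guess is determined by its values on the finitely many bounded variables, since it is 0
  -- elsewhere. The default in `getD` is never reached on that set.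
  refine ((Set.Finite.pi' (ι := {v | bound v ≠ none}) (κ := fun _ => ℤ)
    (t := fun v => Set.Icc 0 (((bound v).getD 0).coeff 0)) fun v => Set.finite_Icc _ _).image
    fun d v => if hv : v ∈ {v | bound v ≠ none} then d ⟨v, hv⟩ else 0).subset ?_
  intro g hg
  refine ⟨fun v => g v, ?_, ?_⟩
  · rintro ⟨v, hv⟩
    obtain ⟨p, hp⟩ := Option.ne_none_iff_exists'.1 hv
    obtain ⟨b, rfl, h₀, h₁⟩ := (hg v).1 p hp
    simpa [hp] using ⟨h₀, h₁⟩
  · funext v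
    dsimp only
    split_ifs with hv
    · rfl
    · exact ((hg v).2 (not_not.1 hv)).symm

end ElimBounded

open ElimBounded in
theorem mainTheorem5 {n : ℕ} {Z : Type*} (B : Fin n → ℤ[X]) (φ : Formula (Fin n ⊕ Z))
    (hφ : IsElimBoundedInput φ)
    (pick : MixedFormula (ElimBounded.Digit n (ElimBounded.maxBitSize B)) Z →
      Constraint (MixedTerm (ElimBounded.Digit n (ElimBounded.maxBitSize B)) Z))
    (hpick : ElimBounded.IsSelection pick) :
    (∀ φ₁ φ₂, ElimBounded.Reaches pick (ElimBounded.bitBlast B φ) φ₁ →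
      ElimBounded.LoopStep pick φ₁ φ₂ → ElimBounded.yDegree φ₂ < ElimBounded.yDegree φ₁) ∧
    (∀ φ', ElimBounded.LoopResult pick (ElimBounded.bitBlast B φ) φ' →
      ∀ β ∈ ElimBounded.callQE (ElimBounded.digits n (ElimBounded.maxBitSize B)) φ',
        (∀ v p, β.bound v = some p → ∃ b : ℤ, p = C b) ∧ ElimBounded.IsClosed β) ∧
    (elimBounded B φ pick).Finite ∧
    (∀ ψ ∈ elimBounded B φ pick, ∀ f τ, Constraint.dvd f τ ∈ ψ.atoms → ∃ d : ℤ, f = C d) ∧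
    (∀ k : ℤ, 2 ≤ k → ∀ ζ : Z → ℤ,
      BoundedSat B φ k ζ ↔ ∃ ψ ∈ elimBounded B φ pick, ψ.Sat k ζ) := by
  have hint : ∀ φ', LoopResult pick (bitBlast B φ) φ' →
      BoundedQE.IsIntegral (abstractFormula φ') := fun φ' h =>
    isIntegral_abstractFormula (h.1.divisor? hpick (bitBlast_divisor? hφ)) h.2
  have hnodup : ((digits n (maxBitSize B)).map
      (Sum.inl : _ → Digit n (maxBitSize B) ⊕ Term Z)).Nodup :=
    (nodup_digits n _).map Sum.inl_injective
  have hmem : ∀ u : Digit n (maxBitSize B) ⊕ Term Z,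
      u ∈ (digits n (maxBitSize B)).map Sum.inl ↔ ∃ y, u = .inl y := by
    intro u
    simp [mem_digits, eq_comm]
  refine ⟨fun φ₁ φ₂ _ h => h.yDegree_lt hpick, fun φ' h β hβ => ?_, ?_, ?_, fun k hk ζ => ?_⟩
  · obtain ⟨h₁, -, h₂, -, -⟩ := BoundedQE.boundedQE_shape (hint φ' h) hnodup hβ
    refine ⟨h₁, fun c hc ρ hρ v hv => ?_⟩
    have hterm : c.term = ρ := by rcases hρ with rfl | rfl | ⟨f, rfl⟩ <;> rfl
    refine (h₂ c hc v (by rw [hterm]; exact Finsupp.mem_support_iff.1 hv)).imp_right ?_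
    rintro ⟨u, hu, rfl⟩
    rcases u with y | τ
    · exact (hu ((hmem _).2 ⟨y, rfl⟩)).elim
    · exact ⟨τ, rfl⟩
  · have hfin : {φ' | LoopResult pick (bitBlast B φ) φ'}.Finite :=
      (finite_setOf_reaches hpick _).subset fun φ' h => h.1
    refine (hfin.biUnion fun φ' hφ' => (finite_boundedQE _ (abstractFormula φ')).biUnion
      fun β hβ => (finite_setOf_isGuess (BoundedQE.boundedQE_shape (hint φ' hφ') hnodup
        hβ).2.1).image fun g => restore g β.body).subset ?_
    rintro ψ ⟨φ', hφ', β, hβ, g, hg, rfl⟩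
    exact Set.mem_biUnion (x := φ') hφ' (Set.mem_biUnion hβ ⟨g, hg, rfl⟩)
  · rintro ψ ⟨φ', hφ', β, hβ, g, -, rfl⟩ f τ hf
    obtain ⟨c, hc, hcf⟩ := PosBool.mem_atoms_map.1 hf
    cases c with
    | eq ρ => cases hcf
    | le ρ => cases hcf
    | dvd f' ρ =>
      obtain ⟨d, hd⟩ := (BoundedQE.boundedQE_shape (hint φ' hφ') hnodup hβ).2.2.2.2 f' ρ hc
      exact ⟨d, (Constraint.dvd.inj hcf).1.symm.trans hd⟩
  · rw [boundedSat_iff_exists_digits hφ hk]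
    constructor
    · rintro ⟨ν, hν, hsat⟩
      obtain ⟨φ', hφ', hsat'⟩ := exists_loopResult_sat hpick hk hν _ hsat
      obtain ⟨β, hβ, ω, hω, hfix, hbody⟩ := BoundedQE.boundedQE_complete (hint φ' hφ') hnodup
        ((holds_abstractFormula (ν := Sum.elim ν fun τ => τ.eval k ζ) (fun _ => rfl) φ').2 hsat')
      obtain ⟨h₁, -, h₂, h₃, -⟩ := BoundedQE.boundedQE_shape (hint φ' hφ') hnodup hβ
      classical
      -- The guess is the satisfying assignment itself, cut off to 0 where there is no bound.
      refine ⟨_, ⟨φ', hφ', β, hβ, fun v => if β.bound v = none then 0 else ω v,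
        fun v => ⟨fun p hp => ?_, fun hv => if_pos hv⟩, rfl⟩, ?_⟩
      · obtain ⟨b, rfl⟩ := h₁ v p hp
        have hv := hω v _ hp
        rw [eval_C] at hv
        exact ⟨b, rfl, by simpa [hp] using hv⟩
      · rw [sat_restore]
        refine PosBool.Holds.mono (fun c hc hcω => (Constraint.holds_congr ?_).1 hcω) hbody
        refine LinTerm.eval_congr fun v hv => ?_
        rcases h₂ c hc v hv with hb | ⟨u, hu, rfl⟩
        · have hval : ω v = (Term.const (C (if β.bound v = none then 0 else ω v)) :
              Term Z).eval k ζ := by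
            simp [Term.eval, hb]
          -- A variable that stands for a term `τ(z)` is not among the eliminated ones, so it has no
          -- bound; the middle case is void.
          rcases v with (y | τ) | σ
          · exact hval
          · obtain ⟨y, hy⟩ := (hmem _).1 (h₃ _ hb)
            cases hy
          · exact hval
        · rcases u with y | τ
          · exact (hu ((hmem _).2 ⟨y, rfl⟩)).elim
          · exact hfix _ hu
    · rintro ⟨ψ, ⟨φ', hφ', β, hβ, g, hg, rfl⟩, hsat⟩
      rw [sat_restore] at hsat
      obtain ⟨-, -, -, h₃, -⟩ := BoundedQE.boundedQE_shape (hint φ' hφ') hnodup hβ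
      obtain ⟨ν, hfix, hν⟩ := BoundedQE.boundedQE_sound (hint φ' hφ') hnodup hβ
        (fun v p hp => by
          have hval : 0 ≤ (Term.const (C (g v)) : Term Z).eval k ζ := by
            obtain ⟨b, -, hb, -⟩ := (hg v).1 p hp
            simpa [Term.eval] using hb
          rcases v with (y | τ) | σ
          · exact hval
          · obtain ⟨y, hy⟩ := (hmem _).1 (h₃ (.inr τ) (by rw [hp]; simp))
            cases hy
          · exact hval) hsat
      have hsat' := (holds_abstractFormula (ζ := ζ) (fun τ => hfix (.inr τ) fun hτ => by
        obtain ⟨y, hy⟩ := (hmem _).1 hτ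
        cases hy) φ').1 hν
      -- Elimination gives arbitrary integers for the digits. Going back through the loop needs no
      -- bounds on them, and the initial formula then supplies the bounds.
      have hblast := hφ'.1.sat_of_sat hk hsat'
      exact ⟨_, ((sat_bitBlast hφ k _ ζ _ fun i => rfl).1 hblast).1, hblast⟩
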